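/- Let $\hbar>0$, $q=e^{\pi i\hbar}$, $q^\vee=e^{\pi i/\hbar}$. **The algebra.** Let $T_q$ be the quantum torus over $\mathbb Z[q,q^{-1}]$ ($q$ a formal variable) generated by $X^{\pm1},Y^{\pm1}$ with $q^{-1}XY=qYX$, with the involutive antiautomorphism $*q=q^{-1}$, $*X=X$, $*Y=Y$. Put $$v_0=X^{-1},\quad v_1=Y,\quad v_2=(1+qY)X,\quad v_3=Y^{-1}+qXY^{-1}+X,\quad v_4=Y^{-1}+qY^{-1}X^{-1}.$$ For $(a,b)\in\mathbb Z^2$ let $\mathbb I^q(a,b)$ be the monomial $v_0^{-a}v_1^{b}$ if $a\le 0\le b$; $v_4^{-b}v_0^{-a}$ if $a,b\le0$; $v_3^{a}v_4^{-b}$ if $b\le0\le a$; $v_2^{b}v_3^{a-b}$ if $a\ge b\ge0$; $v_1^{b-a}v_2^{a}$ if $b\ge a\ge0$, multiplied by $q^{mn}$, where $m,n$ are its two exponents (this makes it $*$-invariant). Let $\mathbb L_q\subset T_q$ be the $\mathbb Z[q,q^{-1}]$-subalgebra generated by all $\mathbb I^q(a,b)$; it is $*$-stable. The homomorphism $X\mapsto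 Y^{-1}$, $Y\mapsto(1+qY)X$ of $T_q$ into its fraction field restricts to an automorphism $\gamma$ of $\mathbb L_q$ with $\gamma(v_i)=v_{i+1}$ (indices mod $5$), so $\gamma^5=\mathrm{Id}$. Let $\mathbf L=\mathbb L_q\otimes_{\mathbb Z}\mathbb L_{q^\vee}$ (with $q,q^\vee$ independent formal variables), with $*$ and $\gamma$ acting on both factors. **The Schwartz space.** Let $W\subset L^2(\mathbb R)$ be the linear span of the functions $e^{-ax^2/2+bx}P(x)$ with $a>0$, $b\in\mathbb C$, $P$ a polynomial; they extend to entire functions. Let $\mathbf L$ act on $W$, $A\mapsto\widehat A$, by $$\widehat Xw(x)=w(x+2\pi i\hbar),\quad \widehat Yw(x)=e^xw(x),\quad \widehat{X^\vee}w(x)=w(x+2\pi i),\quad \widehat{Y^\vee}w(x)=e^{x/\hbar}w(x),$$ with the formal $q,q^\vee$ acting as the numbers $e^{\pi i\hbar},e^{\pi i/\hbar}$. Let $S_{\mathbf L}$ be the space of all $f\in L^2(\mathbb R)$ such that for every $A\in\mathbf L$ the functional $w\mapsto(f,\widehat Aw)$ on $W$ is continuous for the $L^2$-norm. For $A\in\mathbf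 L$ and $f\in S_{\mathbf L}$ let $\widehat Af$ be the unique element of $L^2(\mathbb R)$ with $(\widehat Af,w)=(f,\widehat{*A}\,w)$ for all $w\in W$. **The operator.** Let $$\Phi^\hbar(z)=\exp\Bigl(-\frac14\int_\Omega\frac{e^{-ipz}}{\sinh(\pi p)\sinh(\pi\hbar p)}\frac{dp}{p}\Bigr),$$ where $\Omega$ goes from $-\infty$ to $+\infty$ along the real line, passing just above $p=0$. One has $|\Phi^\hbar|=1$ on $\mathbb R$. Let $K:L^2(\mathbb R)\to L^2(\mathbb R)$ be the bounded invertible operator given on $L^1\cap L^2$ by $$Kf(z)=\int_{-\infty}^{\infty}f(x)\,\Phi^\hbar(x)\,\exp\Bigl(\frac{-xz}{2\pi i\hbar}\Bigr)dx .$$ **Theorem.** For every $s\in S_{\mathbf L}$ one has $Ks\in S_{\mathbf L}$, and for every $A\in\mathbf L$ and $s\in S_{\mathbf L}$ $$K^{-1}\,\widehat A\,K\,s=\widehat{\gamma(A)}\,s .$$ -/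

import Mathlib

noncomputable section

namespace QuantumM05

open scoped TensorProduct

/-- The group of monomials `q^k [a, b]` (`k a b : ℤ`) of the quantum torus, written in the Weyl
ordered form `[a, b] = q^(-ab) X^a Y^b`.  Here `q` is central and
`[a, b] [a', b'] = q^(ab' - a'b) [a + a', b + b']`, which for `X = [1, 0]`, `Y = [0, 1]` is the
relation `q⁻¹ X Y = q Y X`. -/
@[ext] structure HeisGroup where
  k : ℤ
  a : ℤ
  b : ℤ

namespace HeisGroup

instance : Mul HeisGroup := ⟨fun g h => ⟨g.k + h.k + (g.a * h.b - h.a * g.b), g.a + h.a, g.b + h.b⟩⟩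
instance : One HeisGroup := ⟨⟨0, 0, 0⟩⟩
instance : Inv HeisGroup := ⟨fun g => ⟨-g.k, -g.a, -g.b⟩⟩

theorem mul_def (g h : HeisGroup) :
    g * h = ⟨g.k + h.k + (g.a * h.b - h.a * g.b), g.a + h.a, g.b + h.b⟩ := rfl
theorem one_def : (1 : HeisGroup) = ⟨0, 0, 0⟩ := rfl
theorem inv_def (g : HeisGroup) : g⁻¹ = ⟨-g.k, -g.a, -g.b⟩ := rfl

instance : Group HeisGroup :=
  Group.ofLeftAxioms
    (fun g h l => by simp only [mul_def, HeisGroup.mk.injEq]; refine ⟨?_, ?_, ?_⟩ <;> ring)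
    (fun g => by simp [mul_def, one_def])
    (fun g => by simp only [mul_def, one_def, inv_def, HeisGroup.mk.injEq]; refine ⟨?_, ?_, ?_⟩ <;> ring)

section lift
variable {G : Type*} [Group G] {Q X Y : G}

theorem zpow_comm_aux (hQX : Commute Q X) (hQY : Commute Q Y)
    (hXY : X * Y = Q ^ (2 : ℤ) * Y * X) (a b : ℤ) :
    Y ^ b * X ^ a = Q ^ (-(2 * a * b)) * X ^ a * Y ^ b := by
  have h0 : SemiconjBy X Y (Q ^ (2 : ℤ) * Y) := hXY
  have h1 : SemiconjBy X (Y ^ b) (Q ^ (2 * b) * Y ^ b) := by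
    have := h0.zpow_right b
    rwa [((hQY.zpow_left 2).mul_zpow b), ← zpow_mul] at this
  have h2 : SemiconjBy (Y ^ b) X (Q ^ (-(2 * b)) * X) := by
    have h3 : X * Y ^ b = Q ^ (2 * b) * Y ^ b * X := h1
    change Y ^ b * X = Q ^ (-(2 * b)) * X * Y ^ b
    rw [mul_assoc, h3, zpow_neg]; group
  have h4 := h2.zpow_right a
  rw [((hQX.zpow_left _).mul_zpow a), ← zpow_mul] at h4
  have h5 : Y ^ b * X ^ a = _ := h4
  rw [h5]; congr 3; ring

/-- Elements `Q`, `X`, `Y` of a group with `Q` commuting with `X`, `Y` and `XY = Q²YX` define the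
homomorphism `q^k [a, b] ↦ Q^k Q^(-ab) X^a Y^b`. -/
def lift (Q X Y : G) (hQX : Commute Q X) (hQY : Commute Q Y)
    (hXY : X * Y = Q ^ (2 : ℤ) * Y * X) : HeisGroup →* G where
  toFun g := Q ^ (g.k - g.a * g.b) * X ^ g.a * Y ^ g.b
  map_one' := by simp [one_def]
  map_mul' g h := by
    simp only [mul_def]
    have e := zpow_comm_aux hQX hQY hXY h.a g.b
    have c1 : ∀ m n : ℤ, X ^ m * Q ^ n = Q ^ n * X ^ m := fun m n => ((hQX.zpow_zpow n m).eq).symm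
    have c2 : ∀ m n : ℤ, Y ^ m * Q ^ n = Q ^ n * Y ^ m := fun m n => ((hQY.zpow_zpow n m).eq).symm
    calc _ = Q ^ (g.k - g.a * g.b + (h.k - h.a * h.b) + -(2 * h.a * g.b)) *
            (X ^ g.a * X ^ h.a) * (Y ^ g.b * Y ^ h.b) := by
          rw [← zpow_add, ← zpow_add]; congr 3; ring
      _ = Q ^ (g.k - g.a * g.b) * Q ^ (h.k - h.a * h.b) *
            (Q ^ (-(2 * h.a * g.b)) * X ^ g.a) * X ^ h.a * (Y ^ g.b * Y ^ h.b) := by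
          rw [zpow_add, zpow_add]; group
      _ = Q ^ (g.k - g.a * g.b) * Q ^ (h.k - h.a * h.b) * X ^ g.a *
            (Q ^ (-(2 * h.a * g.b)) * X ^ h.a * Y ^ g.b) * Y ^ h.b := by
          rw [← c1]; group
      _ = Q ^ (g.k - g.a * g.b) * (Q ^ (h.k - h.a * h.b) * X ^ g.a) * Y ^ g.b * X ^ h.a * Y ^ h.b := by
          rw [← e]; group
      _ = Q ^ (g.k - g.a * g.b) * X ^ g.a * (Q ^ (h.k - h.a * h.b) * Y ^ g.b) * X ^ h.a * Y ^ h.b := by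
          rw [← c1]; group
      _ = _ := by rw [← c2]; group
end lift

end HeisGroup

/-- The two dimensional quantum torus algebra `T_q` over `ℤ[q, q⁻¹]`, with `q` a formal variable:
the free `ℤ`-module on the monomials `q^k X^a Y^b`, with `q` central and `q⁻¹ X Y = q Y X`. -/
abbrev QTorus : Type := MonoidAlgebra ℤ HeisGroup

namespace QTorus

/-- The central element `q^k`. -/
def qpow (k : ℤ) : QTorus := MonoidAlgebra.of ℤ HeisGroup ⟨k, 0, 0⟩
/-- The `*`-invariant monomial `[a, b] = q^(-ab) X^a Y^b`. -/
def M (a b : ℤ) : QTorus := MonoidAlgebra.of ℤ HeisGroup ⟨0, a, b⟩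

theorem M_mul (a b a' b' : ℤ) : M a b * M a' b' = qpow (a * b' - a' * b) * M (a + a') (b + b') := by
  simp only [M, qpow, ← map_mul, HeisGroup.mul_def]; simp
theorem qpow_mul (k l : ℤ) : qpow k * qpow l = qpow (k + l) := by
  simp only [qpow, ← map_mul, HeisGroup.mul_def]; simp
theorem qpow_zero : qpow 0 = 1 := by
  simp only [qpow]; exact map_one (MonoidAlgebra.of ℤ HeisGroup)
theorem M_zero : M 0 0 = 1 := by
  simp only [M]; exact map_one (MonoidAlgebra.of ℤ HeisGroup)
theorem qpow_comm (k : ℤ) (t : QTorus) : qpow k * t = t * qpow k := by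
  induction t using MonoidAlgebra.induction_on with
  | of g => simp only [qpow, ← map_mul, HeisGroup.mul_def]; congr 2 <;> simp [add_comm]
  | add x y hx hy => rw [mul_add, add_mul, hx, hy]
  | smul r x hx => rw [mul_smul_comm, smul_mul_assoc, hx]

/-- The parameter `q`. -/
def q : QTorus := qpow 1
/-- The generator `X`. -/
def X : QTorus := M 1 0
/-- The generator `Y`. -/
def Y : QTorus := M 0 1

theorem X_mul_Y : qpow (-1) * X * Y = q * Y * X := by
  rw [X, Y, q, mul_assoc, mul_assoc, M_mul, M_mul, ← mul_assoc, ← mul_assoc, qpow_mul, qpow_mul]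
  norm_num

/-- The five basic `*`-invariant elements: the `q`-deformations of
`X⁻¹`, `Y`, `(1 + Y) X`, `(1 + X + XY) / Y` and `(1 + X) / (XY)`, namely
`X⁻¹`, `Y`, `(1 + qY) X`, `Y⁻¹ + q X Y⁻¹ + X` and `Y⁻¹ + q Y⁻¹ X⁻¹`. -/
def v : Fin 5 → QTorus
  | 0 => M (-1) 0
  | 1 => M 0 1
  | 2 => M 1 0 + M 1 1
  | 3 => M 0 (-1) + M 1 (-1) + M 1 0
  | 4 => M 0 (-1) + M (-1) (-1)

theorem v_two_eq : v 2 = (1 + q * Y) * X := by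
  rw [add_mul, one_mul, X, Y, q, mul_assoc, M_mul, ← mul_assoc, qpow_mul]
  simp [v, qpow_zero]

end QTorus

/-- The fraction field of `ℤ[q^{±1}, y^{±1}]`. -/
abbrev CoefField : Type := FractionRing (AddMonoidAlgebra ℤ (ℤ × ℤ))

/-- An auxiliary ring that contains both `T_q` and the images `Y⁻¹`, `(1 + qY) X` of `X`, `Y` under
`γ` together with their inverses: operators on functions `φ : ℤ → Frac ℤ[q^{±1}, y^{±1}]`, with
`(X φ)(n) = φ(n + 1)` and `(Y φ)(n) = q^(2n) y φ(n)`.  In it `1 + qY` is invertible. -/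
abbrev Loc : Type := Module.End CoefField (ℤ → CoefField)

namespace Loc

/-- The monomials `q^i y^j`. -/
def mon : Multiplicative (ℤ × ℤ) →* CoefFieldˣ :=
  (Units.map (algebraMap (AddMonoidAlgebra ℤ (ℤ × ℤ)) CoefField).toMonoidHom).comp
    (AddMonoidAlgebra.of ℤ (ℤ × ℤ)).toHomUnits

theorem mon_val (m : ℤ × ℤ) : (mon (Multiplicative.ofAdd m) : CoefField) =
    algebraMap (AddMonoidAlgebra ℤ (ℤ × ℤ)) CoefField (AddMonoidAlgebra.single m 1) := rfl

/-- Multiplication by a function of `n`. -/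
def diagEnd (d : ℤ → CoefField) : Loc where
  toFun φ := fun n => d n * φ n
  map_add' φ ψ := by ext n; simp [mul_add]
  map_smul' c φ := by ext n; simp [mul_left_comm]

/-- Multiplication by an invertible function of `n`. -/
def diag (d : ℤ → CoefFieldˣ) : Locˣ where
  val := diagEnd fun n => d n
  inv := diagEnd fun n => ↑(d n)⁻¹
  val_inv := by ext φ n; simp [diagEnd]
  inv_val := by ext φ n; simp [diagEnd]

/-- `diag` as a homomorphism. -/
def diagHom : (ℤ → CoefFieldˣ) →* Locˣ where
  toFun := diag
  map_one' := by ext φ n; simp [diag, diagEnd]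
  map_mul' d e := by ext φ n; simp [diag, diagEnd, mul_assoc]

/-- The shift by `m`. -/
def shiftEnd (m : ℤ) : Loc where
  toFun φ := fun n => φ (n + m)
  map_add' _ _ := rfl
  map_smul' _ _ := rfl

/-- The operator `X`. -/
def shift : Locˣ where
  val := shiftEnd 1
  inv := shiftEnd (-1)
  val_inv := by ext φ n; simp [shiftEnd]
  inv_val := by ext φ n; simp [shiftEnd]

theorem shift_mul_diag (d : ℤ → CoefFieldˣ) :
    shift * diagHom d = diagHom (fun n => d (n + 1)) * shift := by
  ext φ n; simp [shift, shiftEnd, diagHom, diag, diagEnd]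

theorem shift_zpow_apply (a : ℤ) (φ : ℤ → CoefField) (n : ℤ) :
    ((shift ^ a : Locˣ) : Loc) φ n = φ (n + a) := by
  induction a generalizing φ n with
  | zero => simp
  | succ i ih => rw [zpow_add_one, Units.val_mul, Module.End.mul_apply, ih]; simp [shift, shiftEnd, add_assoc]
  | pred i ih =>
    rw [zpow_sub_one, Units.val_mul, Module.End.mul_apply, ih]
    change φ (n + -(i : ℤ) + -1) = _
    congr 1; ring

/-- The operator `q`. -/
def Q : Locˣ := diagHom fun _ => mon (Multiplicative.ofAdd (1, 0))
/-- The operator `Y`. -/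
def Y : Locˣ := diagHom fun n => mon (Multiplicative.ofAdd (2 * n, 1))

theorem one_add_ne_zero (n : ℤ) :
    (1 : CoefField) + mon (Multiplicative.ofAdd (2 * n + 1, 1)) ≠ 0 := by
  rw [mon_val, ← map_one (algebraMap (AddMonoidAlgebra ℤ (ℤ × ℤ)) CoefField), ← map_add]
  intro h
  rw [map_eq_zero_iff _ (IsFractionRing.injective _ _)] at h
  have := congrArg (fun p => p.coeff (2 * n + 1, 1)) h
  simp [AddMonoidAlgebra.one_def] at this

/-- The operator `1 + qY`. -/
def V : Locˣ := diagHom fun n => Units.mk0 _ (one_add_ne_zero n)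

theorem V_val : (V : Loc) = 1 + Q * Y := by
  refine LinearMap.ext fun φ => funext fun n => ?_
  simp only [V, Q, Y, diagHom, diag, diagEnd, MonoidHom.coe_mk, OneHom.coe_mk, LinearMap.coe_mk,
    AddHom.coe_mk, Units.val_mk0, Module.End.mul_apply, LinearMap.add_apply, Module.End.one_apply,
    Pi.add_apply]
  rw [← mul_assoc, ← Units.val_mul, ← map_mul, ← ofAdd_add, add_mul, one_mul]
  congr 5
  simp [add_comm]

theorem Q_comm_diag (d : ℤ → CoefFieldˣ) : Commute Q (diagHom d) := by
  rw [Q, commute_iff_eq, ← map_mul, ← map_mul, mul_comm]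

theorem Q_comm_shift : Commute Q shift := by
  rw [Q, commute_iff_eq, shift_mul_diag]

theorem shift_mul_Y : shift * Y = Q ^ (2 : ℤ) * Y * shift := by
  rw [Y, shift_mul_diag, Q, ← map_zpow, ← map_mul]
  congr 2
  funext n
  rw [Pi.mul_apply, Pi.pow_apply, ← map_zpow, ← map_mul, ← ofAdd_zsmul, ← ofAdd_add]
  congr 2
  refine Prod.ext ?_ ?_
  · simp; ring
  · simp

theorem gamma_rel : Y⁻¹ * (V * shift) = Q ^ (2 : ℤ) * (V * shift) * Y⁻¹ := by
  have h1 : Commute Y V := by rw [Y, V, commute_iff_eq, ← map_mul, ← map_mul, mul_comm]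
  have h2 : Commute Q V := Q_comm_diag _
  have h3 : Commute Q Y := Q_comm_diag _
  have h5 : Commute Y⁻¹ V := h1.inv_left
  have h6 : Commute (Q ^ (2 : ℤ)) V := h2.zpow_left 2
  have h7 : Commute (Q ^ (2 : ℤ)) Y⁻¹ := (h3.zpow_left 2).inv_right
  calc Y⁻¹ * (V * shift) = V * (Y⁻¹ * shift) := by rw [← mul_assoc, h5.eq, mul_assoc]
    _ = V * (Q ^ (2 : ℤ) * shift * Y⁻¹) := by
        congr 1
        rw [eq_mul_inv_iff_mul_eq, mul_assoc, shift_mul_Y, ← mul_assoc, ← mul_assoc, ← h7.eq]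
        group
    _ = _ := by rw [← mul_assoc, ← mul_assoc, ← mul_assoc, h6.eq]

end Loc

/-- The (injective) homomorphism `T_q → Loc`, `q ↦ q`, `X ↦ X`, `Y ↦ Y`. -/
def embLoc : QTorus →ₐ[ℤ] Loc :=
  MonoidAlgebra.lift ℤ Loc HeisGroup ((Units.coeHom Loc).comp
    (HeisGroup.lift Loc.Q Loc.shift Loc.Y Loc.Q_comm_shift (Loc.Q_comm_diag _) Loc.shift_mul_Y))

/-- The homomorphism `γ : T_q → Loc`, `q ↦ q`, `X ↦ Y⁻¹`, `Y ↦ (1 + qY) X`. -/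
def gammaLoc : QTorus →ₐ[ℤ] Loc :=
  MonoidAlgebra.lift ℤ Loc HeisGroup ((Units.coeHom Loc).comp
    (HeisGroup.lift Loc.Q Loc.Y⁻¹ (Loc.V * Loc.shift) (Loc.Q_comm_diag _).inv_right
      ((Loc.Q_comm_diag _).mul_right Loc.Q_comm_shift) Loc.gamma_rel))

theorem embLoc_of (g : HeisGroup) : embLoc (MonoidAlgebra.of ℤ HeisGroup g) =
    ((Loc.Q ^ (g.k - g.a * g.b) * Loc.shift ^ g.a * Loc.Y ^ g.b : Locˣ) : Loc) := by
  simp only [embLoc, MonoidAlgebra.lift_of]; rfl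

theorem gammaLoc_of (g : HeisGroup) : gammaLoc (MonoidAlgebra.of ℤ HeisGroup g) =
    ((Loc.Q ^ (g.k - g.a * g.b) * Loc.Y⁻¹ ^ g.a * (Loc.V * Loc.shift) ^ g.b : Locˣ) : Loc) := by
  simp only [gammaLoc, MonoidAlgebra.lift_of]; rfl

theorem embLoc_coeff (f : QTorus) (a : ℤ) : ∃ p : AddMonoidAlgebra ℤ (ℤ × ℤ),
    embLoc f (Pi.single a 1) 0 = algebraMap _ _ p ∧
    ∀ k b : ℤ, p.coeff (k + a * b, b) = f.coeff ⟨k, a, b⟩ := by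
  induction f using MonoidAlgebra.induction_on with
  | of g =>
    refine ⟨if g.a = a then AddMonoidAlgebra.single (g.k + a * g.b, g.b) 1 else 0, ?_, ?_⟩
    · rw [embLoc_of, Loc.Q, Loc.Y, ← map_zpow, ← map_zpow, Units.val_mul, Units.val_mul,
        Module.End.mul_apply, Module.End.mul_apply]
      simp only [Loc.diagHom, Loc.diag, Loc.diagEnd, MonoidHom.coe_mk, OneHom.coe_mk,
        LinearMap.coe_mk, AddHom.coe_mk, Loc.shift_zpow_apply]
      rw [Pi.pow_apply, Pi.pow_apply, ← map_zpow Loc.mon, ← map_zpow Loc.mon]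
      by_cases h : g.a = a
      · subst h
        rw [if_pos rfl, ← Loc.mon_val]
        simp only [zero_add, Pi.single_eq_same, mul_one]
        rw [← Units.val_mul, ← map_mul, ← ofAdd_zsmul, ← ofAdd_zsmul, ← ofAdd_add]
        congr 3
        refine Prod.ext ?_ ?_
        · simp; ring
        · simp
      · rw [if_neg h]; simp [h]
    · intro k b
      by_cases h : g.a = a
      · subst h
        rw [if_pos rfl]
        simp only [MonoidAlgebra.of_apply, AddMonoidAlgebra.coeff_single,
          MonoidAlgebra.coeff_single]
        classical
        rw [Finsupp.single_apply, Finsupp.single_apply]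
        refine if_congr ?_ rfl rfl
        simp only [Prod.mk.injEq, HeisGroup.ext_iff]
        constructor
        · rintro ⟨h1, rfl⟩; exact ⟨by linarith, trivial, rfl⟩
        · rintro ⟨rfl, -, rfl⟩; exact ⟨rfl, rfl⟩
      · rw [if_neg h]
        simp [HeisGroup.ext_iff, h]
  | add x y hx hy =>
    obtain ⟨p, hp, hp'⟩ := hx
    obtain ⟨r, hr, hr'⟩ := hy
    exact ⟨p + r, by simp [hp, hr], fun k b => by simp [hp', hr']⟩
  | smul c x hx =>
    obtain ⟨p, hp, hp'⟩ := hx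
    refine ⟨c • p, by simp [hp], fun k b => by
      rw [AddMonoidAlgebra.coeff_smul, MonoidAlgebra.coeff_smul, Finsupp.smul_apply,
        Finsupp.smul_apply, hp']⟩

theorem embLoc_injective : Function.Injective embLoc := by
  rw [injective_iff_map_eq_zero]
  intro f hf
  ext g
  obtain ⟨p, hp, hp'⟩ := embLoc_coeff f g.a
  rw [hf] at hp
  have : p = 0 := by
    apply IsFractionRing.injective (AddMonoidAlgebra ℤ (ℤ × ℤ)) CoefField
    rw [← hp]; simp
  rw [show g = ⟨g.k, g.a, g.b⟩ from rfl, ← hp', this]; simp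

namespace QTorus

/-- The quantum canonical map on the tropical points `(a, b)`: on each of the five cones it is a
monomial in two neighbouring elements among the five basic ones, multiplied by the power of `q` that
makes it `*`-invariant. -/
def canon (a b : ℤ) : QTorus :=
  if a ≤ 0 ∧ 0 ≤ b then qpow (-a * b) * v 0 ^ (-a).toNat * v 1 ^ b.toNat
  else if a ≤ 0 ∧ b ≤ 0 then qpow (-b * -a) * v 4 ^ (-b).toNat * v 0 ^ (-a).toNat
  else if 0 ≤ a ∧ b ≤ 0 then qpow (a * -b) * v 3 ^ a.toNat * v 4 ^ (-b).toNat
  else if b ≤ a then qpow (b * (a - b)) * v 2 ^ b.toNat * v 3 ^ (a - b).toNat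
  else qpow ((b - a) * a) * v 1 ^ (b - a).toNat * v 2 ^ a.toNat

/-- The algebra `𝕃_q` over `ℤ[q, q⁻¹]`: the subalgebra of `T_q` generated over `ℤ[q, q⁻¹]` by the
image of the quantum canonical map. -/
def Lq : Subalgebra ℤ QTorus :=
  Algebra.adjoin ℤ (Set.range qpow ∪ Set.range fun p : ℤ × ℤ => canon p.1 p.2)

theorem qpow_mem (k : ℤ) : qpow k ∈ Lq :=
  Algebra.subset_adjoin (Or.inl ⟨k, rfl⟩)

theorem v_mem (i : Fin 5) : v i ∈ Lq := by
  have h : ∀ a b, canon a b ∈ Lq := fun a b => Algebra.subset_adjoin (Or.inr ⟨(a, b), rfl⟩)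
  fin_cases i
  · simpa [canon, qpow_zero] using h (-1) 0
  · simpa [canon, qpow_zero] using h 0 1
  · simpa [canon, qpow_zero] using h 1 1
  · simpa [canon, qpow_zero] using h 1 0
  · simpa [canon, qpow_zero] using h 0 (-1)

theorem Lq_eq : Lq = Algebra.adjoin ℤ (Set.range qpow ∪ Set.range v) := by
  apply le_antisymm
  · refine Algebra.adjoin_le ?_
    rintro _ (⟨k, rfl⟩ | ⟨⟨a, b⟩, rfl⟩)
    · exact Algebra.subset_adjoin (Or.inl ⟨k, rfl⟩)
    · have hq : ∀ k, qpow k ∈ Algebra.adjoin ℤ (Set.range qpow ∪ Set.range v) :=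
        fun k => Algebra.subset_adjoin (Or.inl ⟨k, rfl⟩)
      have hv : ∀ i, v i ∈ Algebra.adjoin ℤ (Set.range qpow ∪ Set.range v) :=
        fun i => Algebra.subset_adjoin (Or.inr ⟨i, rfl⟩)
      have : ∀ k i j (m n : ℕ), qpow k * v i ^ m * v j ^ n ∈
          Algebra.adjoin ℤ (Set.range qpow ∪ Set.range v) := fun k i j m n =>
        mul_mem (mul_mem (hq k) (pow_mem (hv i) m)) (pow_mem (hv j) n)
      simp only [SetLike.mem_coe, canon]
      split_ifs <;> apply this
  · refine Algebra.adjoin_le ?_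
    rintro _ (⟨k, rfl⟩ | ⟨i, rfl⟩)
    · exact qpow_mem k
    · exact v_mem i

end QTorus

open QTorus

theorem embLoc_qpow (k : ℤ) : embLoc (qpow k) = ((Loc.Q ^ k : Locˣ) : Loc) := by
  rw [qpow, embLoc_of]; simp
theorem embLoc_M (a b : ℤ) :
    embLoc (M a b) = ((Loc.Q ^ (-(a * b)) * Loc.shift ^ a * Loc.Y ^ b : Locˣ) : Loc) := by
  rw [M, embLoc_of]; simp
theorem gammaLoc_qpow (k : ℤ) : gammaLoc (qpow k) = ((Loc.Q ^ k : Locˣ) : Loc) := by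
  rw [qpow, gammaLoc_of]; simp
theorem gammaLoc_M (a b : ℤ) : gammaLoc (M a b) =
    ((Loc.Q ^ (-(a * b)) * Loc.Y⁻¹ ^ a * (Loc.V * Loc.shift) ^ b : Locˣ) : Loc) := by
  rw [M, gammaLoc_of]; simp

theorem gammaLoc_v0 : gammaLoc (v 0) = embLoc (v 1) := by
  simp [v, embLoc_M, gammaLoc_M]

theorem gammaLoc_v1 : gammaLoc (v 1) = embLoc (v 2) := by
  have : v 2 = X + q * Y * X := by
    rw [X, Y, q, mul_assoc, M_mul, ← mul_assoc, qpow_mul]; simp [v, qpow_zero]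
  rw [this]
  simp only [v, gammaLoc_M, X, Y, q, map_add, map_mul, embLoc_M, embLoc_qpow]
  simp [Loc.V_val, add_mul, mul_assoc]

theorem gammaLoc_X : gammaLoc X = embLoc (M 0 (-1)) := by
  simp [X, embLoc_M, gammaLoc_M]

theorem gammaLoc_v2 : gammaLoc (v 2) = embLoc (v 3) := by
  have h2 : v 2 = X + q * v 1 * X := by
    simp only [v]
    rw [X, q, mul_assoc, M_mul, ← mul_assoc, qpow_mul]; simp [qpow_zero]
  rw [h2, map_add, map_mul, map_mul, gammaLoc_v1, gammaLoc_X, q, gammaLoc_qpow, ← embLoc_qpow,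
    ← map_mul, ← map_mul, ← map_add]
  congr 1
  simp only [v, mul_add, add_mul, mul_assoc, M_mul]
  simp only [← mul_assoc, qpow_mul]
  simp [qpow_zero, add_assoc]

theorem gammaLoc_v3 : gammaLoc (v 3) = embLoc (v 4) := by
  have hu : IsUnit (gammaLoc (M 0 1)) := by rw [gammaLoc_M]; exact Units.isUnit _
  apply hu.mul_left_injective
  change gammaLoc (v 3) * gammaLoc (M 0 1) = embLoc (v 4) * gammaLoc (v 1)
  rw [gammaLoc_v1, ← map_mul, ← map_mul]
  have h3 : v 3 * M 0 1 = 1 + qpow 1 * v 2 := by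
    simp only [v, mul_add, add_mul, mul_assoc, M_mul]
    simp [qpow_zero, M_zero, add_assoc]
  rw [h3, map_add, map_mul, map_one, gammaLoc_v2, gammaLoc_qpow, ← embLoc_qpow, ← map_mul,
    ← map_one embLoc, ← map_add]
  congr 1
  simp only [v, mul_add, add_mul, mul_assoc, M_mul]
  simp [qpow_zero, M_zero]
  abel

theorem gammaLoc_v4 : gammaLoc (v 4) = embLoc (v 0) := by
  have hu : IsUnit (gammaLoc (M 0 1)) := by rw [gammaLoc_M]; exact Units.isUnit _
  apply hu.mul_left_injective
  change gammaLoc (v 4) * gammaLoc (M 0 1) = embLoc (v 0) * gammaLoc (v 1)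
  rw [gammaLoc_v1, ← map_mul, ← map_mul]
  have h3 : v 4 * M 0 1 = 1 + qpow (-1) * v 0 := by
    simp only [v, mul_add, add_mul, mul_assoc, M_mul]
    simp [qpow_zero, M_zero, add_assoc]
  rw [h3, map_add, map_mul, map_one, gammaLoc_v0, gammaLoc_qpow, ← embLoc_qpow, ← map_mul,
    ← map_one embLoc, ← map_add]
  congr 1
  simp only [v, mul_add, add_mul, mul_assoc, M_mul]
  simp [qpow_zero, M_zero, add_assoc]

theorem gammaLoc_v (i : Fin 5) : gammaLoc (v i) = embLoc (v (i + 1)) := by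
  fin_cases i
  exacts [gammaLoc_v0, gammaLoc_v1, gammaLoc_v2, gammaLoc_v3, gammaLoc_v4]

theorem gammaLoc_mem (x : QTorus) (hx : x ∈ Lq) : gammaLoc x ∈ Lq.map embLoc := by
  suffices h : Lq.map gammaLoc ≤ Lq.map embLoc from h ⟨x, hx, rfl⟩
  nth_rewrite 1 [Lq_eq]
  rw [AlgHom.map_adjoin]
  refine Algebra.adjoin_le ?_
  rintro _ ⟨_, ⟨k, rfl⟩ | ⟨i, rfl⟩, rfl⟩
  · exact ⟨qpow k, qpow_mem k, by simp [embLoc_qpow, gammaLoc_qpow]⟩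
  · exact ⟨v (i + 1), v_mem _, (gammaLoc_v i).symm⟩

/-- The restriction of `γ : X ↦ Y⁻¹, Y ↦ (1 + qY) X` to `𝕃_q`, which it maps to itself:
`embLoc (gammaHom x) = gammaLoc x`. -/
def gammaHom : Lq →ₐ[ℤ] Lq :=
  ((Lq.equivMapOfInjective embLoc embLoc_injective).symm : Lq.map embLoc →ₐ[ℤ] Lq).comp
    ((gammaLoc.comp Lq.val).codRestrict (Lq.map embLoc) fun x => gammaLoc_mem x x.2)

theorem embLoc_gammaHom (x : Lq) : embLoc (gammaHom x) = gammaLoc x := by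
  have := Lq.coe_equivMapOfInjective_apply embLoc embLoc_injective (gammaHom x)
  rw [← this, gammaHom, AlgHom.comp_apply]
  erw [AlgEquiv.apply_symm_apply]
  rfl

theorem gammaHom_qpow (k : ℤ) : gammaHom ⟨qpow k, qpow_mem k⟩ = ⟨qpow k, qpow_mem k⟩ := by
  apply Subtype.ext; apply embLoc_injective
  rw [embLoc_gammaHom]; simp [embLoc_qpow, gammaLoc_qpow]

theorem gammaHom_v (i : Fin 5) : gammaHom ⟨v i, v_mem i⟩ = ⟨v (i + 1), v_mem (i + 1)⟩ := by
  apply Subtype.ext; apply embLoc_injective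
  rw [embLoc_gammaHom]; exact gammaLoc_v i

theorem Lq_hom_ext {B : Type*} [Semiring B] [Algebra ℤ B] (f g : Lq →ₐ[ℤ] B)
    (hq : ∀ k, f ⟨qpow k, qpow_mem k⟩ = g ⟨qpow k, qpow_mem k⟩)
    (hv : ∀ i, f ⟨v i, v_mem i⟩ = g ⟨v i, v_mem i⟩) : f = g := by
  have h : Lq ≤ (AlgHom.equalizer f g).map Lq.val := by
    conv_lhs => rw [Lq_eq]
    refine Algebra.adjoin_le ?_
    rintro _ (⟨k, rfl⟩ | ⟨i, rfl⟩)
    · exact ⟨⟨qpow k, qpow_mem k⟩, hq k, rfl⟩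
    · exact ⟨⟨v i, v_mem i⟩, hv i, rfl⟩
  refine AlgHom.ext fun x => ?_
  obtain ⟨y, hy, hyx⟩ := h x.2
  have e : y = x := Subtype.ext hyx
  rw [← e]; exact hy

theorem gammaHom_iterate (x : Lq) :
    gammaHom (gammaHom (gammaHom (gammaHom (gammaHom x)))) = x := by
  have h : gammaHom.comp (gammaHom.comp (gammaHom.comp (gammaHom.comp gammaHom))) =
      AlgHom.id ℤ Lq := by
    refine Lq_hom_ext _ _ (fun k => ?_) (fun i => ?_)
    · rw [AlgHom.comp_apply, AlgHom.comp_apply, AlgHom.comp_apply, AlgHom.comp_apply,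
        gammaHom_qpow, gammaHom_qpow, gammaHom_qpow, gammaHom_qpow, gammaHom_qpow, AlgHom.id_apply]
    · rw [AlgHom.comp_apply, AlgHom.comp_apply, AlgHom.comp_apply, AlgHom.comp_apply,
        gammaHom_v, gammaHom_v, gammaHom_v, gammaHom_v, gammaHom_v, AlgHom.id_apply]
      have e : i + 1 + 1 + 1 + 1 + 1 = i := by revert i; decide
      exact Subtype.ext (congrArg v e)
  exact DFunLike.congr_fun h x

/-- The automorphism `γ` of `𝕃_q`; its fifth power is the identity. -/
def gammaLq : Lq ≃ₐ[ℤ] Lq where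
  __ := gammaHom
  invFun x := gammaHom (gammaHom (gammaHom (gammaHom x)))
  left_inv := gammaHom_iterate
  right_inv := gammaHom_iterate

theorem gammaLq_v (i : Fin 5) : gammaLq ⟨v i, v_mem i⟩ = ⟨v (i + 1), v_mem (i + 1)⟩ :=
  gammaHom_v i

/-- `*(q^k [a, b]) = q^(-k) [a, b]`. -/
def starHeis : HeisGroup →* HeisGroupᵐᵒᵖ where
  toFun g := MulOpposite.op ⟨-g.k, g.a, g.b⟩
  map_one' := rfl
  map_mul' g h := by
    rw [← MulOpposite.op_mul]
    congr 1
    simp only [HeisGroup.mul_def, HeisGroup.mk.injEq]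
    refine ⟨?_, ?_, ?_⟩ <;> ring

/-- The antiautomorphism `*` of `T_q` with `*q = q⁻¹`, `*X = X`, `*Y = Y`. -/
def starT : QTorus →ₐ[ℤ] QTorusᵐᵒᵖ :=
  MonoidAlgebra.lift ℤ QTorusᵐᵒᵖ HeisGroup
    ((MonoidHom.op (MonoidAlgebra.of ℤ HeisGroup)).comp starHeis)

/-- The antiautomorphism `*` as a linear map `T_q → T_q`. -/
def starLin : QTorus →ₗ[ℤ] QTorus :=
  (MulOpposite.opLinearEquiv ℤ).symm.toLinearMap ∘ₗ starT.toLinearMap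

theorem starLin_mul (x y : QTorus) : starLin (x * y) = starLin y * starLin x := by
  simp [starLin]
theorem starLin_qpow (k : ℤ) : starLin (qpow k) = qpow (-k) := by
  simp [starLin, starT, qpow, starHeis]
theorem starLin_M (a b : ℤ) : starLin (M a b) = M a b := by
  simp [starLin, starT, M, starHeis]

theorem starLin_v (i : Fin 5) : starLin (v i) = v i := by
  fin_cases i <;> simp [v, starLin_M]

theorem starLin_mem (x : QTorus) (hx : x ∈ Lq) : starLin x ∈ Lq := by
  rw [Lq_eq] at hx
  induction hx using Algebra.adjoin_induction with
  | mem y hy =>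
    rcases hy with ⟨k, rfl⟩ | ⟨i, rfl⟩
    · rw [starLin_qpow]; exact qpow_mem _
    · rw [starLin_v]; exact v_mem _
  | algebraMap r =>
    have : starLin (algebraMap ℤ QTorus r) = algebraMap ℤ QTorus r := by simp [starLin]
    rw [this]; exact Lq.algebraMap_mem r
  | add a b ha hb iha ihb => rw [map_add]; exact add_mem iha ihb
  | mul a b ha hb iha ihb => rw [starLin_mul]; exact mul_mem ihb iha

/-- The involution `*` of `𝕃_q`. -/
def starLq : Lq →ₗ[ℤ] Lq :=
  starLin.restrict (p := Subalgebra.toSubmodule Lq) (q := Subalgebra.toSubmodule Lq) starLin_mem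

/-- The algebra `L = 𝕃_q ⊗ 𝕃_{q^∨}`.  Both parameters are formal, so that the two factors are copies
of one algebra; they are told apart by their actions. -/
abbrev LAlg : Type := Lq ⊗[ℤ] Lq

/-- The automorphism `γ` of `L`, acting on both factors. -/
def gamma : LAlg ≃ₐ[ℤ] LAlg := Algebra.TensorProduct.congr gammaLq gammaLq

/-- The involution `*` of `L`. -/
def starL : LAlg →ₗ[ℤ] LAlg := TensorProduct.map starLq starLq

open MeasureTheory Complex

/-- The Hilbert space `L²(ℝ)`. -/
abbrev L2R : Type := Lp ℂ 2 (volume : Measure ℝ)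

/-- The entire function `exp(-az²/2 + bz) P(z)`. -/
def gaussPoly (a : ℝ) (b : ℂ) (P : Polynomial ℂ) : ℂ → ℂ :=
  fun z => exp (-a * z ^ 2 / 2 + b * z) * P.eval z

/-- The space `W` of finite linear combinations of the functions `exp(-ax²/2 + bx) P(x)`, `a > 0`,
`b ∈ ℂ`, `P` a polynomial, each taken as an entire function. -/
def W : Submodule ℂ (ℂ → ℂ) :=
  Submodule.span ℂ {w | ∃ (a : ℝ) (b : ℂ) (P : Polynomial ℂ), 0 < a ∧ w = gaussPoly a b P}

theorem shift_mem (c : ℂ) (w : ℂ → ℂ) (hw : w ∈ W) : (fun z => w (z + c)) ∈ W := by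
  have : W ≤ W.comap (LinearMap.funLeft ℂ ℂ (fun z : ℂ => z + c)) := by
    refine Submodule.span_le.2 ?_
    rintro _ ⟨a, b, P, ha, rfl⟩
    refine Submodule.subset_span ⟨a, b - a * c,
      Polynomial.C (exp (-a * c ^ 2 / 2 + b * c)) * P.comp (Polynomial.X + Polynomial.C c), ha, ?_⟩
    funext z
    simp only [LinearMap.funLeft_apply, gaussPoly, Polynomial.eval_mul, Polynomial.eval_C,
      Polynomial.eval_comp, Polynomial.eval_add, Polynomial.eval_X]
    rw [← mul_assoc, ← exp_add]
    congr 2; ring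
  exact this hw

theorem expMul_mem (β : ℂ) (w : ℂ → ℂ) (hw : w ∈ W) : (fun z => exp (β * z) * w z) ∈ W := by
  have : W ≤ W.comap (LinearMap.mulLeft ℂ (fun z : ℂ => exp (β * z))) := by
    refine Submodule.span_le.2 ?_
    rintro _ ⟨a, b, P, ha, rfl⟩
    refine Submodule.subset_span ⟨a, b + β, P, ha, ?_⟩
    funext z
    simp only [LinearMap.mulLeft_apply, Pi.mul_apply, gaussPoly]
    rw [← mul_assoc, ← exp_add]
    congr 2; ring
  exact this hw

/-- `w(z) ↦ w(z + c)`. -/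
def shiftLin (c : ℂ) : Module.End ℂ W where
  toFun w := ⟨fun z => w.1 (z + c), shift_mem c w w.2⟩
  map_add' _ _ := rfl
  map_smul' _ _ := rfl

/-- `w(z) ↦ exp(βz) w(z)`. -/
def expMulLin (β : ℂ) : Module.End ℂ W where
  toFun w := ⟨fun z => exp (β * z) * w.1 z, expMul_mem β w w.2⟩
  map_add' _ _ := Subtype.ext (funext fun _ => mul_add _ _ _)
  map_smul' _ _ := Subtype.ext (funext fun _ => mul_left_comm _ _ _)

/-- `w(z) ↦ w(z + c)` as an invertible operator. -/
def shiftOp (c : ℂ) : (Module.End ℂ W)ˣ where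
  val := shiftLin c
  inv := shiftLin (-c)
  val_inv := LinearMap.ext fun w => Subtype.ext (funext fun z => by simp [shiftLin])
  inv_val := LinearMap.ext fun w => Subtype.ext (funext fun z => by simp [shiftLin])

/-- `w(z) ↦ exp(βz) w(z)` as an invertible operator. -/
def expMulOp (β : ℂ) : (Module.End ℂ W)ˣ where
  val := expMulLin β
  inv := expMulLin (-β)
  val_inv := LinearMap.ext fun w => Subtype.ext (funext fun z => by
    simp [expMulLin, ← mul_assoc, ← exp_add])
  inv_val := LinearMap.ext fun w => Subtype.ext (funext fun z => by
    simp [expMulLin, ← mul_assoc, ← exp_add])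

/-- `w ↦ exp(c) w` as an invertible operator. -/
def scalarOp (c : ℂ) : (Module.End ℂ W)ˣ :=
  Units.map (algebraMap ℂ (Module.End ℂ W)).toMonoidHom (Units.mk0 (exp c) (exp_ne_zero c))

theorem scalarOp_comm (c : ℂ) (T : (Module.End ℂ W)ˣ) : Commute (scalarOp c) T :=
  Units.ext (Algebra.commutes (exp c) (T : Module.End ℂ W))

theorem shift_mul_expMul (c β d : ℂ) (h : exp (β * c) = exp (2 * d)) :
    shiftOp c * expMulOp β = scalarOp d ^ (2 : ℤ) * expMulOp β * shiftOp c := by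
  refine Units.ext (LinearMap.ext fun w => Subtype.ext (funext fun z => ?_))
  have e : ((scalarOp d ^ (2 : ℤ) : (Module.End ℂ W)ˣ) : Module.End ℂ W) =
      algebraMap ℂ (Module.End ℂ W) (exp (2 * d)) := by
    rw [scalarOp, ← map_zpow]
    change algebraMap ℂ (Module.End ℂ W) ((Units.mk0 (exp d) (exp_ne_zero d) ^ (2 : ℤ) : ℂˣ) : ℂ) = _
    congr 1
    rw [two_mul, exp_add, zpow_two]; rfl
  rw [Units.val_mul, Units.val_mul, Units.val_mul, e]
  change exp (β * (z + c)) * w.1 (z + c) = exp (2 * d) * (exp (β * z) * w.1 (z + c))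
  rw [← h, mul_add, exp_add]; ring

theorem shift_comm_expMul (c β : ℂ) (h : exp (β * c) = 1) :
    Commute (shiftOp c) (expMulOp β) := by
  refine Units.ext (LinearMap.ext fun w => Subtype.ext (funext fun z => ?_))
  change exp (β * (z + c)) * w.1 (z + c) = exp (β * z) * w.1 (z + c)
  rw [mul_add, exp_add, h, mul_one]

theorem shift_comm_shift (c d : ℂ) : Commute (shiftOp c) (shiftOp d) := by
  refine Units.ext (LinearMap.ext fun w => Subtype.ext (funext fun z => ?_))
  change w.1 (z + c + d) = w.1 (z + d + c)
  rw [add_right_comm]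

theorem expMul_comm_expMul (c d : ℂ) : Commute (expMulOp c) (expMulOp d) := by
  refine Units.ext (LinearMap.ext fun w => Subtype.ext (funext fun z => ?_))
  exact mul_left_comm _ _ _

/-- `q ↦ exp(πiħ)`, `X w(z) = w(z + 2πiħ)`, `Y w(z) = exp(z) w(z)`. -/
def repHom (ħ : ℝ) : HeisGroup →* (Module.End ℂ W)ˣ :=
  HeisGroup.lift (scalarOp (Real.pi * I * ħ)) (shiftOp (2 * Real.pi * I * ħ)) (expMulOp 1)
    (scalarOp_comm _ _) (scalarOp_comm _ _) (shift_mul_expMul _ _ _ (by congr 1; ring))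

/-- `q^∨ ↦ exp(πi/ħ)`, `X^∨ w(z) = w(z + 2πi)`, `Y^∨ w(z) = exp(z/ħ) w(z)`. -/
def repDualHom (ħ : ℝ) : HeisGroup →* (Module.End ℂ W)ˣ :=
  HeisGroup.lift (scalarOp (Real.pi * I / ħ)) (shiftOp (2 * Real.pi * I)) (expMulOp (1 / ħ))
    (scalarOp_comm _ _) (scalarOp_comm _ _) (shift_mul_expMul _ _ _ (by congr 1; ring))

/-- The representation of `T_q` in `W`. -/
def rep (ħ : ℝ) : QTorus →ₐ[ℤ] Module.End ℂ W :=
  MonoidAlgebra.lift ℤ (Module.End ℂ W) HeisGroup ((Units.coeHom (Module.End ℂ W)).comp (repHom ħ))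

/-- The representation of `T_{q^∨}` in `W`. -/
def repDual (ħ : ℝ) : QTorus →ₐ[ℤ] Module.End ℂ W :=
  MonoidAlgebra.lift ℤ (Module.End ℂ W) HeisGroup
    ((Units.coeHom (Module.End ℂ W)).comp (repDualHom ħ))

theorem lift_commute {G : Type*} [Group G] {Q X Y Q' X' Y' : G} (h1 : Commute Q X) (h2 : Commute Q Y)
    (h3 : X * Y = Q ^ (2 : ℤ) * Y * X) (h1' : Commute Q' X') (h2' : Commute Q' Y')
    (h3' : X' * Y' = Q' ^ (2 : ℤ) * Y' * X')
    (hQ : ∀ g, Commute Q g) (hQ' : ∀ g, Commute g Q') (hXX : Commute X X') (hXY : Commute X Y')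
    (hYX : Commute Y X') (hYY : Commute Y Y') (g h : HeisGroup) :
    Commute (HeisGroup.lift Q X Y h1 h2 h3 g) (HeisGroup.lift Q' X' Y' h1' h2' h3' h) := by
  simp only [HeisGroup.lift, MonoidHom.coe_mk, OneHom.coe_mk]
  refine Commute.mul_left (Commute.mul_left ((hQ _).zpow_left _) ?_) ?_ <;>
  refine Commute.mul_right (Commute.mul_right ((hQ' _).zpow_right _) ?_) ?_
  exacts [hXX.zpow_zpow _ _, hXY.zpow_zpow _ _, hYX.zpow_zpow _ _, hYY.zpow_zpow _ _]

theorem rep_commute {ħ : ℝ} (hħ : 0 < ħ) (x y : QTorus) : Commute (rep ħ x) (repDual ħ y) := by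
  induction x using MonoidAlgebra.induction_on with
  | add x x' h h' => rw [map_add]; exact h.add_left h'
  | smul r x h => rw [map_smul]; exact h.smul_left r
  | of g =>
    induction y using MonoidAlgebra.induction_on with
    | add y y' h h' => rw [map_add]; exact h.add_right h'
    | smul r y h => rw [map_smul]; exact h.smul_right r
    | of h =>
      rw [rep, repDual, MonoidAlgebra.lift_of, MonoidAlgebra.lift_of]
      have h' : Commute (repHom ħ g) (repDualHom ħ h) := by
        refine lift_commute _ _ _ _ _ _ (scalarOp_comm _) (fun g => (scalarOp_comm _ g).symm)
          (shift_comm_shift _ _) ?_ ?_ (expMul_comm_expMul _ _) g h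
        · refine shift_comm_expMul _ _ ?_
          have h0 : (ħ : ℂ) ≠ 0 := by exact_mod_cast hħ.ne'
          have h1 : 1 / (ħ : ℂ) * (2 * Real.pi * I * ħ) = 2 * Real.pi * I := by field_simp
          rw [h1, exp_two_pi_mul_I]
        · refine (shift_comm_expMul _ _ ?_).symm
          rw [one_mul, exp_two_pi_mul_I]
      exact h'.map (Units.coeHom (Module.End ℂ W))

/-- The representation `A ↦ Â` of `L` in `W`. -/
def repL (ħ : ℝ) (hħ : 0 < ħ) : LAlg →ₐ[ℤ] Module.End ℂ W :=
  Algebra.TensorProduct.lift ((rep ħ).comp Lq.val) ((repDual ħ).comp Lq.val)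
    fun x y => rep_commute hħ x y

theorem W_differentiable (w : ℂ → ℂ) (hw : w ∈ W) : Differentiable ℂ w := by
  induction hw using Submodule.span_induction with
  | mem x h =>
    obtain ⟨a, b, P, -, rfl⟩ := h
    unfold gaussPoly
    exact (by fun_prop : Differentiable ℂ fun z : ℂ => exp (-a * z ^ 2 / 2 + b * z)).mul
      P.differentiable
  | zero => exact differentiable_const 0
  | add x y _ _ hx hy => exact hx.add hy
  | smul c x _ hx => exact hx.const_smul c

theorem gauss_memLp (a : ℝ) (b : ℂ) (ha : 0 < a) :
    MemLp (fun x : ℝ => exp (-a * (x : ℂ) ^ 2 / 2 + b * x)) 2 volume := by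
  rw [memLp_two_iff_integrable_sq_norm (by fun_prop)]
  have h := (integrable_cexp_quadratic' (b := -a) (by simpa using ha) (2 * b) 0).norm
  refine h.congr (Filter.Eventually.of_forall fun x => ?_)
  simp only
  rw [← norm_pow, ← exp_nat_mul]
  congr 2; push_cast; ring

theorem gaussPoly_memLp (a : ℝ) (b : ℂ) (P : Polynomial ℂ) (ha : 0 < a) :
    MemLp (fun x : ℝ => gaussPoly a b P x) 2 volume := by
  induction P using Polynomial.induction_on' with
  | add P R hP hR =>
    refine (hP.add hR).ae_eq (Filter.Eventually.of_forall fun x => ?_)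
    simp [gaussPoly, mul_add]
  | monomial n c =>
    have h := (((gauss_memLp a (b + 1) ha).norm.add (gauss_memLp a (b - 1) ha).norm).const_mul
      (‖c‖ * n.factorial))
    refine h.mono' ?_ (Filter.Eventually.of_forall fun x => ?_)
    · refine Continuous.aestronglyMeasurable ?_
      unfold gaussPoly
      fun_prop
    · simp only [gaussPoly, Polynomial.eval_monomial, norm_mul, norm_pow, norm_real, Pi.add_apply,
        norm_exp]
      have h1 : |x| ^ n ≤ n.factorial * (Real.exp x + Real.exp (-x)) := by
        have h2 := Real.pow_div_factorial_le_exp |x| (abs_nonneg x) n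
        rw [div_le_iff₀ (by positivity)] at h2
        have h3 : Real.exp |x| ≤ Real.exp x + Real.exp (-x) := by
          rcases abs_cases x with ⟨h, -⟩ | ⟨h, -⟩ <;> rw [h] <;>
            nlinarith [Real.exp_pos x, Real.exp_pos (-x)]
        nlinarith [(Nat.cast_nonneg n.factorial : (0 : ℝ) ≤ n.factorial)]
      have e1 : (-a * (x : ℂ) ^ 2 / 2 + (b + 1) * x).re = (-a * (x : ℂ) ^ 2 / 2 + b * x).re + x := by
        rw [add_mul, ← add_assoc, add_re, one_mul, ofReal_re]
      have e2 : (-a * (x : ℂ) ^ 2 / 2 + (b - 1) * x).re =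
          (-a * (x : ℂ) ^ 2 / 2 + b * x).re + -x := by
        rw [sub_mul, ← add_sub_assoc, sub_re, one_mul, ofReal_re, sub_eq_add_neg]
      rw [e1, e2, Real.exp_add, Real.exp_add, Real.norm_eq_abs]
      have h4 := mul_le_mul_of_nonneg_left h1
        (mul_nonneg (norm_nonneg c) (Real.exp_pos (-a * (x : ℂ) ^ 2 / 2 + b * x).re).le)
      linarith

theorem W_memLp (w : ℂ → ℂ) (hw : w ∈ W) : MemLp (fun x : ℝ => w x) 2 volume := by
  induction hw using Submodule.span_induction with
  | mem x h =>
    obtain ⟨a, b, P, ha, rfl⟩ := h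
    exact gaussPoly_memLp a b P ha
  | zero => exact MemLp.zero
  | add x y _ _ hx hy => exact hx.add hy
  | smul c x _ hx => exact hx.const_smul c

/-- The embedding `W → L²(ℝ)`, restriction to the real line. -/
def toL2 : W →ₗ[ℂ] L2R where
  toFun w := (W_memLp w w.2).toLp _
  map_add' _ _ := rfl
  map_smul' _ _ := rfl

theorem toL2_injective : Function.Injective toL2 := by
  rw [← LinearMap.ker_eq_bot, LinearMap.ker_eq_bot']
  intro w hw
  have hd := W_differentiable w w.2
  have h1 : (fun x : ℝ => w.1 x) =ᵐ[volume] fun _ => 0 := by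
    have h0 := (W_memLp w w.2).coeFn_toLp
    have h00 : (W_memLp w w.2).toLp _ = (0 : L2R) := hw
    rw [h00] at h0
    exact h0.symm.trans (Lp.coeFn_zero _ _ _)
  have h2 : (fun x : ℝ => w.1 x) = fun _ => 0 :=
    (Continuous.ae_eq_iff_eq volume (hd.continuous.comp continuous_ofReal) continuous_const).1 h1
  have h3 : w.1 = 0 := by
    have ha : AnalyticOnNhd ℂ w.1 Set.univ := fun z _ => hd.analyticAt z
    refine funext fun z => ?_
    refine ha.eqOn_of_preconnected_of_frequently_eq (g := 0) (fun z _ => analyticAt_const)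
      isPreconnected_univ (Set.mem_univ 0) ?_ (Set.mem_univ z)
    have ht : Filter.Tendsto (fun n : ℕ => ((1 / ((n : ℝ) + 1) : ℝ) : ℂ)) Filter.atTop
        (nhdsWithin 0 {0}ᶜ) := by
      refine tendsto_nhdsWithin_iff.2 ⟨?_, Filter.Eventually.of_forall fun n => ?_⟩
      · have := (continuous_ofReal.tendsto 0).comp tendsto_one_div_add_atTop_nhds_zero_nat
        simpa [Function.comp_def] using this
      · have : (1 / ((n : ℝ) + 1)) ≠ 0 := by positivity
        simpa using (by exact_mod_cast this : ((1 / ((n : ℝ) + 1) : ℝ) : ℂ) ≠ 0)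
    exact ht.frequently (Filter.Frequently.of_forall fun n => congrFun h2 _)
  exact Subtype.ext h3

/-- `Â` as an unbounded operator in `L²(ℝ)` with domain `W`. -/
def opW (ħ : ℝ) (hħ : 0 < ħ) (A : LAlg) : L2R →ₗ.[ℂ] L2R where
  domain := LinearMap.range toL2
  toFun := toL2 ∘ₗ repL ħ hħ A ∘ₗ
    (LinearEquiv.ofInjective toL2 toL2_injective).symm.toLinearMap

/-- The Schwartz space `S_L`: all `f ∈ L²(ℝ)` such that for each `A ∈ L` the functional
`w ↦ (f, Â w)` on `W` is continuous for the `L²`-norm. -/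
def schwartzL (ħ : ℝ) (hħ : 0 < ħ) : Submodule ℂ L2R :=
  ⨅ A : LAlg, (opW ħ hħ A).adjointDomain

/-- The operator `Â` on `S_L`: `Â f` is the unique `g ∈ L²(ℝ)` with `(g, w) = (f, B̂ w)` for all
`w ∈ W`, where `B = *A` (see `inner_hat`; `W` is dense by `W_dense`). -/
def hat (ħ : ℝ) (hħ : 0 < ħ) (A : LAlg) : schwartzL ħ hħ →ₗ[ℂ] L2R :=
  (opW ħ hħ (starL A)).adjoint.toFun ∘ₗ
    Submodule.inclusion (iInf_le (fun B : LAlg => (opW ħ hħ B).adjointDomain) (starL A))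

/-- `exp(-ipz) / (sh(πp) sh(πħp) p)`. -/
def dilogIntegrand (ħ : ℝ) (z p : ℂ) : ℂ :=
  exp (-(I * p * z)) / (sinh (Real.pi * p) * sinh (Real.pi * ħ * p)) / p

/-- A height between `0` and the poles `i`, `i/ħ` of the integrand on the positive imaginary axis. -/
def contourHeight (ħ : ℝ) : ℝ := min 1 (1 / ħ) / 2

/-- The quantum dilogarithm `Φ^ħ(z) = exp(-1/4 ∫_Ω exp(-ipz) / (sh(πp) sh(πħp)) dp/p)`.  The contour
`Ω` from `-∞` to `+∞` passes above the pole `p = 0` and below the other poles on the positive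
imaginary axis; it is taken as a horizontal line.  The integral converges for
`|Im z| < π(1 + ħ)`, in particular on the real line, where `Φ^ħ` is used below. -/
def qdilog (ħ : ℝ) (z : ℂ) : ℂ :=
  exp (-(1 / 4) * ∫ t : ℝ, dilogIntegrand ħ z (t + contourHeight ħ * I))

theorem norm_qdilog (ħ : ℝ) (x : ℝ) : ‖qdilog ħ x‖ = 1 := by
  set J := ∫ t : ℝ, dilogIntegrand ħ x (t + contourHeight ħ * I) with hJ
  have h : (starRingEnd ℂ) J = -J := by
    rw [hJ, ← integral_conj, ← integral_neg_eq_self, ← integral_neg]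
    congr 1
    funext t
    have e : (starRingEnd ℂ) (((-t : ℝ) : ℂ) + contourHeight ħ * I) =
        -((t : ℂ) + contourHeight ħ * I) := by
      simp; ring
    simp only [dilogIntegrand, map_div₀, map_mul, map_neg, ← exp_conj, ← sinh_conj, e, conj_ofReal,
      conj_I]
    simp only [mul_neg, sinh_neg, div_neg, neg_mul, neg_neg]
  have h2 : J.re = 0 := by
    have := congrArg re h
    simp at this
    linarith
  rw [qdilog, norm_exp, ← hJ]
  have : (-(1 / 4) * J).re = 0 := by
    rw [show (-(1 / 4) : ℂ) = ((-(1 / 4) : ℝ) : ℂ) by push_cast; ring, re_ofReal_mul, h2, mul_zero]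
  rw [this, Real.exp_zero]

theorem measurable_qdilog (ħ : ℝ) : Measurable fun x : ℝ => qdilog ħ x := by
  have h : StronglyMeasurable fun x : ℝ =>
      ∫ t : ℝ, dilogIntegrand ħ x (t + contourHeight ħ * I) := by
    refine StronglyMeasurable.integral_prod_right
      (f := fun x t : ℝ => dilogIntegrand ħ x (t + contourHeight ħ * I)) ?_
    refine Measurable.stronglyMeasurable ?_
    unfold Function.uncurry dilogIntegrand
    fun_prop
  exact (h.measurable.const_mul _).cexp

theorem memLp_mul {u : ℝ → ℂ} (hu : Measurable u) (h1 : ∀ x, ‖u x‖ = 1) (f : L2R) :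
    MemLp (fun x => u x * f x) 2 volume :=
  (Lp.memLp f).of_le (hu.aestronglyMeasurable.mul (Lp.aestronglyMeasurable f))
    (Filter.Eventually.of_forall fun x => by rw [norm_mul, h1, one_mul])

/-- Multiplication by a unimodular function. -/
def mulLin (u : ℝ → ℂ) (hu : Measurable u) (h1 : ∀ x, ‖u x‖ = 1) : L2R →ₗᵢ[ℂ] L2R where
  toFun f := (memLp_mul hu h1 f).toLp _
  map_add' f g := by
    rw [← MemLp.toLp_add]
    refine MemLp.toLp_congr _ _ ?_
    filter_upwards [Lp.coeFn_add f g] with x hx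
    rw [hx, Pi.add_apply, Pi.add_apply, mul_add]
  map_smul' c f := by
    rw [RingHom.id_apply, ← MemLp.toLp_const_smul]
    refine MemLp.toLp_congr _ _ ?_
    filter_upwards [Lp.coeFn_smul c f] with x hx
    rw [hx, Pi.smul_apply, Pi.smul_apply, smul_eq_mul, smul_eq_mul, mul_left_comm]
  norm_map' f := by
    change ‖(memLp_mul hu h1 f).toLp _‖ = ‖f‖
    rw [Lp.norm_toLp, Lp.norm_def]
    congr 1
    refine eLpNorm_congr_norm_ae (Filter.Eventually.of_forall fun x => ?_)
    rw [norm_mul, h1, one_mul]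

theorem mulLin_coe (u : ℝ → ℂ) (hu : Measurable u) (h1 : ∀ x, ‖u x‖ = 1) (f : L2R) :
    mulLin u hu h1 f =ᵐ[volume] fun x => u x * f x :=
  (memLp_mul hu h1 f).coeFn_toLp

theorem norm_inv_eq_one {u : ℝ → ℂ} (h1 : ∀ x, ‖u x‖ = 1) (x : ℝ) : ‖(u x)⁻¹‖ = 1 := by
  rw [norm_inv, h1, inv_one]

/-- Multiplication by a unimodular function as a unitary operator. -/
def mulEquiv (u : ℝ → ℂ) (hu : Measurable u) (h1 : ∀ x, ‖u x‖ = 1) : L2R ≃ₗᵢ[ℂ] L2R :=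
  LinearIsometryEquiv.mk
    (LinearEquiv.ofLinearMap (mulLin u hu h1).toLinearMap
      (mulLin (fun x => (u x)⁻¹) hu.inv (norm_inv_eq_one h1)).toLinearMap
      (LinearMap.ext fun f => Lp.ext (by
        have hn : ∀ x, u x ≠ 0 := fun x hx => by simpa [hx] using h1 x
        filter_upwards [mulLin_coe u hu h1 (mulLin (fun x => (u x)⁻¹) hu.inv (norm_inv_eq_one h1) f),
          mulLin_coe (fun x => (u x)⁻¹) hu.inv (norm_inv_eq_one h1) f] with x hx hx'
        refine hx.trans ?_
        rw [hx', mul_inv_cancel_left₀ (hn x)]; rfl))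
      (LinearMap.ext fun f => Lp.ext (by
        have hn : ∀ x, u x ≠ 0 := fun x hx => by simpa [hx] using h1 x
        filter_upwards [mulLin_coe (fun x => (u x)⁻¹) hu.inv (norm_inv_eq_one h1) (mulLin u hu h1 f),
          mulLin_coe u hu h1 f] with x hx hx'
        refine hx.trans ?_
        rw [hx', inv_mul_cancel_left₀ (hn x)]; rfl)))
    (mulLin u hu h1).norm_map

theorem quasi_mul {r : ℝ} (hr : r ≠ 0) :
    Measure.QuasiMeasurePreserving (fun x : ℝ => r * x) volume volume := by
  refine ⟨measurable_const_mul r, ?_⟩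
  rw [Real.map_volume_mul_left hr]
  exact Measure.smul_absolutelyContinuous

theorem eLpNorm_dil {r : ℝ} (hr : r ≠ 0) (f : L2R) :
    eLpNorm (fun x => f (r * x)) 2 volume =
      ENNReal.ofReal |r⁻¹| ^ (1 / (2 : ENNReal)).toReal * eLpNorm f 2 volume := by
  have h1 := eLpNorm_map_measure (μ := volume) (p := 2) (g := f) (f := fun x : ℝ => r * x)
    (by rw [Real.map_volume_mul_left hr]
        exact (Lp.aestronglyMeasurable f).mono_ac Measure.smul_absolutelyContinuous)
    (measurable_const_mul r).aemeasurable
  rw [Real.map_volume_mul_left hr, eLpNorm_smul_measure_of_ne_top (by simp)] at h1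
  exact h1.symm

theorem memLp_dil {r : ℝ} (hr : r ≠ 0) (f : L2R) : MemLp (fun x => f (r * x)) 2 volume := by
  refine ⟨(Lp.aestronglyMeasurable f).comp_quasiMeasurePreserving (quasi_mul hr), ?_⟩
  rw [eLpNorm_dil hr]
  exact ENNReal.mul_lt_top (ENNReal.rpow_lt_top_of_nonneg (by simp) (by simp)) (Lp.eLpNorm_lt_top f)

/-- The dilation `f(x) ↦ f(rx)`. -/
def dilLin (r : ℝ) (hr : r ≠ 0) : L2R →L[ℂ] L2R :=
  LinearMap.mkContinuous
    { toFun f := (memLp_dil hr f).toLp _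
      map_add' f g := by
        rw [← MemLp.toLp_add]
        refine MemLp.toLp_congr _ _ ?_
        filter_upwards [(quasi_mul hr).ae (Lp.coeFn_add f g)] with x hx
        exact hx
      map_smul' c f := by
        rw [RingHom.id_apply, ← MemLp.toLp_const_smul]
        refine MemLp.toLp_congr _ _ ?_
        filter_upwards [(quasi_mul hr).ae (Lp.coeFn_smul c f)] with x hx
        exact hx }
    (ENNReal.ofReal |r⁻¹| ^ (1 / (2 : ENNReal)).toReal).toReal
    (fun f => by
      change ‖(memLp_dil hr f).toLp _‖ ≤ _
      rw [Lp.norm_toLp, eLpNorm_dil hr, ENNReal.toReal_mul, Lp.norm_def])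

theorem dilLin_coe {r : ℝ} (hr : r ≠ 0) (f : L2R) :
    dilLin r hr f =ᵐ[volume] fun x => f (r * x) :=
  (memLp_dil hr f).coeFn_toLp

theorem dilLin_inv {r s : ℝ} (hr : r ≠ 0) (hs : s ≠ 0) (h : s * r = 1) (f : L2R) :
    dilLin r hr (dilLin s hs f) = f := by
  refine Lp.ext ?_
  filter_upwards [dilLin_coe hr (dilLin s hs f), (quasi_mul hr).ae (dilLin_coe hs f)] with x hx hx'
  rw [hx, hx', ← mul_assoc, h, one_mul]

/-- The dilation as an invertible operator. -/
def dilEquiv (r : ℝ) (hr : r ≠ 0) : L2R ≃L[ℂ] L2R :=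
  ContinuousLinearEquiv.equivOfInverse (dilLin r hr) (dilLin r⁻¹ (inv_ne_zero hr))
    (dilLin_inv _ _ (mul_inv_cancel₀ hr)) (dilLin_inv _ _ (inv_mul_cancel₀ hr))

theorem scale_ne {ħ : ℝ} (hħ : 0 < ħ) : 1 / (4 * Real.pi ^ 2 * ħ) ≠ 0 := by positivity

/-- The operator `K`: multiplication by `Φ^ħ`, followed by the `L²` Fourier transform in the
normalization `∫ f(x) exp(-xz/(2πiħ)) dx`, that is, by the inverse Fourier transform
`∫ f(x) exp(2πixu) dx` evaluated at `u = z/(4π²ħ)` (see `K_apply_ae`). -/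
def K (ħ : ℝ) (hħ : 0 < ħ) : L2R ≃L[ℂ] L2R :=
  ((mulEquiv (fun x => qdilog ħ x) (measurable_qdilog ħ) (norm_qdilog ħ)).trans
    (Lp.fourierTransformₗᵢ ℝ ℂ).symm).toContinuousLinearEquiv.trans
      (dilEquiv (1 / (4 * Real.pi ^ 2 * ħ)) (scale_ne hħ))

open FourierTransform in
theorem fourierInv_coe_ae (g : L2R) (hg : Integrable g volume) :
    ((𝓕⁻ g : L2R) : ℝ → ℂ) =ᵐ[volume] 𝓕⁻ (g : ℝ → ℂ) := by
  have hL : Continuous fun p : ℝ × ℝ => (-innerₗ ℝ) p.1 p.2 := by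
    change Continuous fun p : ℝ × ℝ => -(inner ℝ p.1 p.2)
    exact (Continuous.inner (𝕜 := ℝ) continuous_fst continuous_snd).neg
  have hF : ∀ f : ℝ → ℂ, VectorFourier.fourierIntegral Real.fourierChar volume (-innerₗ ℝ) f =
      𝓕⁻ f := by
    intro f
    funext w
    simp [VectorFourier.fourierIntegral, Real.fourierInv_eq]
  have hF' : ∀ f : ℝ → ℂ, VectorFourier.fourierIntegral Real.fourierChar volume (-innerₗ ℝ).flip f =
      𝓕⁻ f := by
    intro f
    funext w
    simp [VectorFourier.fourierIntegral, Real.fourierInv_eq, mul_comm]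
  have hcont : Continuous (𝓕⁻ (g : ℝ → ℂ)) := by
    rw [← hF]
    exact VectorFourier.fourierIntegral_continuous Real.continuous_fourierChar hL hg
  refine ae_eq_of_integral_contDiff_smul_eq
    ((Lp.memLp (𝓕⁻ g : L2R)).locallyIntegrable (by norm_num)) hcont.locallyIntegrable ?_
  intro φ hφ hφc
  have hc : HasCompactSupport fun x => (φ x : ℂ) := hφc.comp_left ofReal_zero
  let ψ : SchwartzMap ℝ ℂ := hc.toSchwartzMap (ofRealCLM.contDiff.comp hφ)
  have hψ : ∀ x, ψ x = φ x := fun x => rfl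
  have h1 := DFunLike.congr_fun (Lp.fourierInv_toTemperedDistribution_eq g) ψ
  rw [TemperedDistribution.fourierInv_apply, Lp.toTemperedDistribution_apply,
    Lp.toTemperedDistribution_apply, SchwartzMap.fourierInv_coe] at h1
  have h2 := VectorFourier.integral_fourierIntegral_smul_eq_flip (L := -innerₗ ℝ)
    (μ := (volume : Measure ℝ)) (ν := (volume : Measure ℝ)) Real.continuous_fourierChar hL
    ψ.integrable hg
  rw [hF, hF'] at h2
  rw [h2] at h1
  simpa [hψ] using h1.symm

/-- On `L¹ ∩ L²` the operator `K` is given by its integral formula. -/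
theorem K_apply_ae {ħ : ℝ} (hħ : 0 < ħ) (f : L2R) (hf : Integrable f volume) :
    K ħ hħ f =ᵐ[volume] fun z : ℝ =>
      ∫ x : ℝ, f x * qdilog ħ x * exp (-(x * z) / (2 * Real.pi * I * ħ)) := by
  set g : L2R := mulLin (fun x => qdilog ħ x) (measurable_qdilog ħ) (norm_qdilog ħ) f with hg
  have hgf : g =ᵐ[volume] fun x : ℝ => qdilog ħ x * f x := mulLin_coe _ _ _ f
  have hgi : Integrable g volume := by
    refine Integrable.congr ?_ hgf.symm
    refine hf.bdd_mul (c := 1) (measurable_qdilog ħ).aestronglyMeasurable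
      (Filter.Eventually.of_forall fun x => (norm_qdilog ħ x).le)
  have h1 := dilLin_coe (scale_ne hħ) (FourierTransform.fourierInv g : L2R)
  have h2 := (quasi_mul (scale_ne hħ)).ae (fourierInv_coe_ae g hgi)
  filter_upwards [h1, h2] with z h1 h2
  refine h1.trans (h2.trans ?_)
  rw [Real.fourierInv_eq']
  refine integral_congr_ae ?_
  filter_upwards [hgf] with x hx
  rw [hx, smul_eq_mul, mul_comm, mul_comm (qdilog ħ x)]
  congr 2
  have h0 : (ħ : ℂ) ≠ 0 := by exact_mod_cast hħ.ne'
  have hpi : (Real.pi : ℂ) ≠ 0 := by exact_mod_cast Real.pi_ne_zero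
  have hI : (I : ℂ) ≠ 0 := I_ne_zero
  simp only [RCLike.inner_apply, conj_trivial]
  push_cast
  field_simp
  rw [I_sq]; ring

theorem W_dense : Dense ((LinearMap.range toL2 : Submodule ℂ L2R) : Set L2R) := by
  rw [Submodule.dense_iff_topologicalClosure_eq_top, Submodule.topologicalClosure_eq_top_iff,
    Submodule.eq_bot_iff]
  intro f hf
  have hG := gauss_memLp 1 0 one_pos
  have hGn : ∀ x : ℝ, ‖exp (-(1 : ℝ) * (x : ℂ) ^ 2 / 2 + 0 * x)‖ ≤ 1 := fun x => by
    rw [norm_exp, Real.exp_le_one_iff]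
    have : (-((1 : ℝ) : ℂ) * (x : ℂ) ^ 2 / 2 + 0 * x) = ((-(x ^ 2 / 2) : ℝ) : ℂ) := by
      push_cast; ring
    rw [this, ofReal_re]
    have := sq_nonneg x
    linarith
  have hfc : MemLp (fun x => (starRingEnd ℂ) (f x)) 2 volume :=
    (Lp.memLp f).of_le (continuous_conj.comp_aestronglyMeasurable (Lp.aestronglyMeasurable f))
      (Filter.Eventually.of_forall fun x => by simp)
  have h2 : MemLp (fun x : ℝ => (starRingEnd ℂ) (f x) *
      exp (-(1 : ℝ) * (x : ℂ) ^ 2 / 2 + 0 * x)) 2 volume :=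
    (Lp.memLp f).of_le (hfc.1.mul hG.1) (Filter.Eventually.of_forall fun x => by
      rw [norm_mul, RCLike.norm_conj]
      exact mul_le_of_le_one_right (norm_nonneg _) (hGn x))
  have h1 : Integrable (fun x : ℝ => (starRingEnd ℂ) (f x) *
      exp (-(1 : ℝ) * (x : ℂ) ^ 2 / 2 + 0 * x)) volume := hfc.integrable_mul hG
  have h0 : FourierTransform.fourierInv (h2.toLp _ : L2R) = 0 := by
    refine Lp.ext ?_
    refine (fourierInv_coe_ae (h2.toLp _) (h1.congr h2.coeFn_toLp.symm)).trans ?_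
    refine Filter.EventuallyEq.trans ?_ (Lp.coeFn_zero ℂ 2 volume).symm
    refine Filter.Eventually.of_forall fun ξ => ?_
    rw [Real.fourierInv_eq']
    have hw : gaussPoly 1 (2 * Real.pi * I * ξ) 1 ∈ W :=
      Submodule.subset_span ⟨1, _, 1, one_pos, rfl⟩
    have hin := (Submodule.mem_orthogonal' _ f).1 hf (toL2 ⟨_, hw⟩) ⟨_, rfl⟩
    rw [L2.inner_def] at hin
    rw [Pi.zero_apply]
    refine Eq.trans ?_ hin
    refine integral_congr_ae ?_
    filter_upwards [h2.coeFn_toLp, (W_memLp _ hw).coeFn_toLp] with x hx hx'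
    rw [hx]
    change _ = inner ℂ (f x) ((W_memLp _ hw).toLp _ x)
    have hin' : (inner ℝ x ξ : ℝ) = ξ * x := rfl
    rw [hx', hin', RCLike.inner_apply, gaussPoly, Polynomial.eval_one, mul_one, smul_eq_mul,
      mul_comm ((starRingEnd ℂ) (f x)), ← mul_assoc, ← exp_add]
    congr 2
    push_cast
    ring
  have h3 : (h2.toLp _ : L2R) = 0 := by
    exact (Lp.fourierTransformₗᵢ ℝ ℂ).symm.map_eq_zero_iff.1 h0
  refine Lp.ext ?_
  have h4 := h2.coeFn_toLp
  rw [h3] at h4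
  filter_upwards [h4, Lp.coeFn_zero ℂ 2 (volume : Measure ℝ)] with x hx hx'
  rw [hx', Pi.zero_apply] at hx
  rw [hx', Pi.zero_apply]
  have := (mul_eq_zero.1 hx.symm).resolve_right (exp_ne_zero _)
  simpa using this

theorem inner_hat {ħ : ℝ} (hħ : 0 < ħ) (A : LAlg) (s : schwartzL ħ hħ) (w : W) :
    inner ℂ (hat ħ hħ A s) (toL2 w) = inner ℂ (s : L2R) (toL2 (repL ħ hħ (starL A) w)) := by
  have hd : Dense ((opW ħ hħ (starL A)).domain : Set L2R) := W_dense
  have h := LinearPMap.adjoint_isFormalAdjoint hd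
    (⟨s, (iInf_le (fun B : LAlg => (opW ħ hħ B).adjointDomain) (starL A)) s.2⟩)
    ⟨toL2 w, ⟨w, rfl⟩⟩
  refine h.trans ?_
  congr 1
  simp only [opW]
  change toL2 (repL ħ hħ (starL A) ((LinearEquiv.ofInjective toL2 toL2_injective).symm
    ((LinearEquiv.ofInjective toL2 toL2_injective) w))) = _
  rw [LinearEquiv.symm_apply_apply]

end QuantumM05

end

/-!
# The five-periodic operator on the Schwartz space intertwines `*`-representations

Write `c, d` for the two periods, so that `(c, d) = (ħ, 1)` for the factor `𝕃_q` and `(1, ħ)` for the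
factor with `q^∨`: in either factor `v₁ = Y` is multiplication by `exp(x/d)` and `v₀ = X⁻¹` is the
imaginary translation `w(x) ↦ w(x - 2πic)`. For `B ∈ L` consider the relation
`(K s, B̂ w) = (K Ĉ s, w)`, `C = γ(*B)`, for all `s` in the Schwartz space and all `w ∈ W`
(`Intertwines`). If it holds for all `B`, then `K s` lies in the Schwartz space and the theorem
follows. The elements `B` that satisfy it form a subalgebra, so only `q^k` and the `v_i` of both
factors matter. Moreover the relation for `BC` and for `C` gives it for `B` when `C` is surjective
on `W`; with the exchange relations `v₂v₀ = 1 + q v₁`, `v₄v₁ = 1 + q⁻¹ v₀`, `v₃v₀ = 1 + q⁻¹ v₄`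
it suffices to treat `v₀` and `v₁`, which are invertible on `W`.

For `v₀` one has `γ(v₀) = v₁`, and the relation says that the Fourier transform turns a
multiplication by `exp(x/d)` into an imaginary translation: it is obtained by shifting a contour.

For `v₁` one has `γ(v₁) = v₂`, and the relation says that `Φ v₂ s` is the imaginary translate of
`Φ s` by `2πic` (`IsFactor.isShift_v2`). What is known is that `v₀ v₂ s = (1 + q⁻¹ v₁) s`, that is,
`v₂ s` translated by `-2πic` equals `(1 + q⁻¹ exp(x/d)) s`. The difference equation
`Φ(x + πic) = (1 + exp(x/d)) Φ(x - πic)` (`IsPeriods.dilog_add`), which comes from the Fourier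
transform of `1 / sh`, and two shifts of the contour by `πic`, within the strip `|Im z| ≤ πc` where
`Φ⁻¹` is bounded in terms of its boundary values by the Phragmén-Lindelöf principle, show that both
sides pair equally with `(1 + q⁻¹ exp(z/d)) g(z)`, for all decaying holomorphic `g`
(`DilogTriple.pair_eq`). It remains to divide by this factor.
* If `c ≤ d`, the factor has no zero inside the strip `0 ≤ Im z ≤ 2πc`, and each `w ∈ W` is
  approximated by its multiples, boundedly along both boundary lines (`DilogTriple.isShift_of_le`).
* If `c > d`, the factor may vanish inside the strip, and such an approximation does not exist in
  general. But by the first case, applied to the other factor as often as necessary, `Φ s` has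
  imaginary translates in `L²(ℝ)` that go arbitrarily far, and so has one by `2πic`. Since the
  multiples of the factor separate functions on the real line, where it vanishes at most at one
  point, this translate is `Φ v₂ s` (`DilogTriple.isShift_of_exists`).
-/

noncomputable section

namespace QuantumM05

open MeasureTheory Complex

/-! ### Shifting contours in a horizontal strip -/

theorem integrable_exp_neg_mul_abs {ε : ℝ} (hε : 0 < ε) :
    Integrable fun x : ℝ => Real.exp (-(ε * |x|)) := by
  rw [← integrableOn_univ, ← Set.Iic_union_Ioi (a := (0 : ℝ))]
  refine IntegrableOn.union ?_ ?_
  · refine (integrableOn_exp_mul_Iic hε 0).congr_fun (fun x hx => ?_) measurableSet_Iic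
    simp only [abs_of_nonpos (Set.mem_Iic.1 hx)]; congr 1; ring
  · refine (integrableOn_exp_mul_Ioi (neg_neg_of_pos hε) 0).congr_fun (fun x hx => ?_)
      measurableSet_Ioi
    simp only [abs_of_pos (Set.mem_Ioi.1 hx)]; congr 1; ring

/-- Cauchy's theorem for the two boundary lines of the strip `a ≤ Im z ≤ b`. The integrand need
only be continuous at a countable set of points, which covers removable singularities. -/
theorem integral_line_eq {f : ℂ → ℂ} {a b : ℝ} (hab : a ≤ b) {S : Set ℂ} (hS : S.Countable)
    (hc : ContinuousOn f (im ⁻¹' Set.Icc a b))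
    (hd : ∀ z : ℂ, z.im ∈ Set.Ioo a b → z ∉ S → DifferentiableAt ℂ f z) {C ε : ℝ} (hε : 0 < ε)
    (hb : ∀ z : ℂ, z.im ∈ Set.Icc a b → ‖f z‖ ≤ C * Real.exp (-(ε * |z.re|))) :
    ∫ x : ℝ, f (x + a * I) = ∫ x : ℝ, f (x + b * I) := by
  have hint : ∀ y ∈ Set.Icc a b, Integrable fun x : ℝ => f (x + y * I) := by
    intro y hy
    refine ((integrable_exp_neg_mul_abs hε).const_mul C).mono' ?_
      (Filter.Eventually.of_forall fun x => ?_)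
    · refine Continuous.aestronglyMeasurable ?_
      refine hc.comp_continuous (by fun_prop) fun x => ?_
      simpa using hy
    · simpa using hb (x + y * I) (by simpa using hy)
  have hT : ∀ y ∈ Set.Icc a b, Filter.Tendsto (fun R : ℝ => ∫ x in (-R)..R, f (x + y * I))
      Filter.atTop (nhds (∫ x : ℝ, f (x + y * I))) := fun y hy =>
    intervalIntegral_tendsto_integral (hint y hy) Filter.tendsto_neg_atTop_atBot Filter.tendsto_id
  have hdecay : Filter.Tendsto (fun R : ℝ => C * Real.exp (-(ε * |R|)) * |b - a|) Filter.atTop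
      (nhds 0) := by
    have h1 : Filter.Tendsto (fun R : ℝ => -(ε * |R|)) Filter.atTop Filter.atBot :=
      Filter.tendsto_neg_atTop_atBot.comp
        (Filter.tendsto_abs_atTop_atTop.const_mul_atTop hε)
    simpa using ((Real.tendsto_exp_atBot.comp h1).const_mul C).mul_const |b - a|
  have hside : ∀ σ : ℝ, |σ| = 1 → Filter.Tendsto
      (fun R : ℝ => ∫ y in a..b, f (((σ * R : ℝ) : ℂ) + y * I)) Filter.atTop (nhds 0) := by
    intro σ hσ
    refine squeeze_zero_norm (fun R => ?_) hdecay
    refine intervalIntegral.norm_integral_le_of_norm_le_const fun y hy => ?_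
    rw [Set.uIoc_of_le hab] at hy
    have := hb (((σ * R : ℝ) : ℂ) + y * I) (by simpa using ⟨hy.1.le, hy.2⟩)
    simpa [abs_mul, hσ] using this
  have hrect : ∀ R : ℝ, 0 ≤ R → (∫ x in (-R)..R, f (x + a * I)) - (∫ x in (-R)..R, f (x + b * I)) +
      I * (∫ y in a..b, f (((1 * R : ℝ) : ℂ) + y * I)) -
      I * (∫ y in a..b, f (((-1 * R : ℝ) : ℂ) + y * I)) = 0 := by
    intro R hR
    have := integral_boundary_rect_eq_zero_of_differentiable_on_off_countable f
      ⟨-R, a⟩ ⟨R, b⟩ S hS (hc.mono fun z hz => by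
        have := (mem_reProdIm.1 hz).2
        rwa [Set.uIcc_of_le hab] at this) (fun z hz => by
        have := (mem_reProdIm.1 hz.1).2
        simp only [min_eq_left hab, max_eq_right hab] at this
        exact hd z this hz.2)
    simpa using this
  have hlim := (((hT a ⟨le_rfl, hab⟩).sub (hT b ⟨hab, le_rfl⟩)).add
    ((hside 1 (by simp)).const_mul I)).sub ((hside (-1) (by simp)).const_mul I)
  have h0 := tendsto_nhds_unique (hlim.congr' (by
    filter_upwards [Filter.eventually_ge_atTop 0] with R hR using hrect R hR)) tendsto_const_nhds
  simpa [sub_eq_zero] using h0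

/-- `f` is holomorphic in the strip `a < Im z < b`, continuous up to its boundary, and decays there
faster than every exponential `exp(-n |Re z|)`. -/
structure StripDecay (a b : ℝ) (f : ℂ → ℂ) : Prop where
  cont : ContinuousOn f (im ⁻¹' Set.Icc a b)
  diff : DifferentiableOn ℂ f (im ⁻¹' Set.Ioo a b)
  decay : ∀ n : ℝ, ∃ C, ∀ z : ℂ, z.im ∈ Set.Icc a b → ‖f z‖ ≤ C * Real.exp (-(n * |z.re|))

theorem isOpen_strip (a b : ℝ) : IsOpen (im ⁻¹' Set.Ioo a b) := isOpen_Ioo.preimage continuous_im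

namespace StripDecay

variable {a b : ℝ} {f g : ℂ → ℂ}

theorem mono (hf : StripDecay a b f) {a' b' : ℝ} (ha : a ≤ a') (hb : b' ≤ b) :
    StripDecay a' b' f where
  cont := hf.cont.mono (Set.preimage_mono (Set.Icc_subset_Icc ha hb))
  diff := hf.diff.mono (Set.preimage_mono (Set.Ioo_subset_Ioo ha hb))
  decay n := by
    obtain ⟨C, hC⟩ := hf.decay n
    exact ⟨C, fun z hz => hC z (Set.Icc_subset_Icc ha hb hz)⟩

theorem add (hf : StripDecay a b f) (hg : StripDecay a b g) :
    StripDecay a b fun z => f z + g z where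
  cont := hf.cont.add hg.cont
  diff := hf.diff.add hg.diff
  decay n := by
    obtain ⟨C, hC⟩ := hf.decay n
    obtain ⟨D, hD⟩ := hg.decay n
    refine ⟨C + D, fun z hz => (norm_add_le _ _).trans ?_⟩
    rw [add_mul]
    exact add_le_add (hC z hz) (hD z hz)

/-- Decay is preserved by multiplication with a function of at most exponential growth. -/
theorem mul_left (hf : StripDecay a b f) (hc : ContinuousOn g (im ⁻¹' Set.Icc a b))
    (hd : DifferentiableOn ℂ g (im ⁻¹' Set.Ioo a b)) {D m : ℝ}
    (hg : ∀ z : ℂ, z.im ∈ Set.Icc a b → ‖g z‖ ≤ D * Real.exp (m * |z.re|)) :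
    StripDecay a b fun z => g z * f z where
  cont := hc.mul hf.cont
  diff := hd.mul hf.diff
  decay n := by
    obtain ⟨C, hC⟩ := hf.decay (n + m)
    refine ⟨D * C, fun z hz => ?_⟩
    rw [norm_mul]
    refine (mul_le_mul (hg z hz) (hC z hz) (norm_nonneg _)
      ((norm_nonneg _).trans (hg z hz))).trans_eq ?_
    rw [mul_mul_mul_comm, ← Real.exp_add]
    congr 2; ring

theorem const_mul (hf : StripDecay a b f) (c : ℂ) : StripDecay a b fun z => c * f z :=
  hf.mul_left (g := fun _ => c) (D := ‖c‖) (m := 0) continuousOn_const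
    (differentiableOn_const c) fun z _ => by simp

theorem exp_mul (hf : StripDecay a b f) (β : ℂ) : StripDecay a b fun z => exp (β * z) * f z := by
  refine hf.mul_left (D := Real.exp (|β.im| * max |a| |b|)) (m := |β.re|) (by fun_prop)
    (by fun_prop) fun z hz => ?_
  rw [norm_exp, ← Real.exp_add, mul_re]
  refine Real.exp_le_exp.2 ?_
  have h1 : β.re * z.re ≤ |β.re| * |z.re| := by rw [← abs_mul]; exact le_abs_self _
  have h2 : -(β.im * z.im) ≤ |β.im| * |z.im| := by rw [← abs_mul]; exact neg_le_abs _
  have h3 : |z.im| ≤ max |a| |b| := abs_le_max_abs_abs hz.1 hz.2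
  nlinarith [abs_nonneg β.im]

theorem translate (hf : StripDecay a b f) (y : ℝ) :
    StripDecay (a - y) (b - y) fun z => f (z + y * I) where
  cont := hf.cont.comp (by fun_prop) fun z hz => by
    simp only [Set.mem_preimage, Set.mem_Icc] at hz ⊢
    simp; constructor <;> linarith [hz.1, hz.2]
  diff := hf.diff.comp (by fun_prop) fun z hz => by
    simp only [Set.mem_preimage, Set.mem_Ioo] at hz ⊢
    simp; constructor <;> linarith [hz.1, hz.2]
  decay n := by
    obtain ⟨C, hC⟩ := hf.decay n
    refine ⟨C, fun z hz => ?_⟩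
    have := hC (z + y * I) (by
      simp only [Set.mem_Icc] at hz ⊢
      simp; constructor <;> linarith [hz.1, hz.2])
    simpa using this

theorem continuous_line (hf : StripDecay a b f) {y : ℝ} (hy : y ∈ Set.Icc a b) :
    Continuous fun x : ℝ => f (x + y * I) :=
  hf.cont.comp_continuous (by fun_prop) fun x => by simpa using hy

theorem integrable_line (hf : StripDecay a b f) {y : ℝ} (hy : y ∈ Set.Icc a b) :
    Integrable fun x : ℝ => f (x + y * I) := by
  obtain ⟨C, hC⟩ := hf.decay 1
  refine ((integrable_exp_neg_mul_abs one_pos).const_mul C).mono'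
    (hf.continuous_line hy).aestronglyMeasurable (Filter.Eventually.of_forall fun x => ?_)
  simpa using hC (x + y * I) (by simpa using hy)

theorem memLp_line (hf : StripDecay a b f) {y : ℝ} (hy : y ∈ Set.Icc a b) :
    MemLp (fun x : ℝ => f (x + y * I)) 2 volume := by
  rw [memLp_two_iff_integrable_sq_norm (hf.continuous_line hy).aestronglyMeasurable]
  obtain ⟨C, hC⟩ := hf.decay 1
  refine ((integrable_exp_neg_mul_abs two_pos).const_mul (C ^ 2)).mono'
    ((hf.continuous_line hy).norm.pow 2).aestronglyMeasurable
    (Filter.Eventually.of_forall fun x => ?_)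
  have h := hC (x + y * I) (by simpa using hy)
  simp only [add_re, ofReal_re, mul_re, I_re, I_im, ofReal_im, mul_zero, mul_one, sub_zero,
    add_zero, one_mul] at h
  rw [Real.norm_of_nonneg (by positivity)]
  refine (pow_le_pow_left₀ (norm_nonneg _) h 2).trans_eq ?_
  rw [mul_pow, ← Real.exp_nat_mul]
  congr 2; push_cast; ring

/-- Translation by `(b - a) i` multiplies the Fourier transform by an exponential. -/
theorem fourier_shift (hf : StripDecay a b f) (hab : a ≤ b) (κ : ℝ) :
    ∫ x : ℝ, exp (I * κ * x) * f (x + b * I) =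
      exp (κ * (b - a)) * ∫ x : ℝ, exp (I * κ * x) * f (x + a * I) := by
  have h := hf.exp_mul (I * κ)
  obtain ⟨C, hC⟩ := h.decay 1
  have h1 := integral_line_eq hab Set.countable_empty h.cont
    (fun z hz _ => h.diff.differentiableAt ((isOpen_strip a b).mem_nhds hz)) one_pos hC
  have h2 : ∀ y x : ℝ, exp (I * κ * (x + y * I)) = exp (-(κ * y)) * exp (I * κ * x) := by
    intro y x
    rw [← exp_add]
    congr 1
    linear_combination (κ * y : ℂ) * I_mul_I
  simp only [h2, mul_assoc (exp (-_))] at h1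
  rw [integral_const_mul, integral_const_mul] at h1
  have h3 : exp (κ * (b - a)) = exp (-(κ * a)) * exp (κ * b) := by
    rw [← exp_add]; congr 1; ring
  rw [h3, mul_comm (exp (-(κ * a))), mul_assoc, h1, ← mul_assoc, ← exp_add, add_neg_cancel, exp_zero,
    one_mul]

end StripDecay

theorem gaussPoly_stripDecay {α : ℝ} (hα : 0 < α) (β : ℂ) (P : Polynomial ℂ) (a b : ℝ) :
    StripDecay a b (gaussPoly α β P) := by
  have hg : StripDecay a b fun z => exp (-α * z ^ 2 / 2) := by
    refine ⟨by fun_prop, by fun_prop, fun n => ?_⟩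
    refine ⟨Real.exp (α * max |a| |b| ^ 2 / 2 + n ^ 2 / (2 * α)), fun z hz => ?_⟩
    rw [norm_exp, ← Real.exp_add]
    refine Real.exp_le_exp.2 ?_
    have h1 : (-α * z ^ 2 / 2).re = -α * (z.re ^ 2 - z.im ^ 2) / 2 := by
      rw [show (-α * z ^ 2 / 2 : ℂ) = ((-α / 2 : ℝ) : ℂ) * (z * z) by push_cast; ring, re_ofReal_mul,
        mul_re]
      ring
    rw [h1]
    have h3 : |z.im| ≤ max |a| |b| := abs_le_max_abs_abs hz.1 hz.2
    have h4 : z.im ^ 2 ≤ max |a| |b| ^ 2 := by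
      rw [← sq_abs]; exact pow_le_pow_left₀ (abs_nonneg _) h3 2
    -- Completing the square bounds the exponential weight by half of the Gaussian exponent.
    have h5 : n * |z.re| ≤ n ^ 2 / (2 * α) + α * z.re ^ 2 / 2 := by
      rw [← sq_abs z.re]
      have : n ^ 2 / (2 * α) + α * |z.re| ^ 2 / 2 - n * |z.re| = (n - α * |z.re|) ^ 2 / (2 * α) := by
        field_simp; ring
      have h6 : 0 ≤ (n - α * |z.re|) ^ 2 / (2 * α) := by positivity
      linarith
    nlinarith
  have hβ : StripDecay a b fun z => exp (-α * z ^ 2 / 2 + β * z) := by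
    have := hg.exp_mul β
    convert! this using 2 with z
    rw [← exp_add, add_comm]
  have hz : ∀ f : ℂ → ℂ, StripDecay a b f → StripDecay a b fun z => z * f z := by
    intro f hf
    refine hf.mul_left (g := fun z => z) (D := 1 + max |a| |b|) (m := 1) continuousOn_id
      differentiableOn_id fun z hz => ?_
    have h3 : |z.im| ≤ max |a| |b| := abs_le_max_abs_abs hz.1 hz.2
    have h4 := Real.add_one_le_exp |z.re|
    have h5 := Real.one_le_exp (abs_nonneg z.re)
    have h6 := norm_le_abs_re_add_abs_im z
    have h7 : 0 ≤ max |a| |b| := (abs_nonneg a).trans (le_max_left _ _)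
    rw [one_mul]
    nlinarith
  have hpow : ∀ k : ℕ, StripDecay a b fun z => z ^ k * exp (-α * z ^ 2 / 2 + β * z) := by
    intro k
    induction k with
    | zero => simpa using hβ
    | succ k ih => simpa [pow_succ', mul_assoc] using hz _ ih
  induction P using Polynomial.induction_on' with
  | add P R hP hR =>
    have := hP.add hR
    convert! this using 2 with z
    simp [gaussPoly, mul_add]
  | monomial k c =>
    have := (hpow k).const_mul c
    convert! this using 2 with z
    simp [gaussPoly]; ring

theorem W_stripDecay (w : W) (a b : ℝ) : StripDecay a b w.1 := by
  obtain ⟨w, hw⟩ := w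
  induction hw using Submodule.span_induction with
  | mem x h =>
    obtain ⟨α, β, P, hα, rfl⟩ := h
    exact gaussPoly_stripDecay hα β P a b
  | zero =>
    exact ⟨continuousOn_const, differentiableOn_const 0, fun n => ⟨0, fun z _ => by simp⟩⟩
  | add x y _ _ hx hy => exact hx.add hy
  | smul c x _ hx => exact hx.const_mul c

/-! ### The `L²` Fourier transform, imaginary translations and multiplications -/

open FourierTransform in
theorem fourier_coe_ae (g : L2R) (hg : Integrable g volume) :
    ((𝓕 g : L2R) : ℝ → ℂ) =ᵐ[volume] 𝓕 (g : ℝ → ℂ) := by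
  have hL : Continuous fun p : ℝ × ℝ => (innerₗ ℝ) p.1 p.2 := by
    change Continuous fun p : ℝ × ℝ => inner ℝ p.1 p.2
    exact Continuous.inner (𝕜 := ℝ) continuous_fst continuous_snd
  have hF : ∀ f : ℝ → ℂ, VectorFourier.fourierIntegral Real.fourierChar volume (innerₗ ℝ) f =
      𝓕 f := by
    intro f
    funext w
    simp [VectorFourier.fourierIntegral, Real.fourier_eq]
  have hF' : ∀ f : ℝ → ℂ, VectorFourier.fourierIntegral Real.fourierChar volume (innerₗ ℝ).flip f =
      𝓕 f := by
    intro f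
    funext w
    simp [VectorFourier.fourierIntegral, Real.fourier_eq]
  have hcont : Continuous (𝓕 (g : ℝ → ℂ)) := by
    rw [← hF]
    exact VectorFourier.fourierIntegral_continuous Real.continuous_fourierChar hL hg
  refine ae_eq_of_integral_contDiff_smul_eq
    ((Lp.memLp (𝓕 g : L2R)).locallyIntegrable (by norm_num)) hcont.locallyIntegrable ?_
  intro φ hφ hφc
  have hc : HasCompactSupport fun x => (φ x : ℂ) := hφc.comp_left ofReal_zero
  let ψ : SchwartzMap ℝ ℂ := hc.toSchwartzMap (ofRealCLM.contDiff.comp hφ)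
  have hψ : ∀ x, ψ x = φ x := fun x => rfl
  have h1 := DFunLike.congr_fun (Lp.fourier_toTemperedDistribution_eq g) ψ
  rw [TemperedDistribution.fourier_apply, Lp.toTemperedDistribution_apply,
    Lp.toTemperedDistribution_apply, SchwartzMap.fourier_coe] at h1
  have h2 := VectorFourier.integral_fourierIntegral_smul_eq_flip (L := innerₗ ℝ)
    (μ := (volume : Measure ℝ)) (ν := (volume : Measure ℝ)) Real.continuous_fourierChar hL
    ψ.integrable hg
  rw [hF, hF'] at h2
  rw [h2] at h1
  simpa [hψ] using h1.symm

theorem fourierInv_toLp_ae {u : ℝ → ℂ} (hu : MemLp u 2 volume) (hi : Integrable u) :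
    (FourierTransform.fourierInv (hu.toLp u : L2R) : L2R) =ᵐ[volume]
      fun ξ => ∫ x : ℝ, exp (I * (2 * Real.pi * ξ : ℝ) * x) * u x := by
  refine (fourierInv_coe_ae _ (hi.congr hu.coeFn_toLp.symm)).trans
    (Filter.Eventually.of_forall fun ξ => ?_)
  simp only
  rw [Real.fourierInv_eq']
  refine integral_congr_ae ?_
  filter_upwards [hu.coeFn_toLp] with x hx
  rw [hx, smul_eq_mul]
  congr 2
  have : (inner ℝ x ξ : ℝ) = ξ * x := rfl
  rw [this]; push_cast; ring

theorem fourier_toLp_ae {u : ℝ → ℂ} (hu : MemLp u 2 volume) (hi : Integrable u) :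
    (FourierTransform.fourier (hu.toLp u : L2R) : L2R) =ᵐ[volume]
      fun ξ => ∫ x : ℝ, exp (I * (-(2 * Real.pi * ξ) : ℝ) * x) * u x := by
  refine (fourier_coe_ae _ (hi.congr hu.coeFn_toLp.symm)).trans
    (Filter.Eventually.of_forall fun ξ => ?_)
  simp only
  rw [Real.fourier_eq']
  refine integral_congr_ae ?_
  filter_upwards [hu.coeFn_toLp] with x hx
  rw [hx, smul_eq_mul]
  congr 2
  have : (inner ℝ x ξ : ℝ) = ξ * x := rfl
  rw [this]; push_cast; ring

theorem inner_toLp (s : L2R) {u : ℝ → ℂ} (hu : MemLp u 2 volume) :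
    inner ℂ s (hu.toLp u : L2R) = ∫ x : ℝ, (starRingEnd ℂ) (s x) * u x := by
  rw [L2.inner_def]
  refine integral_congr_ae ?_
  filter_upwards [hu.coeFn_toLp] with x hx
  rw [hx, RCLike.inner_apply, mul_comm]

theorem inner_toL2 (s : L2R) (w : W) :
    inner ℂ s (toL2 w) = ∫ x : ℝ, (starRingEnd ℂ) (s x) * w.1 x :=
  inner_toLp s (W_memLp w.1 w.2)

theorem inner_fourierInv (s t : L2R) :
    inner ℂ (FourierTransform.fourierInv s : L2R) (FourierTransform.fourierInv t : L2R) =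
      inner ℂ s t :=
  (Lp.fourierTransformₗᵢ ℝ ℂ).symm.inner_map_map s t

theorem memLp_conj (s : L2R) : MemLp (fun x => (starRingEnd ℂ) (s x)) 2 volume :=
  (Lp.memLp s).of_le (continuous_conj.comp_aestronglyMeasurable (Lp.aestronglyMeasurable s))
    (Filter.Eventually.of_forall fun x => by simp)

theorem integrable_conj_mul (s : L2R) {u : ℝ → ℂ} (hu : MemLp u 2 volume) :
    Integrable fun x => (starRingEnd ℂ) (s x) * u x :=
  (memLp_conj s).integrable_mul hu

theorem memLp_conj_mul (s : L2R) {u : ℝ → ℂ} (hu : AEStronglyMeasurable u volume) {C : ℝ}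
    (hC : ∀ x, ‖u x‖ ≤ C) : MemLp (fun x => (starRingEnd ℂ) (s x) * u x) 2 volume :=
  (memLp_conj s).of_le_mul (c := C) ((memLp_conj s).1.mul hu)
    (Filter.Eventually.of_forall fun x => by
      rw [norm_mul, mul_comm]; exact mul_le_mul_of_nonneg_right (hC x) (norm_nonneg _))

theorem W_bounded (w : W) : ∃ C, ∀ x : ℝ, ‖w.1 x‖ ≤ C := by
  obtain ⟨C, hC⟩ := (W_stripDecay w 0 0).decay 0
  exact ⟨C, fun x => by simpa using hC x (by simp)⟩

theorem W_continuous (w : W) : Continuous fun x : ℝ => w.1 x :=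
  (W_differentiable w.1 w.2).continuous.comp continuous_ofReal

theorem W_integrable (w : W) : Integrable fun x : ℝ => w.1 x := by
  simpa using (W_stripDecay w 0 0).integrable_line (y := 0) (by simp)

/-- A function in `L¹ ∩ L²` with vanishing Fourier transform vanishes. -/
theorem ae_eq_zero_of_fourier {h : ℝ → ℂ} (hL : MemLp h 2 volume) (hi : Integrable h)
    (h0 : ∀ η : ℝ, ∫ x : ℝ, exp (I * η * x) * h x = 0) : h =ᵐ[volume] 0 := by
  have h1 : FourierTransform.fourierInv (hL.toLp h : L2R) = (0 : L2R) := by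
    refine Lp.ext ?_
    filter_upwards [fourierInv_toLp_ae hL hi, Lp.coeFn_zero ℂ 2 (volume : Measure ℝ)] with ξ e1 e2
    rw [e1, e2, h0]; rfl
  have h2 : (hL.toLp h : L2R) = 0 := (Lp.fourierTransformₗᵢ ℝ ℂ).symm.map_eq_zero_iff.1 h1
  have h3 := hL.coeFn_toLp
  rw [h2] at h3
  exact h3.symm.trans (Lp.coeFn_zero ℂ 2 (volume : Measure ℝ))

/-- Functions that agree after pairing with `exp(iηx) g(x)`, where `g` is a nowhere vanishing
element of `W`, are equal. -/
theorem ae_eq_of_pair (s t : L2R) (g k : W) (hg : ∀ x : ℝ, g.1 x ≠ 0) (m : ℝ → ℂ)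
    (hk : ∀ x : ℝ, k.1 x = (starRingEnd ℂ) (m x) * g.1 x)
    (h : ∀ η : ℝ, ∫ x : ℝ, (starRingEnd ℂ) (t x) * (exp (I * η * x) * g.1 x) =
      ∫ x : ℝ, (starRingEnd ℂ) (s x) * (exp (I * η * x) * k.1 x)) :
    t =ᵐ[volume] fun x => m x * s x := by
  obtain ⟨C, hC⟩ := W_bounded g
  obtain ⟨D, hD⟩ := W_bounded k
  have hgi := integrable_conj_mul t (W_memLp g.1 g.2)
  have hki := integrable_conj_mul s (W_memLp k.1 k.2)
  have key := ae_eq_zero_of_fourier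
    (h := fun x => (starRingEnd ℂ) (t x) * g.1 x - (starRingEnd ℂ) (s x) * k.1 x)
    ((memLp_conj_mul t (W_continuous g).aestronglyMeasurable hC).sub
      (memLp_conj_mul s (W_continuous k).aestronglyMeasurable hD))
    (hgi.sub hki) fun η => by
      have hb : ∀ {f : ℝ → ℂ}, Integrable f → Integrable fun x : ℝ => exp (I * η * x) * f x := by
        intro f hf
        refine hf.bdd_mul (c := 1) (by fun_prop) (Filter.Eventually.of_forall fun x => ?_)
        rw [norm_exp]; simp
      simp only [mul_sub]
      rw [integral_sub (hb hgi) (hb hki), sub_eq_zero]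
      simpa only [mul_left_comm] using h η
  filter_upwards [key] with x hx
  rw [hk, Pi.zero_apply, sub_eq_zero, ← mul_assoc] at hx
  have := congrArg (starRingEnd ℂ) (mul_right_cancel₀ (hg x) hx)
  simpa [mul_comm] using this

/-- The Gaussian `exp(-αx²/2 + βx)` as an element of `W`. -/
def gaussW (α : ℝ) (hα : 0 < α) (β : ℂ) : W :=
  ⟨gaussPoly α β 1, Submodule.subset_span ⟨α, β, 1, hα, rfl⟩⟩

theorem gaussW_apply (α : ℝ) (hα : 0 < α) (β z : ℂ) :
    (gaussW α hα β).1 z = exp (-α * z ^ 2 / 2 + β * z) := by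
  simp [gaussW, gaussPoly]

/-- The adjoint of multiplication by `l exp(βx)` on `W` is multiplication by its conjugate. It is
enough to test with the Gaussians `exp(-x²/2 + iηx)`. -/
theorem ae_eq_of_expMul {s t : L2R} {l : ℂ} {β : ℝ}
    (h : ∀ w : W, inner ℂ t (toL2 w) = l * inner ℂ s (toL2 (expMulLin β w))) :
    t =ᵐ[volume] fun x => (starRingEnd ℂ) l * Real.exp (β * x) * s x := by
  refine ae_eq_of_pair s t (gaussW 1 one_pos 0) (l • gaussW 1 one_pos β)
    (fun x => by rw [gaussW_apply]; exact exp_ne_zero _) _ (fun x => ?_) fun η => ?_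
  · change l * (gaussW 1 one_pos β).1 x = _
    rw [gaussW_apply, gaussW_apply, map_mul, conj_conj, conj_ofReal, mul_assoc]
    congr 1
    push_cast
    rw [← exp_add]; congr 1; ring
  · have h1 := h (gaussW 1 one_pos (I * η))
    rw [inner_toL2, inner_toL2, ← integral_const_mul] at h1
    refine Eq.trans (integral_congr_ae (Filter.Eventually.of_forall fun x => ?_))
      (h1.trans (integral_congr_ae (Filter.Eventually.of_forall fun x => ?_)))
    · simp only [gaussW_apply]
      rw [← exp_add]; congr 2; ring
    · change l * (_ * (exp (β * x) * (gaussW 1 one_pos (I * η)).1 x)) =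
        _ * (_ * (l * (gaussW 1 one_pos β).1 x))
      rw [gaussW_apply, gaussW_apply, ← exp_add, mul_left_comm _ l, ← exp_add, mul_left_comm l]
      ring_nf

/-- `t` is the imaginary translate `t(x) = s(x + ib)` of `s`. Since `s` is only defined on the real
line, this means that the inverse Fourier transform of `t` is that of `s` times `exp(2πbξ)`. -/
def IsShift (b : ℝ) (s t : L2R) : Prop :=
  (FourierTransform.fourierInv t : L2R) =ᵐ[volume]
    fun ξ => (Real.exp (2 * Real.pi * b * ξ) : ℂ) * (FourierTransform.fourierInv s : L2R) ξ

/-- The contour shift `∫ conj (s(x + ib)) u(x) dx = ∫ conj (s(x)) u(x + ib) dx` for an `L²` translate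
of `s`, where `u'` stands for `u(x + ib)`. The hypothesis on `u` and `u'` is about their Fourier
transforms, and Parseval's formula gives the rest. -/
theorem IsShift.pair {b : ℝ} {s t : L2R} (h : IsShift b s t) {u u' : ℝ → ℂ}
    (hu : MemLp u 2 volume) (hi : Integrable u) (hu' : MemLp u' 2 volume) (hi' : Integrable u')
    (hs : ∀ κ : ℝ, ∫ x : ℝ, exp (I * κ * x) * u' x =
      Real.exp (κ * b) * ∫ x : ℝ, exp (I * κ * x) * u x) :
    ∫ x : ℝ, (starRingEnd ℂ) (t x) * u x = ∫ x : ℝ, (starRingEnd ℂ) (s x) * u' x := by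
  rw [← inner_toLp t hu, ← inner_toLp s hu', ← inner_fourierInv t, ← inner_fourierInv s,
    L2.inner_def, L2.inner_def]
  refine integral_congr_ae ?_
  filter_upwards [fourierInv_toLp_ae hu hi, fourierInv_toLp_ae hu' hi', h] with ξ e1 e2 e3
  rw [e1, e2, e3, hs, RCLike.inner_apply, RCLike.inner_apply, map_mul, conj_ofReal]
  rw [show 2 * Real.pi * b * ξ = 2 * Real.pi * ξ * b by ring]
  ring

theorem StripDecay.fourier_shift_real {f : ℂ → ℂ} {b : ℝ}
    (hf : StripDecay (min 0 b) (max 0 b) f) (κ : ℝ) :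
    ∫ x : ℝ, exp (I * κ * x) * f (x + b * I) =
      Real.exp (κ * b) * ∫ x : ℝ, exp (I * κ * x) * f x := by
  rcases le_total 0 b with hb | hb
  · have := (hf.mono (a' := 0) (b' := b) (by simp) (by simp)).fourier_shift hb κ
    simpa using this
  · have := (hf.mono (a' := b) (b' := 0) (by simp) (by simp)).fourier_shift hb κ
    simp only [ofReal_zero, zero_mul, add_zero] at this
    rw [this, ← mul_assoc, ofReal_exp, ← exp_add]
    simp

theorem W_fourier_shift (w : W) (b κ : ℝ) :
    ∫ x : ℝ, exp (I * κ * x) * (shiftLin (b * I) w).1 x =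
      Real.exp (κ * b) * ∫ x : ℝ, exp (I * κ * x) * w.1 x :=
  (W_stripDecay w _ _).fourier_shift_real κ

theorem IsShift.inner_W {b : ℝ} {s t : L2R} (h : IsShift b s t) (w : W) :
    inner ℂ t (toL2 w) = inner ℂ s (toL2 (shiftLin (b * I) w)) := by
  rw [inner_toL2, inner_toL2]
  exact h.pair (W_memLp _ w.2) (W_integrable w) (W_memLp _ (shiftLin (b * I) w).2)
    (W_integrable _) (W_fourier_shift w b)

/-- The Fourier transform of a Gaussian. -/
theorem integral_gaussW (μ ξ : ℝ) :
    ∫ x : ℝ, exp (I * (2 * Real.pi * ξ : ℝ) * x) * (gaussW 1 one_pos μ).1 x =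
      (2 * Real.pi : ℂ) ^ (1 / 2 : ℂ) * exp (μ ^ 2 / 2) *
        (exp (I * (2 * Real.pi * μ : ℝ) * ξ) *
          (gaussW (4 * Real.pi ^ 2) (by positivity) 0).1 ξ) := by
  have h := integral_cexp_quadratic (b := -(1 / 2)) (by norm_num)
    (I * (2 * Real.pi * ξ : ℝ) + μ) 0
  have e : (Real.pi : ℂ) / - -(1 / 2) = 2 * Real.pi := by ring
  rw [e] at h
  simp only [gaussW_apply]
  rw [mul_assoc ((2 * Real.pi : ℂ) ^ (1 / 2 : ℂ)), ← exp_add, ← exp_add]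
  convert! h using 2
  · funext x
    rw [← exp_add]; congr 1; push_cast; ring
  · congr 1
    push_cast
    linear_combination (-(2 * Real.pi ^ 2 * ξ ^ 2) : ℂ) * I_sq

/-- The adjoint of an imaginary translation of `W` is that translation. It is enough to test with the
Gaussians `exp(-x²/2 + μx)`, whose Fourier transforms are Gaussians times characters. -/
theorem isShift_of_inner {b : ℝ} {s t : L2R}
    (h : ∀ w : W, inner ℂ t (toL2 w) = inner ℂ s (toL2 (shiftLin (b * I) w))) :
    IsShift b s t := by
  have hα : (0 : ℝ) < 4 * Real.pi ^ 2 := by positivity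
  refine ae_eq_of_pair _ _ (gaussW _ hα 0) (gaussW _ hα (2 * Real.pi * b : ℝ))
    (fun x => by rw [gaussW_apply]; exact exp_ne_zero _) _ (fun x => ?_) fun η => ?_
  · rw [gaussW_apply, gaussW_apply, conj_ofReal]
    push_cast
    rw [← exp_add]; congr 1; ring
  · have h1 := h (gaussW 1 one_pos (η / (2 * Real.pi) : ℝ))
    rw [← inner_fourierInv t, ← inner_fourierInv s, L2.inner_def, L2.inner_def] at h1
    set w := gaussW 1 one_pos (η / (2 * Real.pi) : ℝ) with hw
    set k : ℂ := (2 * Real.pi : ℂ) ^ (1 / 2 : ℂ) * exp ((η / (2 * Real.pi) : ℝ) ^ 2 / 2) with hk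
    have hk0 : k ≠ 0 := by
      refine mul_ne_zero ?_ (exp_ne_zero _)
      rw [Ne, cpow_eq_zero_iff]
      have : (2 * Real.pi : ℂ) ≠ 0 := by exact_mod_cast (by positivity : 2 * Real.pi ≠ 0)
      tauto
    have hη : 2 * Real.pi * (η / (2 * Real.pi)) = η := by field_simp
    have e1 := fourierInv_toLp_ae (W_memLp w.1 w.2) (W_integrable w)
    have e2 := fourierInv_toLp_ae (W_memLp _ (shiftLin (b * I) w).2)
      (W_integrable (shiftLin (b * I) w))
    have a1 : ∫ x : ℝ, inner ℂ ((FourierTransform.fourierInv t : L2R) x)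
        ((FourierTransform.fourierInv (toL2 w) : L2R) x) =
        k * ∫ x : ℝ, (starRingEnd ℂ) ((FourierTransform.fourierInv t : L2R) x) *
          (exp (I * η * x) * (gaussW _ hα 0).1 x) := by
      rw [← integral_const_mul]
      refine integral_congr_ae ?_
      filter_upwards [e1] with ξ e1
      refine (congrArg (inner ℂ _) e1).trans ?_
      rw [hw, integral_gaussW, RCLike.inner_apply, hη, ← hk]; ring
    have a2 : ∫ x : ℝ, inner ℂ ((FourierTransform.fourierInv s : L2R) x)
        ((FourierTransform.fourierInv (toL2 (shiftLin (b * I) w)) : L2R) x) =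
        k * ∫ x : ℝ, (starRingEnd ℂ) ((FourierTransform.fourierInv s : L2R) x) *
          (exp (I * η * x) * (gaussW _ hα (2 * Real.pi * b : ℝ)).1 x) := by
      rw [← integral_const_mul]
      refine integral_congr_ae ?_
      filter_upwards [e2] with ξ e2
      refine (congrArg (inner ℂ _) e2).trans ?_
      rw [W_fourier_shift, hw, integral_gaussW, RCLike.inner_apply, hη, ← hk]
      have : (gaussW _ hα (2 * Real.pi * b : ℝ)).1 ξ =
          Real.exp (2 * Real.pi * ξ * b) * (gaussW _ hα 0).1 ξ := by
        rw [gaussW_apply, gaussW_apply]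
        push_cast
        rw [← exp_add]; congr 1; ring
      rw [this]; ring
    rw [a1, a2] at h1
    exact mul_left_cancel₀ hk0 h1

/-! ### Fourier-Laplace integrals along a horizontal line -/

/-- `∫ exp(-ipz) k(p) dp` along the line `p = t + iη`; the kernel is given as a function of `t`. -/
def lineIntegral (η : ℝ) (k : ℝ → ℂ) (z : ℂ) : ℂ :=
  ∫ t : ℝ, exp (-(I * (t + η * I) * z)) * k t

theorem norm_exp_line (t η : ℝ) (z : ℂ) :
    ‖exp (-(I * (t + η * I) * z))‖ = Real.exp (t * z.im + η * z.re) := by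
  rw [norm_exp]
  congr 1
  simp

section lineIntegral

variable {k : ℝ → ℂ} {A κ η : ℝ}

theorem norm_line_le (hb : ∀ t, ‖k t‖ ≤ A * Real.exp (-(κ * |t|))) {ρ : ℝ} {z : ℂ}
    (hz : |z.im| ≤ ρ) (t : ℝ) : ‖exp (-(I * (t + η * I) * z)) * k t‖ ≤
      A * Real.exp (η * z.re) * Real.exp (-((κ - ρ) * |t|)) := by
  rw [norm_mul, norm_exp_line]
  have h1 : t * z.im ≤ ρ * |t| := by
    have : t * z.im ≤ |t| * |z.im| := by rw [← abs_mul]; exact le_abs_self _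
    nlinarith [abs_nonneg t]
  have hA : 0 ≤ A := by
    have := (norm_nonneg _).trans (hb 0)
    exact nonneg_of_mul_nonneg_left this (Real.exp_pos _)
  calc _ ≤ Real.exp (ρ * |t| + η * z.re) * (A * Real.exp (-(κ * |t|))) :=
        mul_le_mul (Real.exp_le_exp.2 (by linarith)) (hb t) (norm_nonneg _) (Real.exp_pos _).le
    _ = _ := by
        rw [mul_left_comm, mul_assoc, ← Real.exp_add, ← Real.exp_add]
        congr 2; ring

theorem integrable_line (hk : Continuous k) (hb : ∀ t, ‖k t‖ ≤ A * Real.exp (-(κ * |t|))) {z : ℂ}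
    (hz : |z.im| < κ) : Integrable fun t : ℝ => exp (-(I * (t + η * I) * z)) * k t :=
  ((integrable_exp_neg_mul_abs (sub_pos.2 hz)).const_mul _).mono'
    (by fun_prop) (Filter.Eventually.of_forall (norm_line_le hb le_rfl))

theorem norm_lineIntegral_le (hb : ∀ t, ‖k t‖ ≤ A * Real.exp (-(κ * |t|))) {ρ : ℝ} (hρ : ρ < κ)
    {z : ℂ} (hz : |z.im| ≤ ρ) : ‖lineIntegral η k z‖ ≤
      (A * ∫ t : ℝ, Real.exp (-((κ - ρ) * |t|))) * Real.exp (η * z.re) := by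
  refine (norm_integral_le_of_norm_le ((integrable_exp_neg_mul_abs (sub_pos.2 hρ)).const_mul _)
    (Filter.Eventually.of_forall (norm_line_le hb hz))).trans_eq ?_
  rw [integral_const_mul]; ring

theorem hasDerivAt_lineIntegral (hk : Continuous k)
    (hb : ∀ t, ‖k t‖ ≤ A * Real.exp (-(κ * |t|))) {z : ℂ} (hz : |z.im| < κ) :
    HasDerivAt (lineIntegral η k)
      (∫ t : ℝ, -(I * (t + η * I)) * (exp (-(I * (t + η * I) * z)) * k t)) z := by
  -- The factor `p` of the derivative costs half of the exponential decay that is left at height `ρ`.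
  obtain ⟨ρ, hρ, hρκ⟩ := exists_between hz
  set δ := κ - ρ with hδ
  have hδ0 : 0 < δ := sub_pos.2 hρκ
  have hs : {w : ℂ | |w.im| < ρ ∧ |w.re| < |z.re| + 1} ∈ nhds z := by
    refine IsOpen.mem_nhds ?_ ⟨hρ, by linarith⟩
    exact (isOpen_lt continuous_im.abs continuous_const).inter
      (isOpen_lt continuous_re.abs continuous_const)
  have hA : 0 ≤ A := by
    have := (norm_nonneg _).trans (hb 0)
    exact nonneg_of_mul_nonneg_left this (Real.exp_pos _)
  refine (hasDerivAt_integral_of_dominated_loc_of_deriv_le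
    (bound := fun t => (2 / δ + |η|) * (A * Real.exp (|η| * (|z.re| + 1))) *
      Real.exp (-(δ / 2 * |t|)))
    (F := fun w t => exp (-(I * (t + η * I) * w)) * k t)
    (F' := fun w t => -(I * (t + η * I)) * (exp (-(I * (t + η * I) * w)) * k t)) hs
    (Filter.Eventually.of_forall fun w => by fun_prop) (integrable_line hk hb hz) (by fun_prop)
    (Filter.Eventually.of_forall fun t w hw => ?_)
    ((integrable_exp_neg_mul_abs (half_pos hδ0)).const_mul _)
    (Filter.Eventually.of_forall fun t w _ => ?_)).2
  · have h1 : ‖-(I * (t + η * I))‖ ≤ (2 / δ + |η|) * Real.exp (δ / 2 * |t|) := by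
      rw [norm_neg, norm_mul, norm_I, one_mul]
      refine (norm_add_le _ _).trans ?_
      rw [norm_mul, norm_I, mul_one, norm_real, norm_real, Real.norm_eq_abs, Real.norm_eq_abs]
      have h2 := Real.add_one_le_exp (δ / 2 * |t|)
      have h3 := Real.one_le_exp (by positivity : 0 ≤ δ / 2 * |t|)
      have h4 : |t| = 2 / δ * (δ / 2 * |t|) := by field_simp
      have h5 : |t| ≤ 2 / δ * Real.exp (δ / 2 * |t|) := by
        rw [h4]
        have : δ / 2 * (2 / δ * (δ / 2 * |t|)) = δ / 2 * |t| := by field_simp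
        rw [this]
        exact mul_le_mul_of_nonneg_left (by linarith) (by positivity)
      have h6 : |η| ≤ |η| * Real.exp (δ / 2 * |t|) := le_mul_of_one_le_right (abs_nonneg _) h3
      linarith
    have h2 := norm_line_le (η := η) hb hw.1.le t
    have h3 : Real.exp (η * w.re) ≤ Real.exp (|η| * (|z.re| + 1)) := by
      refine Real.exp_le_exp.2 ?_
      have : η * w.re ≤ |η| * |w.re| := by rw [← abs_mul]; exact le_abs_self _
      exact this.trans (mul_le_mul_of_nonneg_left hw.2.le (abs_nonneg _))
    rw [norm_mul]
    refine (mul_le_mul h1 h2 (norm_nonneg _) (by positivity)).trans ?_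
    calc _ ≤ (2 / δ + |η|) * Real.exp (δ / 2 * |t|) *
          (A * Real.exp (|η| * (|z.re| + 1)) * Real.exp (-(δ * |t|))) := by
          gcongr
      _ = (2 / δ + |η|) * (A * Real.exp (|η| * (|z.re| + 1))) *
          (Real.exp (δ / 2 * |t|) * Real.exp (-(δ * |t|))) := by ring
      _ = _ := by
          rw [← Real.exp_add]; congr 2; ring
  · have h1 : HasDerivAt (fun w : ℂ => -(I * (t + η * I) * w)) (-(I * (t + η * I))) w := by
      simpa using ((hasDerivAt_id w).const_mul (I * (t + η * I))).fun_neg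
    have := h1.cexp.mul_const (k t)
    convert! this using 1; ring

end lineIntegral

theorem exp_abs_le_cosh (x : ℝ) : Real.exp |x| ≤ 2 * Real.cosh x := by
  rw [← Real.cosh_abs, Real.cosh_eq]
  linarith [Real.exp_pos (-|x|)]

theorem sin_mul_exp_le_norm_sinh {c t η : ℝ} (hs : 0 ≤ Real.sin (Real.pi * c * η)) :
    Real.sin (Real.pi * c * η) / 2 * Real.exp (Real.pi * c * |t|) ≤
      ‖sinh (Real.pi * c * (t + η * I))‖ := by
  have h1 := abs_im_le_norm (sinh (Real.pi * c * (t + η * I)))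
  have h2 : (Real.pi * c * (t + η * I) : ℂ) = (Real.pi * c * t : ℝ) + (Real.pi * c * η : ℝ) * I := by
    push_cast; ring
  rw [h2, sinh_add, sinh_mul_I, cosh_mul_I, ← ofReal_sinh, ← ofReal_cosh, ← ofReal_sin,
    ← ofReal_cos] at h1 ⊢
  simp only [add_im, mul_im, ofReal_re, ofReal_im, mul_zero, zero_mul, add_zero, I_re, I_im, mul_one,
    zero_add, mul_re, sub_zero] at h1
  refine le_trans ?_ ((le_abs_self _).trans h1)
  have h3 := exp_abs_le_cosh (Real.pi * c * t)
  have h4 : Real.pi * c * |t| ≤ |Real.pi * c * t| := by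
    rw [abs_mul]
    exact mul_le_mul_of_nonneg_right (le_abs_self _) (abs_nonneg _)
  have h5 := Real.exp_le_exp.2 h4
  nlinarith

theorem sin_pos_of_height {c η : ℝ} (hc : 0 < c) (h0 : 0 < η) (h1 : η * c < 1) :
    0 < Real.sin (Real.pi * c * η) :=
  Real.sin_pos_of_pos_of_lt_pi (by positivity) (by nlinarith [Real.pi_pos])

theorem sinh_line_ne_zero {c η : ℝ} (hc : 0 < c) (h0 : 0 < η) (h1 : η * c < 1) (t : ℝ) :
    sinh (Real.pi * c * (t + η * I)) ≠ 0 := by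
  have hs := sin_pos_of_height hc h0 h1
  exact norm_pos_iff.1 (lt_of_lt_of_le (by positivity) (sin_mul_exp_le_norm_sinh (t := t) hs.le))

theorem norm_sinh_inv_le {c η : ℝ} (hc : 0 < c) (h0 : 0 < η) (h1 : η * c < 1) (t : ℝ) :
    ‖(sinh (Real.pi * c * (t + η * I)))⁻¹‖ ≤
      2 / Real.sin (Real.pi * c * η) * Real.exp (-(Real.pi * c * |t|)) := by
  have hs := sin_pos_of_height hc h0 h1
  rw [norm_inv]
  refine (inv_anti₀ (by positivity) (sin_mul_exp_le_norm_sinh (t := t) hs.le)).trans_eq ?_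
  rw [Real.exp_neg]; field_simp

theorem line_ne_zero {η : ℝ} (h0 : 0 < η) (t : ℝ) : (t + η * I : ℂ) ≠ 0 := by
  intro h
  have := congrArg im h
  simp at this
  exact h0.ne' this

theorem norm_line_inv_le {η : ℝ} (h0 : 0 < η) (t : ℝ) : ‖(t + η * I : ℂ)⁻¹‖ ≤ η⁻¹ := by
  rw [norm_inv]
  refine inv_anti₀ h0 ?_
  have := abs_im_le_norm (t + η * I : ℂ)
  simp only [add_im, ofReal_im, mul_im, ofReal_re, I_im, mul_one, I_re, mul_zero, add_zero,
    zero_add] at this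
  exact (le_abs_self _).trans this

/-- `1 / sh(πdp)` on the line `p = t + iη`. -/
def sinhKernel (d η t : ℝ) : ℂ := (sinh (Real.pi * d * (t + η * I)))⁻¹

theorem continuous_sinhKernel {d η : ℝ} (hd : 0 < d) (h0 : 0 < η) (h1 : η * d < 1) :
    Continuous (sinhKernel d η) :=
  Continuous.inv₀ (by fun_prop) (sinh_line_ne_zero hd h0 h1)

/-- A primitive is `arctan (sh(πdt)) / (πd)`. -/
theorem integral_inv_cosh {d : ℝ} (hd : 0 < d) : ∫ t : ℝ, (Real.cosh (Real.pi * d * t))⁻¹ = 1 / d := by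
  have hpd : 0 < Real.pi * d := by positivity
  have hderiv : ∀ t : ℝ, HasDerivAt (fun t => Real.arctan (Real.sinh (Real.pi * d * t)) / (Real.pi * d))
      ((Real.cosh (Real.pi * d * t))⁻¹) t := by
    intro t
    have h1 : HasDerivAt (fun t : ℝ => Real.pi * d * t) (Real.pi * d) t := by
      simpa using (hasDerivAt_id t).const_mul (Real.pi * d)
    have h2 := (h1.sinh.arctan).div_const (Real.pi * d)
    convert! h2 using 1
    have h3 : 1 + Real.sinh (Real.pi * d * t) ^ 2 = Real.cosh (Real.pi * d * t) ^ 2 := by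
      rw [Real.cosh_sq]; ring
    rw [h3]
    have := (Real.cosh_pos (Real.pi * d * t)).ne'
    field_simp
  have hint : Integrable fun t : ℝ => (Real.cosh (Real.pi * d * t))⁻¹ := by
    refine ((integrable_exp_neg_mul_abs hpd).const_mul 2).mono' ?_
      (Filter.Eventually.of_forall fun t => ?_)
    · exact (Continuous.inv₀ (by fun_prop) fun t => (Real.cosh_pos _).ne').aestronglyMeasurable
    · rw [norm_inv, Real.norm_eq_abs, abs_of_pos (Real.cosh_pos _), Real.exp_neg]
      have := exp_abs_le_cosh (Real.pi * d * t)
      rw [abs_mul, abs_of_pos hpd] at this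
      rw [← div_eq_mul_inv, inv_eq_one_div, div_le_div_iff₀ (Real.cosh_pos _) (Real.exp_pos _)]
      linarith
  have hT : Filter.Tendsto (fun t : ℝ => Real.pi * d * t) Filter.atTop Filter.atTop :=
    Filter.tendsto_id.const_mul_atTop hpd
  have hB : Filter.Tendsto (fun t : ℝ => Real.pi * d * t) Filter.atBot Filter.atBot :=
    Filter.tendsto_id.const_mul_atBot hpd
  have hsT : Filter.Tendsto Real.sinh Filter.atTop Filter.atTop := by
    refine Filter.tendsto_atTop_mono' _ ?_ Filter.tendsto_id
    filter_upwards [Filter.eventually_ge_atTop 0] with x hx using Real.self_le_sinh_iff.2 hx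
  have hsB : Filter.Tendsto Real.sinh Filter.atBot Filter.atBot := by
    refine Filter.tendsto_atBot_mono' _ ?_ Filter.tendsto_id
    filter_upwards [Filter.eventually_le_atBot 0] with x hx using Real.sinh_le_self_iff.2 hx
  have e := integral_of_hasDerivAt_of_tendsto hderiv hint
    (((Real.tendsto_arctan_atBot.mono_right nhdsWithin_le_nhds).comp (hsB.comp hB)).div_const _)
    (((Real.tendsto_arctan_atTop.mono_right nhdsWithin_le_nhds).comp (hsT.comp hT)).div_const _)
  rw [e]
  field_simp
  ring

/-! ### The Fourier transform of `1 / sh` and the difference equation -/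

/-- The contour is moved to the height `1/(2d)`, where `sh(πdp)` becomes `i ch(πdt)`. -/
theorem integral_sinhKernel {d η : ℝ} (hd : 0 < d) (h0 : 0 < η) (h1 : η * d < 1) :
    ∫ t : ℝ, sinhKernel d η t = -I / d := by
  have h2 : (0 : ℝ) < 1 / (2 * d) := by positivity
  have h3 : 1 / (2 * d) * d < 1 := by field_simp; norm_num
  have hmin : 0 < min η (1 / (2 * d)) := lt_min h0 h2
  have hmax : max η (1 / (2 * d)) * d < 1 := by
    rcases max_choice η (1 / (2 * d)) with h | h <;> rw [h] <;> assumption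
  have hstrip : ∀ y ∈ Set.Icc (min η (1 / (2 * d))) (max η (1 / (2 * d))), 0 < y ∧ y * d < 1 :=
    fun y hy => ⟨hmin.trans_le hy.1, (mul_le_mul_of_nonneg_right hy.2 hd.le).trans_lt hmax⟩
  have hne : ∀ z : ℂ, z.im ∈ Set.Icc (min η (1 / (2 * d))) (max η (1 / (2 * d))) →
      sinh (Real.pi * d * z) ≠ 0 := fun z hz => by
    have := sinh_line_ne_zero hd (hstrip _ hz).1 (hstrip _ hz).2 z.re
    rwa [re_add_im] at this
  -- By concavity, the sine is bounded below between the two heights by its values at them.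
  set σ := min (Real.sin (Real.pi * d * η)) (Real.sin (Real.pi * d * (1 / (2 * d)))) with hσ
  have hσ0 : 0 < σ := lt_min (sin_pos_of_height hd h0 h1) (sin_pos_of_height hd h2 h3)
  have hmem : ∀ y : ℝ, 0 < y → y * d < 1 → Real.pi * d * y ∈ Set.Icc 0 Real.pi := fun y hy hy' =>
    ⟨by positivity, by nlinarith [Real.pi_pos]⟩
  have hσle : ∀ y ∈ Set.Icc (min η (1 / (2 * d))) (max η (1 / (2 * d))),
      σ ≤ Real.sin (Real.pi * d * y) := by
    intro y hy
    have hpd : 0 < Real.pi * d := by positivity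
    rcases le_total η (1 / (2 * d)) with h | h
    · rw [min_eq_left h, max_eq_right h] at hy
      exact strictConcaveOn_sin_Icc.concaveOn.min_le_of_mem_Icc (hmem _ h0 h1) (hmem _ h2 h3)
        ⟨mul_le_mul_of_nonneg_left hy.1 hpd.le, mul_le_mul_of_nonneg_left hy.2 hpd.le⟩
    · rw [min_eq_right h, max_eq_left h] at hy
      rw [hσ, min_comm]
      exact strictConcaveOn_sin_Icc.concaveOn.min_le_of_mem_Icc (hmem _ h2 h3) (hmem _ h0 h1)
        ⟨mul_le_mul_of_nonneg_left hy.1 hpd.le, mul_le_mul_of_nonneg_left hy.2 hpd.le⟩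
  have key := integral_line_eq (f := fun z => (sinh (Real.pi * d * z))⁻¹)
    (a := min η (1 / (2 * d))) (b := max η (1 / (2 * d))) min_le_max Set.countable_empty
    (ContinuousOn.inv₀ (by fun_prop) hne)
    (fun z hz _ => DifferentiableAt.inv (by fun_prop) (hne z (Set.Ioo_subset_Icc_self hz)))
    (C := 2 / σ) (ε := Real.pi * d) (by positivity) (fun z hz => by
      have h := norm_sinh_inv_le hd (hstrip _ hz).1 (hstrip _ hz).2 z.re
      rw [re_add_im] at h
      refine h.trans ?_
      gcongr
      exact hσle _ hz)
  have key' : ∫ t : ℝ, sinhKernel d η t =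
      ∫ t : ℝ, (sinh (Real.pi * d * (t + (1 / (2 * d) : ℝ) * I)))⁻¹ := by
    rcases le_total η (1 / (2 * d)) with h | h
    · rw [min_eq_left h, max_eq_right h] at key
      exact key
    · rw [min_eq_right h, max_eq_left h] at key
      exact key.symm
  have hd' : (d : ℂ) ≠ 0 := by exact_mod_cast hd.ne'
  have e : ∀ t : ℝ, (sinh (Real.pi * d * (t + (1 / (2 * d) : ℝ) * I)))⁻¹ =
      -I * ((Real.cosh (Real.pi * d * t))⁻¹ : ℝ) := by
    intro t
    have : (Real.pi * d * (t + (1 / (2 * d) : ℝ) * I) : ℂ) =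
        (Real.pi * d * t : ℝ) + (Real.pi / 2 : ℂ) * I := by
      push_cast; field_simp
    rw [this, sinh_add, sinh_mul_I, cosh_mul_I, cos_pi_div_two, sin_pi_div_two, mul_zero, zero_add,
      one_mul, mul_inv, inv_I, ← ofReal_cosh]
    push_cast; ring
  simp only [e] at key'
  have e' : ∫ t : ℝ, (((Real.cosh (Real.pi * d * t))⁻¹ : ℝ) : ℂ) = ((1 / d : ℝ) : ℂ) := by
    rw [← integral_inv_cosh hd]; exact integral_ofReal
  rw [key', integral_const_mul, e']
  push_cast; ring

theorem abs_sinh_le_norm_sinh (z : ℂ) : |Real.sinh z.re| ≤ ‖sinh z‖ := by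
  have h := abs_norm_sub_norm_le (exp z) (exp (-z))
  rw [norm_exp, norm_exp, neg_re] at h
  rw [Complex.sinh, Real.sinh_eq, norm_div, abs_div]
  simpa using div_le_div_of_nonneg_right h (by norm_num : (0 : ℝ) ≤ 2)

theorem sinh_eq_zero_of_abs_im_lt {z : ℂ} (h : sinh z = 0) (hz : |z.im| < Real.pi) : z = 0 := by
  have h1 : z.re = 0 := by
    have := abs_sinh_le_norm_sinh z
    rw [h, norm_zero] at this
    exact Real.sinh_eq_zero.1 (abs_eq_zero.1 (le_antisymm this (abs_nonneg _)))
  have h2 : z = z.im * I := by apply Complex.ext <;> simp [h1]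
  rw [h2, sinh_mul_I, mul_eq_zero, or_iff_left I_ne_zero, ← ofReal_sin, ofReal_eq_zero] at h
  have h3 := (Real.sin_eq_zero_iff_of_lt_of_lt (abs_lt.1 hz).1 (abs_lt.1 hz).2).1 h
  rw [h2, h3]; simp

/-- The transform `J(x) = ∫ exp(-ipx) / sh(πdp) dp` satisfies `J(x) (1 + exp(-x/d)) = 2 J(0)`. The
relation comes from moving the contour by `i/d` in the integral of `(exp(-ipx) - 1) / sh(πdp)`, whose
singularity at the origin is removable. -/
theorem lineIntegral_sinhKernel_mul {d η : ℝ} (hd : 0 < d) (h0 : 0 < η) (h1 : η * d < 1) (x : ℝ) :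
    lineIntegral η (sinhKernel d η) x * (1 + Real.exp (-(x / d))) =
      2 * ∫ t : ℝ, sinhKernel d η t := by
  have hpd : 0 < Real.pi * d := by positivity
  have hηd : η < 1 / d := by rwa [lt_div_iff₀ hd]
  have hd' : (d : ℂ) ≠ 0 := by exact_mod_cast hd.ne'
  have hpi' : (Real.pi : ℂ) ≠ 0 := by exact_mod_cast Real.pi_ne_zero
  have him : ∀ z : ℂ, z.im ∈ Set.Icc (η - 1 / d) η → |z.im| ≤ 1 / d := fun z hz =>
    abs_le.2 ⟨by linarith [hz.1], by linarith [hz.2]⟩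
  have hzero : ∀ z : ℂ, z.im ∈ Set.Icc (η - 1 / d) η → sinh (Real.pi * d * z) = 0 → z = 0 := by
    intro z hz h
    have e : (Real.pi * d * z : ℂ).im = Real.pi * d * z.im := by
      rw [← ofReal_mul, im_ofReal_mul]
    have h2 : |z.im| < 1 / d := abs_lt.2 ⟨by linarith [hz.1], by linarith [hz.2]⟩
    have h3 := sinh_eq_zero_of_abs_im_lt h (by
      rw [e, abs_mul, abs_of_pos hpd]
      calc Real.pi * d * |z.im| < Real.pi * d * (1 / d) := mul_lt_mul_of_pos_left h2 hpd
        _ = Real.pi := by field_simp)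
    simpa [hd', hpi'] using h3
  set g : ℂ → ℂ := fun p => (exp (-(I * p * x)) - 1) / sinh (Real.pi * d * p) with hg
  -- The removable singularity is filled in by the value of the limit.
  set f : ℂ → ℂ := Function.update g 0 (-(I * x) / (Real.pi * d)) with hf
  have hfg : ∀ p : ℂ, p ≠ 0 → f p = g p := fun p hp => Function.update_of_ne hp _ _
  have hev : ∀ p : ℂ, p ≠ 0 → f =ᶠ[nhds p] g := fun p hp => by
    filter_upwards [isOpen_ne.mem_nhds hp] with w hw using hfg w hw
  have hgd : ∀ z : ℂ, z.im ∈ Set.Icc (η - 1 / d) η → z ≠ 0 → DifferentiableAt ℂ g z :=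
    fun z hz hz0 => DifferentiableAt.div (by fun_prop) (by fun_prop) fun h => hz0 (hzero z hz h)
  have hc0 : ContinuousAt f 0 := by
    rw [hf, continuousAt_update_same]
    have a1 : HasDerivAt (fun p : ℂ => exp (-(I * p * x))) (-(I * x)) 0 := by
      have : HasDerivAt (fun p : ℂ => -(I * p * x)) (-(I * x)) 0 := by
        simpa using (((hasDerivAt_id (0 : ℂ)).const_mul I).mul_const (x : ℂ)).fun_neg
      simpa using this.cexp
    have a2 : HasDerivAt (fun p : ℂ => sinh (Real.pi * d * p)) (Real.pi * d) 0 := by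
      have : HasDerivAt (fun p : ℂ => (Real.pi * d * p : ℂ)) (Real.pi * d) 0 := by
        simpa using (hasDerivAt_id (0 : ℂ)).const_mul (Real.pi * d : ℂ)
      simpa using this.csinh
    have b := (hasDerivAt_iff_tendsto_slope.1 a1).div (hasDerivAt_iff_tendsto_slope.1 a2)
      (mul_ne_zero hpi' hd')
    refine b.congr' ?_
    filter_upwards [self_mem_nhdsWithin] with p hp
    have hp' : p ≠ 0 := hp
    simp only [Pi.div_apply, slope_def_field, hg, mul_zero, zero_mul, neg_zero, exp_zero, sinh_zero,
      sub_zero]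
    rw [div_div_div_cancel_right₀ hp']
  have hc : ContinuousOn f (im ⁻¹' Set.Icc (η - 1 / d) η) := by
    intro z hz
    by_cases hz0 : z = 0
    · rw [hz0]; exact hc0.continuousWithinAt
    · exact ((hgd z hz hz0).continuousAt.congr (hev z hz0).symm).continuousWithinAt
  have hcomp : IsCompact (Set.Icc (-1 : ℝ) 1 ×ℂ Set.Icc (η - 1 / d) η) :=
    isCompact_Icc.reProdIm isCompact_Icc
  obtain ⟨M, hM⟩ := hcomp.exists_bound_of_continuousOn (hc.mono fun z hz => (mem_reProdIm.1 hz).2)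
  -- `|sh u| ≥ k exp |u|` as soon as `|u| ≥ πd`; near the origin `f` is bounded by compactness.
  set k : ℝ := (1 - Real.exp (-(2 * (Real.pi * d)))) / 2 with hk
  have hk0 : 0 < k := by
    have : Real.exp (-(2 * (Real.pi * d))) < 1 := Real.exp_lt_one_iff.2 (by linarith)
    rw [hk]; linarith
  have hM0 : 0 ≤ M := (norm_nonneg _).trans (hM (η * I) (by
    rw [mem_reProdIm]; simp [hd.le]))
  have hb : ∀ z : ℂ, z.im ∈ Set.Icc (η - 1 / d) η → ‖f z‖ ≤
      (M * Real.exp (Real.pi * d) + (Real.exp (|x| / d) + 1) / k) *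
        Real.exp (-(Real.pi * d * |z.re|)) := by
    intro z hz
    rw [add_mul]
    rcases le_total |z.re| 1 with h | h
    · refine (hM z (mem_reProdIm.2 ⟨abs_le.1 h, hz⟩)).trans ?_
      have h2 : 1 ≤ Real.exp (Real.pi * d) * Real.exp (-(Real.pi * d * |z.re|)) := by
        rw [← Real.exp_add]
        exact Real.one_le_exp (by nlinarith)
      have h3 := mul_le_mul_of_nonneg_left h2 hM0
      have h4 : 0 ≤ (Real.exp (|x| / d) + 1) / k * Real.exp (-(Real.pi * d * |z.re|)) := by
        positivity
      linarith
    · have hz0 : z ≠ 0 := fun h' => by rw [h'] at h; norm_num at h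
      rw [hfg z hz0, hg]
      simp only
      rw [norm_div]
      have h2 : ‖exp (-(I * z * x)) - 1‖ ≤ Real.exp (|x| / d) + 1 := by
        refine (norm_sub_le _ _).trans ?_
        rw [norm_one, norm_exp]
        gcongr
        have : (-(I * z * x)).re = z.im * x := by simp
        rw [this]
        have h3 : z.im * x ≤ |z.im| * |x| := by rw [← abs_mul]; exact le_abs_self _
        refine h3.trans ((mul_le_mul_of_nonneg_right (him z hz) (abs_nonneg x)).trans_eq ?_)
        ring
      have h3 : k * Real.exp (Real.pi * d * |z.re|) ≤ ‖sinh (Real.pi * d * z)‖ := by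
        refine le_trans ?_ (abs_sinh_le_norm_sinh _)
        have e : (Real.pi * d * z : ℂ).re = Real.pi * d * z.re := by
          rw [← ofReal_mul, re_ofReal_mul]
        rw [e, Real.abs_sinh, abs_mul, abs_of_pos hpd, Real.sinh_eq, hk]
        have h4 : Real.exp (-(Real.pi * d * |z.re|)) ≤
            Real.exp (-(2 * (Real.pi * d))) * Real.exp (Real.pi * d * |z.re|) := by
          rw [← Real.exp_add]
          exact Real.exp_le_exp.2 (by nlinarith)
        nlinarith
      have h4 : 0 ≤ M * Real.exp (Real.pi * d) * Real.exp (-(Real.pi * d * |z.re|)) := by positivity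
      have h5 : ‖exp (-(I * z * x)) - 1‖ / ‖sinh (Real.pi * d * z)‖ ≤
          (Real.exp (|x| / d) + 1) / k * Real.exp (-(Real.pi * d * |z.re|)) := by
        refine (div_le_div₀ (by positivity) h2 (by positivity) h3).trans_eq ?_
        rw [Real.exp_neg]; field_simp
      linarith
  have key := integral_line_eq (f := f) (a := η - 1 / d) (b := η) (by
      have : (0 : ℝ) < 1 / d := by positivity
      linarith) (Set.countable_singleton (0 : ℂ)) hc (fun z hz hz0 =>
      ((hgd z (Set.Ioo_subset_Icc_self hz) hz0).congr_of_eventuallyEq (hev z hz0))) hpd hb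
  have hkb : ∀ t : ℝ, ‖sinhKernel d η t‖ ≤
      2 / Real.sin (Real.pi * d * η) * Real.exp (-(Real.pi * d * |t|)) := norm_sinh_inv_le hd h0 h1
  have hkc := continuous_sinhKernel hd h0 h1
  have i1 : Integrable fun t : ℝ => exp (-(I * (t + η * I) * x)) * sinhKernel d η t :=
    integrable_line hkc hkb (by simpa using hpd)
  have i2 : Integrable (sinhKernel d η) := by
    have := integrable_line (η := η) (z := 0) hkc hkb (by simpa using hpd)
    simpa using this
  have e1 : ∫ t : ℝ, f (t + η * I) =
      lineIntegral η (sinhKernel d η) x - ∫ t : ℝ, sinhKernel d η t := by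
    rw [lineIntegral, ← integral_sub i1 i2]
    congr 1
    funext t
    rw [hfg _ (line_ne_zero h0 t)]
    simp only [hg, sinhKernel]
    ring
  have e2 : ∫ t : ℝ, f (t + (η - 1 / d : ℝ) * I) =
      -(Real.exp (-(x / d)) * lineIntegral η (sinhKernel d η) x - ∫ t : ℝ, sinhKernel d η t) := by
    rw [lineIntegral, ← integral_const_mul, ← integral_sub (i1.const_mul _) i2, ← integral_neg]
    congr 1
    funext t
    have hne : (t + (η - 1 / d : ℝ) * I : ℂ) ≠ 0 := by
      intro h
      have := congrArg im h
      simp at this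
      rw [one_div] at hηd
      linarith
    rw [hfg _ hne]
    simp only [hg, sinhKernel]
    have a1 : (Real.pi * d * (t + (η - 1 / d : ℝ) * I) : ℂ) =
        Real.pi * d * (t + η * I) - Real.pi * I := by
      push_cast; field_simp; ring
    have a2 : -(I * (t + (η - 1 / d : ℝ) * I) * x : ℂ) =
        (-(x / d) : ℝ) + -(I * (t + η * I) * x) := by
      push_cast
      linear_combination (x / d : ℂ) * I_sq
    have a3 : sinh (Real.pi * d * (t + η * I) - Real.pi * I) = -sinh (Real.pi * d * (t + η * I)) := by
      rw [sinh_sub, sinh_mul_I, cosh_mul_I, cos_pi, sin_pi]; ring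
    rw [a1, a2, a3, exp_add, ← ofReal_exp]
    ring
  rw [e1, e2] at key
  linear_combination -key

/-- `exp(-1/2 ∫ exp(-ipx) / (p sh(πdp)) dp) = 1 + exp(x/d)`: the derivative of the integral is a
multiple of the transform of `1 / sh`, so that the quotient of both sides is constant, and both sides
tend to `1` as `x → -∞`. -/
theorem exp_lineIntegral_eq {d η : ℝ} (hd : 0 < d) (h0 : 0 < η) (h1 : η * d < 1) (x : ℝ) :
    exp (-(1 / 2) * lineIntegral η (fun t => sinhKernel d η t * (t + η * I)⁻¹) x) =
      1 + Real.exp (x / d) := by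
  set k : ℝ → ℂ := fun t => sinhKernel d η t * (t + η * I)⁻¹ with hk
  have hpd : 0 < Real.pi * d := by positivity
  have hd' : (d : ℂ) ≠ 0 := by exact_mod_cast hd.ne'
  have hkc : Continuous k := (continuous_sinhKernel hd h0 h1).mul
    (Continuous.inv₀ (by fun_prop) (line_ne_zero h0))
  have hs := sin_pos_of_height hd h0 h1
  have hkb : ∀ t : ℝ, ‖k t‖ ≤
      2 / Real.sin (Real.pi * d * η) * η⁻¹ * Real.exp (-(Real.pi * d * |t|)) := by
    intro t
    rw [hk]
    simp only
    rw [norm_mul]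
    refine (mul_le_mul (norm_sinh_inv_le hd h0 h1 t) (norm_line_inv_le h0 t) (norm_nonneg _)
      (by positivity)).trans_eq ?_
    ring
  have hJ : ∀ x : ℝ, lineIntegral η (sinhKernel d η) x =
      -(2 * I / d) / (1 + Real.exp (-(x / d))) := by
    intro x
    have hne : (1 + Real.exp (-(x / d)) : ℂ) ≠ 0 := by
      exact_mod_cast (by positivity : 1 + Real.exp (-(x / d)) ≠ 0)
    rw [eq_div_iff hne, lineIntegral_sinhKernel_mul hd h0 h1, integral_sinhKernel hd h0 h1]
    ring
  have hI : ∀ x : ℝ, HasDerivAt (fun x : ℝ => lineIntegral η k x)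
      (-(2 / d) / (1 + Real.exp (-(x / d))) : ℂ) x := by
    intro x
    have := (hasDerivAt_lineIntegral (η := η) (z := x) hkc hkb (by simpa using hpd)).comp_ofReal
    convert! this using 1
    have e : ∀ t : ℝ, -(I * (t + η * I)) * (exp (-(I * (t + η * I) * x)) * k t) =
        -I * (exp (-(I * (t + η * I) * x)) * sinhKernel d η t) := by
      intro t
      have h2 : k t * (t + η * I) = sinhKernel d η t := inv_mul_cancel_right₀ (line_ne_zero h0 t) _
      rw [← h2]; ring
    simp only [e]
    rw [integral_const_mul]
    have := hJ x
    rw [lineIntegral] at this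
    rw [this]
    linear_combination (-(2 / d) / (1 + Real.exp (-(x / d))) : ℂ) * I_sq
  set H : ℝ → ℂ := fun x => exp (1 / 2 * lineIntegral η k x) * (1 + Real.exp (x / d)) with hH
  have hE : ∀ x : ℝ, HasDerivAt (fun x : ℝ => (1 + Real.exp (x / d) : ℂ)) (Real.exp (x / d) / d) x := by
    intro x
    have := (((hasDerivAt_id x).div_const d).exp.ofReal_comp).const_add 1
    simpa [div_eq_mul_inv] using this
  have hHd : ∀ x : ℝ, HasDerivAt H 0 x := by
    intro x
    have := (((hI x).const_mul (1 / 2 : ℂ)).cexp).mul (hE x)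
    convert! this using 1
    have hne : (1 + Real.exp (-(x / d)) : ℂ) ≠ 0 := by
      exact_mod_cast (by positivity : 1 + Real.exp (-(x / d)) ≠ 0)
    have he : (Real.exp (x / d) : ℂ) * Real.exp (-(x / d)) = 1 := by
      rw [← ofReal_mul, ← Real.exp_add, add_neg_cancel, Real.exp_zero, ofReal_one]
    field_simp
    linear_combination -exp (lineIntegral η k x / 2) * he
  have hconst : ∀ y : ℝ, H y = H x := fun y =>
    is_const_of_deriv_eq_zero (fun z => (hHd z).differentiableAt) (fun z => (hHd z).deriv) y x
  -- The contour runs above the origin, whence the factor `exp(ηy)`, which is small as `y → -∞`.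
  have hlim0 : Filter.Tendsto (fun y : ℝ => lineIntegral η k y) Filter.atBot (nhds 0) := by
    refine squeeze_zero_norm (fun y => norm_lineIntegral_le hkb hpd (z := y) (by simp)) ?_
    have h2 : Filter.Tendsto (fun y : ℝ => Real.exp (η * y)) Filter.atBot (nhds 0) :=
      Real.tendsto_exp_atBot.comp (Filter.tendsto_id.const_mul_atBot h0)
    simpa using h2.const_mul _
  have hlim : Filter.Tendsto H Filter.atBot (nhds 1) := by
    have h2 : Filter.Tendsto (fun y : ℝ => (Real.exp (y / d) : ℂ)) Filter.atBot (nhds 0) := by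
      have := Real.tendsto_exp_atBot.comp (Filter.tendsto_id.atBot_div_const hd)
      have h3 := (continuous_ofReal.tendsto 0).comp this
      rwa [ofReal_zero] at h3
    have h3 := ((hlim0.const_mul (1 / 2 : ℂ)).cexp).mul (h2.const_add 1)
    rw [mul_zero, exp_zero, add_zero, mul_one] at h3
    exact h3
  have hHx : H x = 1 := tendsto_nhds_unique (tendsto_const_nhds.congr fun y => (hconst y).symm) hlim
  rw [neg_mul, exp_neg]
  exact inv_eq_of_mul_eq_one_right hHx

/-! ### The quantum dilogarithm in a strip -/

/-- `1 / (sh(πcp) sh(πdp) p)` on the line `p = t + iη`. -/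
def dilogKernel (c d η t : ℝ) : ℂ := sinhKernel c η t * sinhKernel d η t * (t + η * I)⁻¹

/-- The quantum dilogarithm with periods `c`, `d`; it is symmetric in `c` and `d`, and `Φ^ħ` is the
case `{c, d} = {ħ, 1}`. -/
def dilog (c d η : ℝ) (z : ℂ) : ℂ := exp (-(1 / 4) * lineIntegral η (dilogKernel c d η) z)

/-- Two positive periods, and a height between `0` and the poles `i/c`, `i/d` of the integrand. -/
structure IsPeriods (c d η : ℝ) : Prop where
  c_pos : 0 < c
  d_pos : 0 < d
  η_pos : 0 < η
  η_c : η * c < 1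
  η_d : η * d < 1

theorem dilog_comm (c d η : ℝ) : dilog c d η = dilog d c η := by
  funext z
  have : dilogKernel c d η = dilogKernel d c η := by
    funext t; rw [dilogKernel, dilogKernel, mul_comm (sinhKernel c η t)]
  rw [dilog, dilog, this]

theorem qdilog_eq (ħ : ℝ) (z : ℂ) : qdilog ħ z = dilog ħ 1 (contourHeight ħ) z := by
  rw [qdilog, dilog, lineIntegral]
  congr 2
  refine integral_congr_ae (Filter.Eventually.of_forall fun t => ?_)
  simp only [dilogIntegrand, dilogKernel, sinhKernel, ofReal_one, mul_one]
  rw [div_eq_mul_inv, div_eq_mul_inv, mul_inv, mul_comm (sinh (Real.pi * _))⁻¹, mul_assoc]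

theorem isPeriods_contourHeight {ħ : ℝ} (hħ : 0 < ħ) : IsPeriods ħ 1 (contourHeight ħ) := by
  have h1 : contourHeight ħ ≤ 1 / 2 := by
    unfold contourHeight; linarith [min_le_left 1 (1 / ħ)]
  have h2 : contourHeight ħ ≤ (1 / ħ) / 2 := by
    unfold contourHeight; linarith [min_le_right 1 (1 / ħ)]
  refine ⟨hħ, one_pos, ?_, ?_, by linarith⟩
  · unfold contourHeight; positivity
  · calc contourHeight ħ * ħ ≤ (1 / ħ) / 2 * ħ := mul_le_mul_of_nonneg_right h2 hħ.le
      _ = 1 / 2 := by field_simp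
      _ < 1 := by norm_num

/-- Unitarity, `conj Φ(z) Φ(conj z) = 1`: the kernel changes its sign under `p ↦ -conj p`, which
preserves the line `Im p = η`. -/
theorem conj_dilog_mul (c d η : ℝ) (z : ℂ) :
    (starRingEnd ℂ) (dilog c d η z) * dilog c d η ((starRingEnd ℂ) z) = 1 := by
  have hk : ∀ t : ℝ, (starRingEnd ℂ) (dilogKernel c d η (-t)) = -dilogKernel c d η t := by
    intro t
    have e : (starRingEnd ℂ) (((-t : ℝ) : ℂ) + η * I) = -((t : ℂ) + η * I) := by
      simp; ring
    simp only [dilogKernel, sinhKernel, map_mul, map_inv₀, ← sinh_conj, e, conj_ofReal, mul_neg,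
      sinh_neg, inv_neg]
    ring
  have hJ : (starRingEnd ℂ) (lineIntegral η (dilogKernel c d η) z) =
      -lineIntegral η (dilogKernel c d η) ((starRingEnd ℂ) z) := by
    rw [lineIntegral, lineIntegral, ← integral_conj, ← integral_neg_eq_self, ← integral_neg]
    congr 1
    funext t
    have e : (starRingEnd ℂ) (((-t : ℝ) : ℂ) + η * I) = -((t : ℂ) + η * I) := by
      simp; ring
    rw [map_mul, hk, ← exp_conj, map_neg, map_mul, map_mul, e, conj_I]
    ring_nf
  rw [dilog, dilog, ← exp_conj, ← exp_add, map_mul, hJ]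
  have : (starRingEnd ℂ) (-(1 / 4) : ℂ) = -(1 / 4) := by
    rw [map_neg, map_div₀, map_one]; congr 2; exact conj_ofReal 4
  rw [this, mul_neg, neg_add_cancel, exp_zero]

theorem dilog_ne_zero (c d η : ℝ) (z : ℂ) : dilog c d η z ≠ 0 := exp_ne_zero _

theorem conj_dilog_ofReal (c d η x : ℝ) :
    (starRingEnd ℂ) (dilog c d η x) = (dilog c d η x)⁻¹ := by
  have := conj_dilog_mul c d η x
  rw [conj_ofReal] at this
  exact eq_inv_of_mul_eq_one_left this

theorem norm_dilog_ofReal (c d η x : ℝ) : ‖dilog c d η x‖ = 1 := by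
  have h1 := congrArg norm (conj_dilog_mul c d η x)
  rw [conj_ofReal, norm_mul, RCLike.norm_conj, norm_one] at h1
  nlinarith [norm_nonneg (dilog c d η x)]

namespace IsPeriods

variable {c d η : ℝ} (h : IsPeriods c d η)

include h

theorem symm : IsPeriods d c η := ⟨h.d_pos, h.c_pos, h.η_pos, h.η_d, h.η_c⟩

theorem continuous_kernel : Continuous (dilogKernel c d η) :=
  ((continuous_sinhKernel h.c_pos h.η_pos h.η_c).mul
    (continuous_sinhKernel h.d_pos h.η_pos h.η_d)).mul
    (Continuous.inv₀ (by fun_prop) (line_ne_zero h.η_pos))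

theorem norm_kernel_le : ∃ A, ∀ t : ℝ, ‖dilogKernel c d η t‖ ≤
    A * Real.exp (-(Real.pi * (c + d) * |t|)) := by
  have hc := sin_pos_of_height h.c_pos h.η_pos h.η_c
  have hd := sin_pos_of_height h.d_pos h.η_pos h.η_d
  have hη := h.η_pos
  refine ⟨2 / Real.sin (Real.pi * c * η) * (2 / Real.sin (Real.pi * d * η)) * η⁻¹, fun t => ?_⟩
  rw [dilogKernel, norm_mul, norm_mul]
  refine (mul_le_mul (mul_le_mul (norm_sinh_inv_le h.c_pos h.η_pos h.η_c t)
    (norm_sinh_inv_le h.d_pos h.η_pos h.η_d t) (norm_nonneg _) (by positivity))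
    (norm_line_inv_le h.η_pos t) (norm_nonneg _) (by positivity)).trans_eq ?_
  rw [show -(Real.pi * (c + d) * |t|) = -(Real.pi * c * |t|) + -(Real.pi * d * |t|) by ring,
    Real.exp_add]
  ring

theorem differentiableAt_dilog {z : ℂ} (hz : |z.im| < Real.pi * (c + d)) :
    DifferentiableAt ℂ (dilog c d η) z := by
  obtain ⟨A, hA⟩ := h.norm_kernel_le
  exact ((hasDerivAt_lineIntegral h.continuous_kernel hA hz).differentiableAt.const_mul _).cexp

/-- The a priori growth estimate. It is doubly exponential, but with a rate that is admissible in the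
Phragmén-Lindelöf principle. -/
theorem norm_inv_dilog_le {ρ : ℝ} (hρ : ρ < Real.pi * (c + d)) : ∃ B, ∀ z : ℂ, |z.im| ≤ ρ →
    ‖(dilog c d η z)⁻¹‖ ≤ Real.exp (B * Real.exp (η * |z.re|)) := by
  obtain ⟨A, hA⟩ := h.norm_kernel_le
  have hA0 : 0 ≤ A := by
    have := (norm_nonneg _).trans (hA 0)
    exact nonneg_of_mul_nonneg_left this (Real.exp_pos _)
  have hI : 0 ≤ ∫ t : ℝ, Real.exp (-((Real.pi * (c + d) - ρ) * |t|)) :=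
    integral_nonneg fun t => (Real.exp_pos _).le
  refine ⟨A * ∫ t : ℝ, Real.exp (-((Real.pi * (c + d) - ρ) * |t|)), fun z hz => ?_⟩
  have h1 := norm_lineIntegral_le (η := η) hA hρ hz
  rw [dilog, ← exp_neg, norm_exp]
  refine Real.exp_le_exp.2 ((re_le_norm _).trans ?_)
  have h2 : Real.exp (η * z.re) ≤ Real.exp (η * |z.re|) :=
    Real.exp_le_exp.2 (mul_le_mul_of_nonneg_left (le_abs_self _) h.η_pos.le)
  rw [norm_neg, norm_mul]
  have h3 : ‖(-(1 / 4) : ℂ)‖ ≤ 1 := by norm_num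
  calc _ ≤ 1 * ((A * ∫ t : ℝ, Real.exp (-((Real.pi * (c + d) - ρ) * |t|))) *
        Real.exp (η * z.re)) := mul_le_mul h3 h1 (norm_nonneg _) zero_le_one
    _ ≤ _ := by
      rw [one_mul]; gcongr

/-- The difference equation: `exp(πcp) - exp(-πcp)` cancels the factor `sh(πcp)` of the kernel. -/
theorem dilog_add (x : ℝ) : dilog c d η (x + Real.pi * c * I) =
    (1 + Real.exp (x / d)) * dilog c d η (x - Real.pi * c * I) := by
  obtain ⟨A, hA⟩ := h.norm_kernel_le
  have hc := h.c_pos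
  have hd := h.d_pos
  have him : Real.pi * c < Real.pi * (c + d) := by nlinarith [Real.pi_pos]
  have hpc : (0 : ℝ) < Real.pi * c := by positivity
  have i1 := integrable_line (η := η) (z := x + Real.pi * c * I) h.continuous_kernel hA (by
    simpa [abs_of_pos hc, abs_of_pos Real.pi_pos] using him)
  have i2 := integrable_line (η := η) (z := x - Real.pi * c * I) h.continuous_kernel hA (by
    simpa [abs_of_pos hc, abs_of_pos Real.pi_pos] using him)
  have e : lineIntegral η (dilogKernel c d η) (x + Real.pi * c * I) -
      lineIntegral η (dilogKernel c d η) (x - Real.pi * c * I) =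
      2 * lineIntegral η (fun t => sinhKernel d η t * (t + η * I)⁻¹) x := by
    rw [lineIntegral, lineIntegral, lineIntegral, ← integral_sub i1 i2, ← integral_const_mul]
    congr 1
    funext t
    have hs := sinh_line_ne_zero hc h.η_pos h.η_c t
    have a1 : -(I * (t + η * I) * (x + Real.pi * c * I)) =
        -(I * (t + η * I) * x) + Real.pi * c * (t + η * I) := by
      linear_combination (-(t + η * I) * Real.pi * c) * I_sq
    have a2 : -(I * (t + η * I) * (x - Real.pi * c * I)) =
        -(I * (t + η * I) * x) + -(Real.pi * c * (t + η * I)) := by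
      linear_combination ((t + η * I) * Real.pi * c) * I_sq
    have a3 : exp (Real.pi * c * (t + η * I)) - exp (-(Real.pi * c * (t + η * I))) =
        2 * sinh (Real.pi * c * (t + η * I)) := by
      rw [Complex.sinh]; ring
    rw [← sub_mul, a1, a2, exp_add, exp_add, ← mul_sub, a3, dilogKernel, sinhKernel]
    linear_combination (2 * exp (-(I * (t + η * I) * x)) * sinhKernel d η t * (t + η * I : ℂ)⁻¹) *
      mul_inv_cancel₀ hs
  rw [← exp_lineIntegral_eq hd h.η_pos h.η_d x, dilog, dilog, ← exp_add]
  congr 1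
  linear_combination -(1 / 4 : ℂ) * e

/-- By unitarity `Φ(x + πic)` and `Φ(x - πic)` have inverse absolute values, and their quotient is
given by the difference equation. -/
theorem norm_dilog_add_sq (x : ℝ) :
    ‖dilog c d η (x + Real.pi * c * I)‖ ^ 2 = 1 + Real.exp (x / d) := by
  have h1 := congrArg norm (h.dilog_add x)
  have h2 := congrArg norm (conj_dilog_mul c d η (x + Real.pi * c * I))
  have e : (starRingEnd ℂ) (x + Real.pi * c * I : ℂ) = x - Real.pi * c * I := by
    simp [sub_eq_add_neg]
  rw [e, norm_mul, RCLike.norm_conj, norm_one] at h2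
  have h3 : ‖(1 + Real.exp (x / d) : ℂ)‖ = 1 + Real.exp (x / d) := by
    rw [← ofReal_one, ← ofReal_add, norm_real, Real.norm_of_nonneg (by positivity)]
  rw [norm_mul, h3] at h1
  rw [sq]
  nth_rewrite 2 [h1]
  rw [mul_left_comm, h2, mul_one]

theorem norm_inv_dilog_add_le (x : ℝ) : ‖(dilog c d η (x + Real.pi * c * I))⁻¹‖ ≤ 1 := by
  rw [norm_inv]
  refine inv_le_one_of_one_le₀ ?_
  have := h.norm_dilog_add_sq x
  nlinarith [Real.exp_pos (x / d), norm_nonneg (dilog c d η (x + Real.pi * c * I))]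

theorem norm_inv_dilog_sub_le (x : ℝ) :
    ‖(dilog c d η (x - Real.pi * c * I))⁻¹‖ ≤ 2 * Real.exp (1 / d * |x|) := by
  have h2 := congrArg norm (conj_dilog_mul c d η (x + Real.pi * c * I))
  have e : (starRingEnd ℂ) (x + Real.pi * c * I : ℂ) = x - Real.pi * c * I := by
    simp [sub_eq_add_neg]
  rw [e, norm_mul, RCLike.norm_conj, norm_one] at h2
  rw [norm_inv, ← eq_inv_of_mul_eq_one_left h2]
  have h3 := h.norm_dilog_add_sq x
  have hd := h.d_pos
  have h4 : Real.exp (x / d) ≤ Real.exp (1 / d * |x|) := by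
    refine Real.exp_le_exp.2 ?_
    rw [div_eq_inv_mul, one_div]
    exact mul_le_mul_of_nonneg_left (le_abs_self x) (by positivity)
  have h5 : 1 ≤ Real.exp (1 / d * |x|) := Real.one_le_exp (by positivity)
  nlinarith [norm_nonneg (dilog c d η (x + Real.pi * c * I))]

end IsPeriods

/-- Multiplication by a function that has at most exponential growth on the boundary of the strip
preserves rapid decay, by the Phragmén-Lindelöf principle. -/
theorem StripDecay.mul_of_boundary {a b : ℝ} (hab : a < b) {f ψ : ℂ → ℂ} (hf : StripDecay a b f)
    (hc : ContinuousOn ψ (im ⁻¹' Set.Icc a b)) (hd : DifferentiableOn ℂ ψ (im ⁻¹' Set.Ioo a b))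
    {B η : ℝ} (hη : η < Real.pi / (b - a))
    (hB : ∀ z : ℂ, z.im ∈ Set.Icc a b → ‖ψ z‖ ≤ Real.exp (B * Real.exp (η * |z.re|))) {D m : ℝ}
    (hD : ∀ z : ℂ, z.im = a ∨ z.im = b → ‖ψ z‖ ≤ D * Real.exp (m * |z.re|)) :
    StripDecay a b fun z => ψ z * f z where
  cont := hc.mul hf.cont
  diff := hd.mul hf.diff
  decay n := by
    -- The weights `exp(νz)` with `ν = ± n` measure the decay to the right and to the left.
    have key : ∀ ν : ℝ, ∃ C, ∀ z : ℂ, z.im ∈ Set.Icc a b →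
        ‖ψ z * (exp (ν * z) * f z)‖ ≤ C := by
      intro ν
      have hg := hf.exp_mul ν
      obtain ⟨C, hC⟩ := hg.decay m
      obtain ⟨C', hC'⟩ := hg.decay 0
      have hbd : ∀ z : ℂ, z.im = a ∨ z.im = b → ‖ψ z * (exp (ν * z) * f z)‖ ≤ D * C := by
        intro z hz
        have hz' : z.im ∈ Set.Icc a b := by rcases hz with h | h <;> rw [h] <;> simp [hab.le]
        have h1 := hD z hz
        rw [norm_mul]
        refine (mul_le_mul h1 (hC z hz') (norm_nonneg _) ((norm_nonneg _).trans h1)).trans_eq ?_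
        rw [mul_mul_mul_comm, ← Real.exp_add, add_neg_cancel, Real.exp_zero, mul_one]
      refine ⟨D * C, fun z hz => PhragmenLindelof.horizontal_strip (a := a) (b := b)
        (f := fun z => ψ z * (exp (ν * z) * f z)) ⟨hd.mul hg.diff, ?_⟩ ⟨η, hη, B, ?_⟩
        (fun z hz => hbd z (Or.inl hz)) (fun z hz => hbd z (Or.inr hz)) hz.1 hz.2⟩
      · rw [closure_preimage_im, closure_Ioo hab.ne]
        exact hc.mul hg.cont
      · refine Asymptotics.IsBigO.of_bound C' ?_
        refine Filter.mem_inf_of_right (Filter.mem_principal.2 fun z hz => ?_)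
        have hz' := Set.Ioo_subset_Icc_self hz
        simp only [Set.mem_ofPred_eq]
        rw [norm_mul, Real.norm_of_nonneg (Real.exp_pos _).le, mul_comm]
        have := hC' z hz'
        simp only [zero_mul, neg_zero, Real.exp_zero, mul_one] at this
        exact mul_le_mul this (hB z hz') (norm_nonneg _) ((norm_nonneg _).trans this)
    obtain ⟨C, hC⟩ := key n
    obtain ⟨C', hC'⟩ := key (-n)
    refine ⟨max C C', fun z hz => ?_⟩
    rw [Real.exp_neg, ← div_eq_mul_inv, le_div_iff₀ (Real.exp_pos _)]
    have e : ∀ ν : ℝ, ‖ψ z * (exp (ν * z) * f z)‖ = ‖ψ z * f z‖ * Real.exp (ν * z.re) := by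
      intro ν
      rw [mul_left_comm, norm_mul, norm_exp, re_ofReal_mul, mul_comm]
    rcases le_total 0 z.re with h | h
    · rw [abs_of_nonneg h, ← e]
      exact (hC z hz).trans (le_max_left _ _)
    · rw [abs_of_nonpos h, mul_neg, ← neg_mul, ← e]
      exact (by simpa using hC' z hz : _ ≤ C').trans (le_max_right _ _)

namespace IsPeriods

variable {c d η : ℝ} (h : IsPeriods c d η)

include h

theorem stripDecay_inv_dilog_mul {a b : ℝ} (hab : b - a = Real.pi * c)
    (ha : -(Real.pi * c) ≤ a) (hb : b ≤ Real.pi * c) {f : ℂ → ℂ} (hf : StripDecay a b f) {D m : ℝ}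
    (hD : ∀ z : ℂ, z.im = a ∨ z.im = b → ‖(dilog c d η z)⁻¹‖ ≤ D * Real.exp (m * |z.re|)) :
    StripDecay a b fun z => (dilog c d η z)⁻¹ * f z := by
  have hc := h.c_pos
  have hd := h.d_pos
  have hpc : 0 < Real.pi * c := by positivity
  have him : Real.pi * c < Real.pi * (c + d) := by nlinarith [Real.pi_pos]
  have hle : ∀ z : ℂ, z.im ∈ Set.Icc a b → |z.im| ≤ Real.pi * c := fun z hz =>
    abs_le.2 ⟨ha.trans hz.1, hz.2.trans hb⟩
  have hdiff : ∀ z : ℂ, z.im ∈ Set.Icc a b →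
      DifferentiableAt ℂ (fun z => (dilog c d η z)⁻¹) z := fun z hz =>
    (h.differentiableAt_dilog ((hle z hz).trans_lt him)).inv (dilog_ne_zero c d η z)
  obtain ⟨B, hB⟩ := h.norm_inv_dilog_le him
  refine hf.mul_of_boundary (by linarith) (fun z hz => (hdiff z hz).continuousAt.continuousWithinAt)
    (fun z hz => (hdiff z (Set.Ioo_subset_Icc_self hz)).differentiableWithinAt)
    (η := η) (B := B) ?_ (fun z hz => hB z (hle z hz)) hD
  -- The rate `η < 1/c` is below `π / (b - a) = 1/c`, which is what the principle requires.
  rw [hab, lt_div_iff₀ hpc]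
  nlinarith [Real.pi_pos, h.η_c]

theorem stripDecay_upper {f : ℂ → ℂ} (hf : StripDecay 0 (Real.pi * c) f) :
    StripDecay 0 (Real.pi * c) fun z => (dilog c d η z)⁻¹ * f z := by
  have hc := h.c_pos
  have hpc : 0 < Real.pi * c := by positivity
  refine h.stripDecay_inv_dilog_mul (by ring) (by linarith) le_rfl hf (D := 1) (m := 0)
    fun z hz => ?_
  rw [zero_mul, Real.exp_zero, mul_one]
  rcases hz with hz | hz
  · have e : z = (z.re : ℂ) := by apply Complex.ext <;> simp [hz]
    rw [e, norm_inv, norm_dilog_ofReal, inv_one]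
  · have e : z = (z.re : ℂ) + Real.pi * c * I := by apply Complex.ext <;> simp [hz]
    rw [e]
    exact h.norm_inv_dilog_add_le z.re

theorem stripDecay_lower {f : ℂ → ℂ} (hf : StripDecay (-(Real.pi * c)) 0 f) :
    StripDecay (-(Real.pi * c)) 0 fun z => (dilog c d η z)⁻¹ * f z := by
  have hc := h.c_pos
  have hd := h.d_pos
  have hpc : 0 < Real.pi * c := by positivity
  refine h.stripDecay_inv_dilog_mul (by ring) le_rfl hpc.le hf (D := 2) (m := 1 / d)
    fun z hz => ?_
  rcases hz with hz | hz
  · have e : z = (z.re : ℂ) - Real.pi * c * I := by apply Complex.ext <;> simp [hz]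
    rw [e]
    simpa using h.norm_inv_dilog_sub_le z.re
  · have e : z = (z.re : ℂ) := by apply Complex.ext <;> simp [hz]
    rw [e, norm_inv, norm_dilog_ofReal, inv_one, ofReal_re]
    have : 1 ≤ Real.exp (1 / d * |z.re|) := Real.one_le_exp (by positivity)
    linarith

end IsPeriods

/-! ### Imaginary translation of `Φ s` -/

theorem IsShift.trans {b b' : ℝ} {s t u : L2R} (h : IsShift b s t) (h' : IsShift b' t u) :
    IsShift (b + b') s u := by
  unfold IsShift at *
  filter_upwards [h, h'] with ξ e e'
  rw [e', e, ← mul_assoc, ← ofReal_mul, ← Real.exp_add]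
  congr 3; ring

/-- If `s` can be translated by `ib`, it can be translated by `ib'` for all `0 ≤ b' ≤ b`. -/
theorem IsShift.interpolate {b b' : ℝ} {s t : L2R} (h : IsShift b s t) (h0 : 0 ≤ b') (hb : b' ≤ b) :
    ∃ u, IsShift b' s u := by
  set S : L2R := FourierTransform.fourierInv s with hS
  set T : L2R := FourierTransform.fourierInv t with hT
  -- `exp(2πb'ξ) ≤ 1 + exp(2πbξ)` for all real `ξ`.
  have hm : MemLp (fun ξ => (Real.exp (2 * Real.pi * b' * ξ) : ℂ) * S ξ) 2 volume := by
    refine MemLp.mono ((Lp.memLp S).norm.add (Lp.memLp T).norm) ?_ ?_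
    · exact Continuous.aestronglyMeasurable (by fun_prop) |>.mul (Lp.aestronglyMeasurable S)
    · have h' : T =ᵐ[volume] fun ξ => (Real.exp (2 * Real.pi * b * ξ) : ℂ) * S ξ := h
      filter_upwards [h'] with ξ e
      simp only [Pi.add_apply]
      rw [e, Real.norm_of_nonneg (by positivity), norm_mul, norm_mul, norm_real, norm_real,
        Real.norm_of_nonneg (Real.exp_pos _).le, Real.norm_of_nonneg (Real.exp_pos _).le]
      have hb0 : 0 ≤ b := h0.trans hb
      have h1 : Real.exp (2 * Real.pi * b' * ξ) ≤ 1 + Real.exp (2 * Real.pi * b * ξ) := by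
        rcases le_total ξ 0 with hξ | hξ
        · have : Real.exp (2 * Real.pi * b' * ξ) ≤ 1 := by
            rw [Real.exp_le_one_iff]
            exact mul_nonpos_of_nonneg_of_nonpos (by positivity) hξ
          linarith [Real.exp_pos (2 * Real.pi * b * ξ)]
        · have : Real.exp (2 * Real.pi * b' * ξ) ≤ Real.exp (2 * Real.pi * b * ξ) := by
            refine Real.exp_le_exp.2 ?_
            gcongr
          linarith
      nlinarith [norm_nonneg (S ξ)]
  refine ⟨FourierTransform.fourier (hm.toLp _ : L2R), ?_⟩
  have e : FourierTransform.fourierInv (FourierTransform.fourier (hm.toLp _ : L2R) : L2R) =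
      (hm.toLp _ : L2R) := FourierTransform.fourierInv_fourier_eq _
  rw [IsShift, e]
  exact hm.coeFn_toLp

/-- The function `1 + q⁻¹ exp(z/d)`, where `q = exp(πic/d)`. -/
def coefE (c d : ℝ) (z : ℂ) : ℂ := 1 + exp ((z - Real.pi * c * I) / d)

theorem one_add_exp_ne_zero {d : ℝ} (hd : 0 < d) {x : ℝ} (hx : x ≠ 0) (σ : ℝ) :
    1 + exp ((x + σ * I) / d) ≠ 0 := by
  intro h
  have h1 := congrArg norm (eq_neg_of_add_eq_zero_right h)
  rw [norm_neg, norm_one, norm_exp, Real.exp_eq_one_iff] at h1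
  rw [show ((x + σ * I) / d : ℂ) = (x / d : ℝ) + (σ / d : ℝ) * I by push_cast; ring] at h1
  simp only [add_re, ofReal_re, mul_re, I_re, mul_zero, ofReal_im, I_im, mul_one, sub_self,
    add_zero, div_eq_zero_iff] at h1
  exact h1.elim hx hd.ne'

theorem ae_ne_zero : ∀ᵐ x : ℝ, x ≠ 0 := by
  rw [ae_iff]; simp

theorem StripDecay.coefE_mul {a b : ℝ} {g : ℂ → ℂ} (hg : StripDecay a b g) (c d : ℝ) :
    StripDecay a b fun z => coefE c d z * g z := by
  have := hg.add ((hg.exp_mul (1 / d)).const_mul (exp (-(Real.pi * c * I) / d)))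
  convert! this using 2 with z
  rw [coefE, add_mul, one_mul, ← mul_assoc, ← exp_add]
  congr 3; ring

/-- A triple `s`, `r`, `t` that stands for `s`, `v₂ s`, `v₀ v₂ s = (1 + q⁻¹ v₁) s`, and the products
`σ = Φ s`, `ρ = Φ r`. -/
structure DilogTriple (c d η : ℝ) (s r t σ ρ : L2R) : Prop where
  per : IsPeriods c d η
  shift : IsShift (-(2 * Real.pi * c)) r t
  ae_t : t =ᵐ[volume] fun x => (1 + exp ((x - Real.pi * c * I) / d)) * s x
  ae_σ : σ =ᵐ[volume] fun x => dilog c d η x * s x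
  ae_ρ : ρ =ᵐ[volume] fun x => dilog c d η x * r x

namespace DilogTriple

variable {c d η : ℝ} {s r t σ ρ : L2R}

/-- The pairing with multiples of `1 + q⁻¹ exp(z/d)`: the contour is moved by `πic` twice, with the
integrand rewritten by the difference equation on the middle line, so that `Φ⁻¹` is only needed in
the strip `|Im z| ≤ πc`. -/
theorem pair_eq (h : DilogTriple c d η s r t σ ρ) {g : ℂ → ℂ}
    (hg : StripDecay 0 (2 * Real.pi * c) g) :
    ∫ x : ℝ, (starRingEnd ℂ) (ρ x) * (coefE c d x * g x) =
      ∫ x : ℝ, (starRingEnd ℂ) (σ x) *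
        (coefE c d (x + 2 * Real.pi * c * I) * g (x + 2 * Real.pi * c * I)) := by
  have hc := h.per.c_pos
  have hpc : 0 < Real.pi * c := mul_pos Real.pi_pos hc
  set Φ := dilog c d η with hΦ
  have hH1 : StripDecay 0 (Real.pi * c) fun z => (Φ z)⁻¹ * (coefE c d z * g z) :=
    h.per.stripDecay_upper ((hg.mono le_rfl (by linarith)).coefE_mul c d)
  have hH2 : StripDecay (-(Real.pi * c)) 0 fun z => (Φ z)⁻¹ * g (z + 2 * Real.pi * c * I) := by
    have h2 := hg.translate (2 * Real.pi * c)
    have h3 := h.per.stripDecay_lower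
      (h2.mono (a' := -(Real.pi * c)) (b' := 0) (by linarith) (by linarith))
    simpa using h3
  have hu := hH2.memLp_line (y := 0) ⟨by linarith, le_rfl⟩
  have hi := hH2.integrable_line (y := 0) ⟨by linarith, le_rfl⟩
  have hu' := hH1.memLp_line (y := 0) ⟨le_rfl, hpc.le⟩
  have hi' := hH1.integrable_line (y := 0) ⟨le_rfl, hpc.le⟩
  have key := h.shift.pair hu hi hu' hi' (fun κ => by
    have f1 := hH1.fourier_shift hpc.le κ
    have f2 := hH2.fourier_shift (by linarith) κ
    rw [f2]
    have e : ∫ x : ℝ, exp (I * κ * x) * ((Φ (x + (-(Real.pi * c) : ℝ) * I))⁻¹ *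
        g (x + (-(Real.pi * c) : ℝ) * I + 2 * Real.pi * c * I)) =
        ∫ x : ℝ, exp (I * κ * x) * ((Φ (x + (Real.pi * c : ℝ) * I))⁻¹ *
          (coefE c d (x + (Real.pi * c : ℝ) * I) * g (x + (Real.pi * c : ℝ) * I))) := by
      congr 1
      funext x
      have a1 : (x + (Real.pi * c : ℝ) * I : ℂ) = x + Real.pi * c * I := by push_cast; ring
      have a2 : (x + (-(Real.pi * c) : ℝ) * I : ℂ) = x - Real.pi * c * I := by push_cast; ring
      have a3 : (x - Real.pi * c * I + 2 * Real.pi * c * I : ℂ) = x + Real.pi * c * I := by ring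
      rw [a1, a2, a3, hΦ, h.per.dilog_add, coefE, add_sub_cancel_right]
      have hne : (1 + exp (x / d) : ℂ) ≠ 0 := by
        rw [← ofReal_div, ← ofReal_exp]
        exact_mod_cast (by positivity : 1 + Real.exp (x / d) ≠ 0)
      have := dilog_ne_zero c d η (x - Real.pi * c * I)
      push_cast
      rw [mul_inv]
      field_simp
    rw [e, f1, ← mul_assoc, ← mul_assoc]
    have e2 : (Real.exp (κ * -(2 * Real.pi * c)) : ℂ) *
        exp (κ * ((0 : ℝ) - (-(Real.pi * c) : ℝ))) * exp (κ * ((Real.pi * c : ℝ) - (0 : ℝ))) = 1 := by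
      rw [ofReal_exp, ← exp_add, ← exp_add, ← exp_zero]
      congr 1; push_cast; ring
    rw [e2, one_mul])
  simp only [ofReal_zero, zero_mul, add_zero] at key
  refine Eq.trans (integral_congr_ae ?_) (key.symm.trans (integral_congr_ae ?_))
  · filter_upwards [h.ae_ρ] with x hx
    rw [hx, map_mul, conj_dilog_ofReal]; ring
  · filter_upwards [h.ae_t, h.ae_σ] with x hx hx'
    rw [hx, hx', map_mul, map_mul, conj_dilog_ofReal]
    have : (starRingEnd ℂ) (1 + exp ((x - Real.pi * c * I) / d)) =
        coefE c d (x + 2 * Real.pi * c * I) := by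
      rw [coefE, map_add, map_one, ← exp_conj]
      congr 2
      simp only [map_div₀, map_sub, map_mul, conj_ofReal, conj_I]
      ring
    rw [this]; ring

/-- If `c ≤ d`, the function `1 + q⁻¹ exp(z/d)` has no zero inside the strip `0 ≤ Im z ≤ 2πc`, and
every element of `W` is a limit of its multiples: with `2 ch = 2 ch((z - πic)/2d)`, which has
nonnegative real part there, `w` is the limit of `2 ch / (ε + 2 ch) w`. -/
theorem isShift_of_le (h : DilogTriple c d η s r t σ ρ) (hcd : c ≤ d) :
    IsShift (2 * Real.pi * c) σ ρ := by
  have hc := h.per.c_pos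
  have hd := h.per.d_pos
  have hd' : (d : ℂ) ≠ 0 := by exact_mod_cast hd.ne'
  set θ : ℂ → ℂ := fun z => (z - Real.pi * c * I) / (2 * d) with hθ
  have hθre : ∀ z, (θ z).re = z.re / (2 * d) := by
    intro z
    rw [hθ]
    simp only
    rw [show (2 * d : ℂ) = ((2 * d : ℝ) : ℂ) by push_cast; ring, div_ofReal_re]
    simp
  have hθim : ∀ z, (θ z).im = (z.im - Real.pi * c) / (2 * d) := by
    intro z
    rw [hθ]
    simp only
    rw [show (2 * d : ℂ) = ((2 * d : ℝ) : ℂ) by push_cast; ring, div_ofReal_im]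
    simp
  have hre : ∀ z : ℂ, z.im ∈ Set.Icc 0 (2 * Real.pi * c) → 0 ≤ (2 * cosh (θ z)).re := by
    intro z hz
    have e : (2 * cosh (θ z)).re = 2 * (Real.cosh (θ z).re * Real.cos (θ z).im) := by
      rw [show (2 : ℂ) = ((2 : ℝ) : ℂ) by norm_num, re_ofReal_mul]
      nth_rewrite 1 [← re_add_im (θ z)]
      rw [cosh_add, cosh_mul_I, sinh_mul_I, ← ofReal_cosh, ← ofReal_cos, ← ofReal_sinh, ← ofReal_sin]
      simp only [add_re, mul_re, ofReal_re, ofReal_im, I_re, I_im, mul_im]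
      ring
    rw [e]
    have hcos : 0 ≤ Real.cos (θ z).im := by
      refine Real.cos_nonneg_of_mem_Icc ?_
      rw [hθim]
      have h2 : Real.pi * c ≤ Real.pi * d := mul_le_mul_of_nonneg_left hcd Real.pi_pos.le
      constructor
      · rw [le_div_iff₀ (by positivity)]; linarith [hz.1]
      · rw [div_le_iff₀ (by positivity)]; linarith [hz.2]
    have := Real.cosh_pos (θ z).re
    positivity
  have hcosh : ∀ z : ℂ, z.re ≠ 0 → cosh (θ z) ≠ 0 := by
    intro z hz h0
    have h1 : exp (θ z) = -exp (-θ z) := by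
      rw [Complex.cosh, div_eq_zero_iff] at h0
      exact eq_neg_of_add_eq_zero_left (h0.resolve_right two_ne_zero)
    have h2 := congrArg norm h1
    rw [norm_neg, norm_exp, norm_exp, Real.exp_eq_exp, neg_re, hθre] at h2
    have h3 : z.re / (2 * d) = 0 := by linarith
    rw [div_eq_zero_iff] at h3
    rcases h3 with h3 | h3
    · exact hz h3
    · linarith
  have hden : ∀ ε : ℝ, 0 < ε → ∀ z : ℂ, z.im ∈ Set.Icc 0 (2 * Real.pi * c) →
      ε ≤ ‖(ε : ℂ) + 2 * cosh (θ z)‖ := by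
    intro ε hε z hz
    refine le_trans ?_ (re_le_norm _)
    rw [add_re, ofReal_re]
    linarith [hre z hz]
  have hE : ∀ z, coefE c d z = exp (θ z) * (2 * cosh (θ z)) := by
    intro z
    rw [Complex.cosh, mul_div_cancel₀ _ (two_ne_zero), mul_add, ← exp_add, ← exp_add, add_neg_cancel,
      exp_zero, coefE, add_comm, hθ]
    congr 2
    field_simp; ring
  have hθd : Differentiable ℂ θ := by rw [hθ]; fun_prop
  have hθc : Continuous θ := hθd.continuous
  refine isShift_of_inner fun w => ?_
  have hg : ∀ ε : ℝ, 0 < ε → StripDecay 0 (2 * Real.pi * c) fun z =>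
      (ε + 2 * cosh (θ z))⁻¹ * (exp (-θ z) * w.1 z) := by
    intro ε hε
    have hne : ∀ z : ℂ, z.im ∈ Set.Icc 0 (2 * Real.pi * c) → (ε : ℂ) + 2 * cosh (θ z) ≠ 0 :=
      fun z hz => norm_pos_iff.1 (hε.trans_le (hden ε hε z hz))
    have h1 := ((W_stripDecay w 0 (2 * Real.pi * c)).exp_mul (-(1 / (2 * d)))).const_mul
      (exp (Real.pi * c * I / (2 * d)))
    have h2 : StripDecay 0 (2 * Real.pi * c) fun z => exp (-θ z) * w.1 z := by
      convert! h1 using 2 with z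
      rw [← mul_assoc, ← exp_add, hθ]
      congr 2; ring
    refine h2.mul_left (D := ε⁻¹) (m := 0) (ContinuousOn.inv₀ (by fun_prop) hne)
      (DifferentiableOn.inv (by fun_prop) fun z hz => hne z (Set.Ioo_subset_Icc_self hz))
      fun z hz => ?_
    rw [zero_mul, Real.exp_zero, mul_one, norm_inv]
    exact inv_anti₀ hε (hden ε hε z hz)
  -- The cut-off factors: bounded by `1` in the strip, and convergent to `1` off the imaginary axis.
  set m : ℕ → ℂ → ℂ := fun n z => 2 * cosh (θ z) / (((1 / ((n : ℝ) + 1) : ℝ) : ℂ) + 2 * cosh (θ z))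
    with hm
  have hpos : ∀ n : ℕ, (0 : ℝ) < 1 / ((n : ℝ) + 1) := fun n => by positivity
  have hm1 : ∀ n : ℕ, ∀ z : ℂ, z.im ∈ Set.Icc 0 (2 * Real.pi * c) → ‖m n z‖ ≤ 1 := by
    intro n z hz
    rw [hm]
    simp only
    rw [norm_div, div_le_one ((hpos n).trans_le (hden _ (hpos n) z hz))]
    rw [norm_def, norm_def]
    refine Real.sqrt_le_sqrt ?_
    rw [normSq_apply, normSq_apply, add_re, add_im, ofReal_re, ofReal_im, zero_add]
    nlinarith [hre z hz, hpos n]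
  have hmlim : ∀ z : ℂ, z.re ≠ 0 → Filter.Tendsto (fun n => m n z) Filter.atTop (nhds 1) := by
    intro z hz
    have hne : 2 * cosh (θ z) ≠ 0 := mul_ne_zero two_ne_zero (hcosh z hz)
    have h1 : Filter.Tendsto (fun n : ℕ => ((1 / ((n : ℝ) + 1) : ℝ) : ℂ)) Filter.atTop (nhds 0) := by
      have := (continuous_ofReal.tendsto 0).comp tendsto_one_div_add_atTop_nhds_zero_nat
      simpa [Function.comp_def] using this
    have h2 := (tendsto_const_nhds (x := 2 * cosh (θ z))).div (h1.add_const (2 * cosh (θ z)))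
      (by simpa using hne)
    rw [zero_add, div_self hne] at h2
    exact h2
  have hmc : ∀ n : ℕ, ∀ y ∈ Set.Icc 0 (2 * Real.pi * c),
      Continuous fun x : ℝ => m n (x + y * I) := by
    intro n y hy
    refine Continuous.div (by fun_prop) (by fun_prop) fun x => ?_
    exact norm_pos_iff.1 ((hpos n).trans_le (hden _ (hpos n) _ (by simpa using hy)))
  -- `m n w` is a multiple of `1 + q⁻¹ exp(z/d)`, to which the pairing formula applies.
  have key : ∀ n, ∫ x : ℝ, (starRingEnd ℂ) (ρ x) * (m n (x + (0 : ℝ) * I) * w.1 (x + (0 : ℝ) * I)) =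
      ∫ x : ℝ, (starRingEnd ℂ) (σ x) * (m n (x + (2 * Real.pi * c : ℝ) * I) *
        w.1 (x + (2 * Real.pi * c : ℝ) * I)) := by
    intro n
    have := h.pair_eq (hg _ (hpos n))
    have e : ∀ z, coefE c d z * ((((1 / ((n : ℝ) + 1) : ℝ) : ℂ) + 2 * cosh (θ z))⁻¹ *
        (exp (-θ z) * w.1 z)) = m n z * w.1 z := by
      intro z
      rw [hE, hm, exp_neg]
      have := exp_ne_zero (θ z)
      simp only
      rw [div_eq_mul_inv]
      field_simp
    simp only [e] at this
    simpa using this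
  have hT : ∀ (τ : L2R), ∀ y ∈ Set.Icc 0 (2 * Real.pi * c), Filter.Tendsto (fun n : ℕ => ∫ x : ℝ,
      (starRingEnd ℂ) (τ x) * (m n (x + y * I) * w.1 (x + y * I))) Filter.atTop
      (nhds (∫ x : ℝ, (starRingEnd ℂ) (τ x) * w.1 (x + y * I))) := by
    intro τ y hy
    have hwd := (W_stripDecay w 0 (2 * Real.pi * c))
    have hint := integrable_conj_mul τ (hwd.memLp_line hy)
    refine tendsto_integral_of_dominated_convergence _ (fun n => ?_) hint.norm (fun n => ?_) ?_
    · exact (memLp_conj τ).1.mul ((hmc n y hy).mul (hwd.continuous_line hy)).aestronglyMeasurable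
    · refine Filter.Eventually.of_forall fun x => ?_
      rw [norm_mul, norm_mul, norm_mul]
      refine mul_le_mul_of_nonneg_left ?_ (norm_nonneg _)
      exact mul_le_of_le_one_left (norm_nonneg _) (hm1 n _ (by simpa using hy))
    · filter_upwards [ae_ne_zero] with x hx
      have := ((hmlim (x + y * I) (by simpa using hx)).mul_const (w.1 (x + y * I))).const_mul
        ((starRingEnd ℂ) (τ x))
      simpa using this
  have hpc : 0 ≤ 2 * Real.pi * c := by positivity
  have h1 := hT ρ 0 ⟨le_rfl, hpc⟩
  have h2 := hT σ (2 * Real.pi * c) ⟨hpc, le_rfl⟩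
  simp only [key] at h1
  have h3 := tendsto_nhds_unique h1 h2
  rw [inner_toL2, inner_toL2]
  simp only [ofReal_zero, zero_mul, add_zero] at h3
  exact h3

/-- If `Φ s` is known to have an imaginary translate by `2πc` in `L²(ℝ)`, then this translate is
`Φ r`: both pair equally with the multiples of `1 + q⁻¹ exp(z/d)`. -/
theorem isShift_of_exists (h : DilogTriple c d η s r t σ ρ) {τ : L2R}
    (hτ : IsShift (2 * Real.pi * c) σ τ) : IsShift (2 * Real.pi * c) σ ρ := by
  have hd := h.per.d_pos
  set l : ℂ := exp (-(Real.pi * c * I) / d) with hl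
  have hE : ∀ (w : W) (z : ℂ), coefE c d z * w.1 z = (w + l • expMulLin (1 / d : ℝ) w).1 z := by
    intro w z
    change _ = w.1 z + l * (exp ((1 / d : ℝ) * z) * w.1 z)
    rw [coefE, add_mul, one_mul, ← mul_assoc, hl, ← exp_add]
    congr 3; push_cast; ring
  have key : ∀ w : W, inner ℂ (ρ - τ) (toL2 (w + l • expMulLin (1 / d : ℝ) w)) = 0 := by
    intro w
    have h1 := h.pair_eq (W_stripDecay w 0 (2 * Real.pi * c))
    simp only [hE] at h1
    rw [inner_sub_left, sub_eq_zero, hτ.inner_W, inner_toL2, inner_toL2, h1]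
    change _ = ∫ x : ℝ, _ * (w + l • expMulLin (1 / d : ℝ) w).1 (x + (2 * Real.pi * c : ℝ) * I)
    push_cast
    rfl
  have h2 := ae_eq_of_expMul (s := ρ - τ) (t := ρ - τ) (l := -l) (β := 1 / d) fun w => by
    have := key w
    rw [map_add, map_smul, inner_add_right, inner_smul_right] at this
    rw [neg_mul]
    exact eq_neg_of_add_eq_zero_left this
  have h3 : ρ - τ = 0 := by
    refine Lp.ext ?_
    filter_upwards [h2, ae_ne_zero, Lp.coeFn_zero ℂ 2 (volume : Measure ℝ)] with x hx hx0 hz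
    rw [hz, Pi.zero_apply]
    have h4 : (1 + exp ((x + (Real.pi * c : ℝ) * I) / d)) * (ρ - τ : L2R) x = 0 := by
      have e : exp ((x + (Real.pi * c : ℝ) * I) / d) =
          (starRingEnd ℂ) l * Real.exp (1 / d * x) := by
        rw [hl, ← exp_conj, ofReal_exp, ← exp_add]
        congr 1
        simp only [map_div₀, map_neg, map_mul, conj_ofReal, conj_I]
        push_cast; ring
      rw [e, add_mul, one_mul]
      nth_rewrite 1 [hx]
      rw [map_neg]; ring
    exact (mul_eq_zero.1 h4).resolve_left (one_add_exp_ne_zero hd hx0 _)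
  rw [sub_eq_zero] at h3
  rwa [h3]

end DilogTriple

open QTorus
open scoped TensorProduct

/-! ### The action on the Schwartz space -/

theorem starL_tmul (x y : Lq) : starL (x ⊗ₜ y) = starLq x ⊗ₜ starLq y := rfl

theorem starLq_mul (x y : Lq) : starLq (x * y) = starLq y * starLq x :=
  Subtype.ext (starLin_mul x.1 y.1)

theorem starLin_starLin (x : QTorus) : starLin (starLin x) = x := by
  induction x using MonoidAlgebra.induction_on with
  | of g =>
    have : MonoidAlgebra.of ℤ HeisGroup g = qpow g.k * M g.a g.b := by
      simp only [qpow, M, ← map_mul, HeisGroup.mul_def]; simp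
    rw [this, starLin_mul, starLin_mul, starLin_M, starLin_qpow, starLin_M, starLin_qpow, neg_neg]
  | add x y hx hy => rw [map_add, map_add, hx, hy]
  | smul r x hx => rw [map_smul, map_smul, hx]

theorem starLq_starLq (x : Lq) : starLq (starLq x) = x := Subtype.ext (starLin_starLin x.1)

theorem starL_mul (A B : LAlg) : starL (A * B) = starL B * starL A := by
  induction A using TensorProduct.induction_on with
  | zero => simp
  | add A A' h h' => rw [add_mul, map_add, map_add, h, h', mul_add]
  | tmul x y =>
    induction B using TensorProduct.induction_on with
    | zero => simp
    | add B B' h h' => rw [mul_add, map_add, map_add, h, h', add_mul]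
    | tmul x' y' =>
      rw [Algebra.TensorProduct.tmul_mul_tmul, starL_tmul, starL_tmul, starL_tmul, starLq_mul,
        starLq_mul, Algebra.TensorProduct.tmul_mul_tmul]

theorem starL_starL (A : LAlg) : starL (starL A) = A := by
  induction A using TensorProduct.induction_on with
  | zero => simp
  | add A A' h h' => rw [map_add, map_add, h, h']
  | tmul x y => rw [starL_tmul, starL_tmul, starLq_starLq, starLq_starLq]

theorem starLq_one : starLq 1 = 1 := by
  have h : (1 : Lq) = ⟨qpow 0, qpow_mem 0⟩ := Subtype.ext qpow_zero.symm
  rw [h]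
  exact Subtype.ext ((starLin_qpow 0).trans (by rw [neg_zero]))

theorem starL_one : starL 1 = 1 := by
  rw [Algebra.TensorProduct.one_def, starL_tmul, starLq_one]

variable {ħ : ℝ} {hħ : 0 < ħ}

theorem mem_schwartzL_of_exists {f : L2R}
    (h : ∀ A : LAlg, ∃ g : L2R, ∀ w : W, inner ℂ g (toL2 w) = inner ℂ f (toL2 (repL ħ hħ A w))) :
    f ∈ schwartzL ħ hħ := by
  rw [schwartzL, Submodule.mem_iInf]
  intro A
  obtain ⟨g, hg⟩ := h A
  refine LinearPMap.mem_adjoint_domain_of_exists f ⟨g, ?_⟩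
  rintro ⟨_, w, rfl⟩
  refine (hg w).trans ?_
  congr 1
  simp only [opW]
  change _ = toL2 (repL ħ hħ A ((LinearEquiv.ofInjective toL2 toL2_injective).symm
    ((LinearEquiv.ofInjective toL2 toL2_injective) w)))
  rw [LinearEquiv.symm_apply_apply]

theorem eq_of_inner_W {f g : L2R} (h : ∀ w : W, inner ℂ f (toL2 w) = inner ℂ g (toL2 w)) :
    f = g := by
  refine Dense.eq_of_inner_left (𝕜 := ℂ) W_dense ?_
  rintro _ ⟨w, rfl⟩
  exact h w

theorem hat_mem (A : LAlg) (s : schwartzL ħ hħ) : hat ħ hħ A s ∈ schwartzL ħ hħ :=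
  mem_schwartzL_of_exists fun B => ⟨hat ħ hħ (starL B * A) s, fun w => by
    rw [inner_hat, inner_hat, starL_mul, starL_starL, map_mul]; rfl⟩

/-- The operator `Â` as a map of the Schwartz space to itself. -/
def hatS (A : LAlg) (s : schwartzL ħ hħ) : schwartzL ħ hħ := ⟨hat ħ hħ A s, hat_mem A s⟩

theorem hat_mul (A B : LAlg) (s : schwartzL ħ hħ) : hat ħ hħ (A * B) s = hat ħ hħ A (hatS B s) :=
  eq_of_inner_W fun w => by
    rw [inner_hat, inner_hat, starL_mul, map_mul]
    exact (inner_hat hħ B s _).symm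

theorem hat_add (A B : LAlg) (s : schwartzL ħ hħ) :
    hat ħ hħ (A + B) s = hat ħ hħ A s + hat ħ hħ B s :=
  eq_of_inner_W fun w => by
    rw [inner_add_left, inner_hat, inner_hat, inner_hat, map_add, map_add, LinearMap.add_apply,
      map_add, inner_add_right]

theorem hat_zsmul (n : ℤ) (A : LAlg) (s : schwartzL ħ hħ) :
    hat ħ hħ (n • A) s = n • hat ħ hħ A s := by
  have : AddMonoidHom.mk' (fun A => hat ħ hħ A s) (fun A B => hat_add A B s) (n • A) =
      n • AddMonoidHom.mk' (fun A => hat ħ hħ A s) (fun A B => hat_add A B s) A := map_zsmul _ _ _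
  exact this

theorem hat_one (s : schwartzL ħ hħ) : hat ħ hħ 1 s = s :=
  eq_of_inner_W fun w => by rw [inner_hat, starL_one, map_one]; rfl

variable (ħ hħ) in
/-- The relation `(K s, B̂ w) = (K Ĉ s, w)` with `C = γ(*B)`, for all `s ∈ S_L` and `w ∈ W`. -/
def Intertwines (B : LAlg) : Prop :=
  ∀ (s : schwartzL ħ hħ) (w : W), inner ℂ (K ħ hħ s) (toL2 (repL ħ hħ B w)) =
    inner ℂ (K ħ hħ (hat ħ hħ (gamma (starL B)) s)) (toL2 w)

theorem Intertwines.mul {B C : LAlg} (hB : Intertwines ħ hħ B) (hC : Intertwines ħ hħ C) :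
    Intertwines ħ hħ (B * C) := fun s w => by
  rw [map_mul, Module.End.mul_apply, hB, starL_mul, map_mul, hat_mul]
  exact hC (hatS (gamma (starL B)) s) w

theorem Intertwines.add {B C : LAlg} (hB : Intertwines ħ hħ B) (hC : Intertwines ħ hħ C) :
    Intertwines ħ hħ (B + C) := fun s w => by
  rw [map_add, LinearMap.add_apply, map_add, inner_add_right, hB, hC, map_add, map_add, hat_add,
    map_add, inner_add_left]

theorem Intertwines.algebraMap (n : ℤ) : Intertwines ħ hħ (algebraMap ℤ LAlg n) := fun s w => by
  rw [Algebra.algebraMap_eq_smul_one, map_zsmul, map_zsmul, map_zsmul, starL_one, map_one, map_one,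
    hat_zsmul, hat_one, LinearMap.smul_apply, map_zsmul, map_zsmul, Module.End.one_apply,
    ← Int.cast_smul_eq_zsmul ℂ, ← Int.cast_smul_eq_zsmul ℂ, inner_smul_right, inner_smul_left,
    map_intCast]

/-- If `C` acts surjectively on `W`, the relation for `B` follows from those for `BC` and `C`. -/
theorem Intertwines.of_mul {B C : LAlg} (hBC : Intertwines ħ hħ (B * C)) (hC : Intertwines ħ hħ C)
    (hs : Function.Surjective (repL ħ hħ C)) : Intertwines ħ hħ B := fun s w => by
  obtain ⟨w, rfl⟩ := hs w
  have h1 := hBC s w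
  rw [map_mul, Module.End.mul_apply, starL_mul, map_mul, hat_mul] at h1
  rw [h1]
  exact (hC (hatS (gamma (starL B)) s) w).symm

variable (ħ hħ) in
/-- The elements of `L` that satisfy the intertwining relation. -/
def intertwiners : Subalgebra ℤ LAlg where
  carrier := {B | Intertwines ħ hħ B}
  mul_mem' := Intertwines.mul
  add_mem' := Intertwines.add
  algebraMap_mem' := Intertwines.algebraMap

/-- `𝕃_q` is generated by the powers of `q` and the `v_i`. -/
theorem Lq_subalgebra_eq_top (S : Subalgebra ℤ Lq) (hq : ∀ k, ⟨qpow k, qpow_mem k⟩ ∈ S)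
    (hv : ∀ i, ⟨v i, v_mem i⟩ ∈ S) (x : Lq) : x ∈ S := by
  have h : Lq ≤ S.map Lq.val := by
    conv_lhs => rw [Lq_eq]
    refine Algebra.adjoin_le ?_
    rintro _ (⟨k, rfl⟩ | ⟨i, rfl⟩)
    · exact ⟨_, hq k, rfl⟩
    · exact ⟨_, hv i, rfl⟩
  obtain ⟨y, hy, hyx⟩ := h x.2
  have e : y = x := Subtype.ext hyx
  rwa [← e]

/-! ### The operator `K` and the two generators `v₀`, `v₁` -/

/-- Multiplication by `Φ^ħ`. -/
def mulDilog (ħ : ℝ) : L2R →ₗᵢ[ℂ] L2R :=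
  mulLin (fun x => qdilog ħ x) (measurable_qdilog ħ) (norm_qdilog ħ)

theorem mulDilog_ae (s : L2R) : mulDilog ħ s =ᵐ[volume] fun x => qdilog ħ x * s x :=
  mulLin_coe _ _ _ s

theorem K_ae (s : L2R) : K ħ hħ s =ᵐ[volume] fun z =>
    (FourierTransform.fourierInv (mulDilog ħ s) : L2R) (1 / (4 * Real.pi ^ 2 * ħ) * z) :=
  dilLin_coe (scale_ne hħ) (FourierTransform.fourierInv (mulDilog ħ s) : L2R)

theorem inner_fourierInv_left (s t : L2R) :
    inner ℂ (FourierTransform.fourierInv s : L2R) t =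
      inner ℂ s (FourierTransform.fourier t : L2R) := by
  have e : FourierTransform.fourierInv (FourierTransform.fourier t : L2R) = t :=
    FourierTransform.fourierInv_fourier_eq t
  nth_rewrite 1 [← e]
  exact inner_fourierInv s _

/-- The pairing with `K s` is the pairing of `Φ s` with the Fourier integral of `w`. -/
theorem inner_K (s : L2R) (w : W) : inner ℂ (K ħ hħ s) (toL2 w) =
    ∫ x : ℝ, (starRingEnd ℂ) (mulDilog ħ s x) *
      ∫ z : ℝ, exp (I * (-(x / (2 * Real.pi * ħ)) : ℝ) * z) * w.1 z := by
  set r : ℝ := 1 / (4 * Real.pi ^ 2 * ħ) with hr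
  have hr0 : 0 < r := by positivity
  set G : L2R := FourierTransform.fourierInv (mulDilog ħ s) with hG
  have hm : MemLp (fun y : ℝ => w.1 ((r⁻¹ * y : ℝ) : ℂ)) 2 volume := by
    refine (memLp_congr_ae ?_).1 (memLp_dil (inv_ne_zero hr0.ne') (toL2 w))
    exact (quasi_mul (inv_ne_zero hr0.ne')).ae (W_memLp w.1 w.2).coeFn_toLp
  have hi : Integrable fun y : ℝ => w.1 ((r⁻¹ * y : ℝ) : ℂ) :=
    (W_integrable w).comp_mul_left' (inv_ne_zero hr0.ne')
  have h1 : inner ℂ (K ħ hħ s) (toL2 w) = r⁻¹ * inner ℂ G (hm.toLp _ : L2R) := by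
    rw [inner_toL2, inner_toLp]
    have := Measure.integral_comp_mul_left
      (fun y : ℝ => (starRingEnd ℂ) (G y) * w.1 ((r⁻¹ * y : ℝ) : ℂ)) r
    rw [abs_of_pos (inv_pos.2 hr0), real_smul] at this
    rw [← this]
    refine integral_congr_ae ?_
    filter_upwards [K_ae (hħ := hħ) s] with x hx
    rw [hx, inv_mul_cancel_left₀ hr0.ne']
  rw [h1, inner_fourierInv_left, L2.inner_def, ← integral_const_mul]
  refine integral_congr_ae ?_
  filter_upwards [fourier_toLp_ae hm hi] with x hx
  rw [hx, RCLike.inner_apply]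
  have := Measure.integral_comp_mul_left (fun y : ℝ =>
    exp (I * (-(2 * Real.pi * x) : ℝ) * y) * w.1 ((r⁻¹ * y : ℝ) : ℂ)) r
  rw [abs_of_pos (inv_pos.2 hr0), real_smul] at this
  rw [← mul_assoc, ← this, mul_comm]
  congr 2
  funext z
  rw [inv_mul_cancel_left₀ hr0.ne']
  congr 2
  have hpi : (Real.pi : ℂ) ≠ 0 := by exact_mod_cast Real.pi_ne_zero
  have hh : (ħ : ℂ) ≠ 0 := by exact_mod_cast hħ.ne'
  rw [hr]
  push_cast
  field_simp
  ring

/-- The Fourier transform turns imaginary translation into multiplication by an exponential. -/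
theorem K_of_isShift {c d : ℝ} (hcd : c * d = ħ) {s t : L2R}
    (h : IsShift (2 * Real.pi * c) (mulDilog ħ s) (mulDilog ħ t)) (w : W) :
    inner ℂ (K ħ hħ s) (toL2 (expMulLin (1 / d : ℝ) w)) = inner ℂ (K ħ hħ t) (toL2 w) := by
  rw [inner_toL2, inner_toL2]
  refine integral_congr_ae ?_
  filter_upwards [K_ae (hħ := hħ) s, K_ae (hħ := hħ) t, (quasi_mul (scale_ne hħ)).ae h]
    with x h1 h2 h3
  rw [h1, h2, h3, map_mul, conj_ofReal]
  change _ * (exp ((1 / d : ℝ) * x) * w.1 x) = _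
  have hd : d ≠ 0 := by rintro rfl; rw [mul_zero] at hcd; exact hħ.ne hcd
  have hc : c ≠ 0 := by rintro rfl; rw [zero_mul] at hcd; exact hħ.ne hcd
  have e : 2 * Real.pi * (2 * Real.pi * c) * (1 / (4 * Real.pi ^ 2 * ħ) * x) = 1 / d * x := by
    rw [← hcd]; field_simp; ring
  rw [e, ofReal_exp, ofReal_mul]; ring

variable (ħ hħ) in
/-- `ι : 𝕃_q → L` is one of the two factors: it acts on `W` with translation by `2πic`,
multiplication by `exp(z/d)` and `q = exp(πic/d)`, where `{c, d} = {ħ, 1}`; it commutes with `*` and `γ`. -/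
structure IsFactor (c d : ℝ) (ι : Lq →ₐ[ℤ] LAlg) : Prop where
  per : IsPeriods c d (contourHeight ħ)
  mul : c * d = ħ
  dilog : ∀ z, qdilog ħ z = dilog c d (contourHeight ħ) z
  q : ∀ (k : ℤ) (w : W), repL ħ hħ (ι ⟨qpow k, qpow_mem k⟩) w = exp (k * (Real.pi * I * c / d)) • w
  v0 : ∀ w : W, repL ħ hħ (ι ⟨v 0, v_mem 0⟩) w = shiftLin ((-(2 * Real.pi * c) : ℝ) * I) w
  v1 : ∀ w : W, repL ħ hħ (ι ⟨v 1, v_mem 1⟩) w = expMulLin (1 / d : ℝ) w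
  star : ∀ x, starL (ι x) = ι (starLq x)
  gamma : ∀ x, gamma (ι x) = ι (gammaLq x)

theorem scalarOp_zpow (c : ℂ) (k : ℤ) (w : W) :
    ((scalarOp c ^ k : (Module.End ℂ W)ˣ) : Module.End ℂ W) w = exp (k * c) • w := by
  rw [scalarOp, ← map_zpow]
  change ((Units.mk0 (exp c) (exp_ne_zero c) ^ k : ℂˣ) : ℂ) • w = _
  rw [Units.val_zpow_eq_zpow_val, Units.val_mk0, ← exp_int_mul]

theorem repL_left (x : Lq) :
    repL ħ hħ ((Algebra.TensorProduct.includeLeft : Lq →ₐ[ℤ] LAlg) x) = rep ħ x.1 := by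
  change rep ħ x.1 * repDual ħ (1 : QTorus) = _
  rw [map_one, mul_one]

theorem repL_right (x : Lq) :
    repL ħ hħ ((Algebra.TensorProduct.includeRight : Lq →ₐ[ℤ] LAlg) x) = repDual ħ x.1 := by
  change rep ħ (1 : QTorus) * repDual ħ x.1 = _
  rw [map_one, one_mul]

theorem isFactor_left :
    IsFactor ħ hħ ħ 1 (Algebra.TensorProduct.includeLeft : Lq →ₐ[ℤ] LAlg) where
  per := isPeriods_contourHeight hħ
  mul := mul_one ħ
  dilog := qdilog_eq ħ
  q k w := by
    rw [repL_left]
    change rep ħ (MonoidAlgebra.of ℤ HeisGroup ⟨k, 0, 0⟩) w = _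
    rw [rep, MonoidAlgebra.lift_of]
    change (((scalarOp _ ^ (k - 0 * 0) * shiftOp _ ^ (0 : ℤ) * expMulOp 1 ^ (0 : ℤ) :
      (Module.End ℂ W)ˣ)) : Module.End ℂ W) w = _
    rw [zpow_zero, zpow_zero, mul_one, mul_one, zero_mul, sub_zero, scalarOp_zpow]
    simp
  v0 w := by
    rw [repL_left]
    change rep ħ (MonoidAlgebra.of ℤ HeisGroup ⟨0, -1, 0⟩) w = _
    rw [rep, MonoidAlgebra.lift_of]
    change (((scalarOp _ ^ ((0 : ℤ) - (-1) * 0) * shiftOp _ ^ (-1 : ℤ) * expMulOp 1 ^ (0 : ℤ) :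
      (Module.End ℂ W)ˣ)) : Module.End ℂ W) w = _
    rw [zpow_zero, mul_zero, sub_zero, zpow_zero, mul_one, one_mul, zpow_neg_one]
    change shiftLin _ w = _
    congr 2; push_cast; ring
  v1 w := by
    rw [repL_left]
    change rep ħ (MonoidAlgebra.of ℤ HeisGroup ⟨0, 0, 1⟩) w = _
    rw [rep, MonoidAlgebra.lift_of]
    change (((scalarOp _ ^ ((0 : ℤ) - 0 * 1) * shiftOp _ ^ (0 : ℤ) * expMulOp 1 ^ (1 : ℤ) :
      (Module.End ℂ W)ˣ)) : Module.End ℂ W) w = _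
    rw [zero_mul, sub_zero, zpow_zero, zpow_zero, one_mul, one_mul, zpow_one]
    change expMulLin _ w = _
    congr 2; simp
  star x := by
    change starL (x ⊗ₜ 1) = starLq x ⊗ₜ 1
    rw [starL_tmul, starLq_one]
  gamma x := by
    change gammaLq x ⊗ₜ gammaLq 1 = gammaLq x ⊗ₜ[ℤ] 1
    rw [map_one]

theorem isFactor_right :
    IsFactor ħ hħ 1 ħ (Algebra.TensorProduct.includeRight : Lq →ₐ[ℤ] LAlg) where
  per := (isPeriods_contourHeight hħ).symm
  mul := one_mul ħ
  dilog z := by rw [qdilog_eq, dilog_comm]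
  q k w := by
    rw [repL_right]
    change repDual ħ (MonoidAlgebra.of ℤ HeisGroup ⟨k, 0, 0⟩) w = _
    rw [repDual, MonoidAlgebra.lift_of]
    change (((scalarOp _ ^ (k - 0 * 0) * shiftOp _ ^ (0 : ℤ) * expMulOp _ ^ (0 : ℤ) :
      (Module.End ℂ W)ˣ)) : Module.End ℂ W) w = _
    rw [zpow_zero, zpow_zero, mul_one, mul_one, zero_mul, sub_zero, scalarOp_zpow]
    simp
  v0 w := by
    rw [repL_right]
    change repDual ħ (MonoidAlgebra.of ℤ HeisGroup ⟨0, -1, 0⟩) w = _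
    rw [repDual, MonoidAlgebra.lift_of]
    change (((scalarOp _ ^ ((0 : ℤ) - (-1) * 0) * shiftOp _ ^ (-1 : ℤ) * expMulOp _ ^ (0 : ℤ) :
      (Module.End ℂ W)ˣ)) : Module.End ℂ W) w = _
    rw [zpow_zero, mul_zero, sub_zero, zpow_zero, mul_one, one_mul, zpow_neg_one]
    change shiftLin _ w = _
    congr 2; push_cast; ring
  v1 w := by
    rw [repL_right]
    change repDual ħ (MonoidAlgebra.of ℤ HeisGroup ⟨0, 0, 1⟩) w = _
    rw [repDual, MonoidAlgebra.lift_of]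
    change (((scalarOp _ ^ ((0 : ℤ) - 0 * 1) * shiftOp _ ^ (0 : ℤ) * expMulOp _ ^ (1 : ℤ) :
      (Module.End ℂ W)ˣ)) : Module.End ℂ W) w = _
    rw [zero_mul, sub_zero, zpow_zero, zpow_zero, one_mul, one_mul, zpow_one]
    change expMulLin _ w = _
    congr 2; push_cast; rfl
  star x := by
    change starL (1 ⊗ₜ x) = 1 ⊗ₜ starLq x
    rw [starL_tmul, starLq_one]
  gamma x := by
    change gammaLq 1 ⊗ₜ gammaLq x = 1 ⊗ₜ[ℤ] gammaLq x
    rw [map_one]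

/-! ### The intertwining relation -/

/-- The generator `q^k` of `𝕃_q`. -/
def gq (k : ℤ) : Lq := ⟨qpow k, qpow_mem k⟩

/-- The generator `v_i` of `𝕃_q`. -/
def gv (i : Fin 5) : Lq := ⟨v i, v_mem i⟩

theorem v2_mul_v0 : gv 2 * gv 0 = 1 + gq 1 * gv 1 := by
  refine Subtype.ext ?_
  change v 2 * v 0 = 1 + qpow 1 * v 1
  simp only [v, add_mul, M_mul]
  simp [qpow_zero, M_zero]

theorem v4_mul_v1 : gv 4 * gv 1 = 1 + gq (-1) * gv 0 := by
  refine Subtype.ext ?_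
  change v 4 * v 1 = 1 + qpow (-1) * v 0
  simp only [v, add_mul, M_mul]
  simp [qpow_zero, M_zero]

theorem v3_mul_v0 : gv 3 * gv 0 = 1 + gq (-1) * gv 4 := by
  refine Subtype.ext ?_
  change v 3 * v 0 = 1 + qpow (-1) * v 4
  simp only [v, add_mul, mul_add, M_mul]
  simp [qpow_zero, M_zero]
  abel

namespace IsFactor

variable {ħ : ℝ} {hħ : 0 < ħ} {c d : ℝ} {ι : Lq →ₐ[ℤ] LAlg}

theorem star_gv (h : IsFactor ħ hħ c d ι) (i : Fin 5) : starL (ι (gv i)) = ι (gv i) := by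
  rw [h.star]; congr 1; exact Subtype.ext (starLin_v i)

theorem star_gq (h : IsFactor ħ hħ c d ι) (k : ℤ) : starL (ι (gq k)) = ι (gq (-k)) := by
  rw [h.star]; congr 1; exact Subtype.ext (starLin_qpow k)

theorem gamma_gv (h : IsFactor ħ hħ c d ι) (i : Fin 5) :
    QuantumM05.gamma (ι (gv i)) = ι (gv (i + 1)) := by
  rw [h.gamma]; congr 1; exact gammaLq_v i

theorem gamma_gq (h : IsFactor ħ hħ c d ι) (k : ℤ) :
    QuantumM05.gamma (ι (gq k)) = ι (gq k) := by
  rw [h.gamma]; congr 1; exact gammaHom_qpow k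

theorem intertwines_gq (h : IsFactor ħ hħ c d ι) (k : ℤ) : Intertwines ħ hħ (ι (gq k)) := by
  intro s w
  have hs : hat ħ hħ (ι (gq (-k))) s =
      (starRingEnd ℂ) (exp (k * (Real.pi * I * c / d))) • (s : L2R) := by
    refine eq_of_inner_W fun w => ?_
    rw [inner_hat, h.star_gq, neg_neg, inner_smul_left, conj_conj, ← inner_smul_right, ← map_smul]
    exact congrArg (fun u => inner ℂ (s : L2R) (toL2 u)) (h.q k w)
  rw [h.star_gq, h.gamma_gq, hs, map_smul, inner_smul_left, conj_conj, ← inner_smul_right,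
    ← map_smul]
  exact congrArg (fun u => inner ℂ (K ħ hħ (s : L2R)) (toL2 u)) (h.q k w)

/-- On the Schwartz space `v₁` acts as multiplication by `exp(x/d)`. -/
theorem hat_v1_ae (h : IsFactor ħ hħ c d ι) (s : schwartzL ħ hħ) :
    hat ħ hħ (ι (gv 1)) s =ᵐ[volume] fun x => (Real.exp (1 / d * x) : ℂ) * (s : L2R) x := by
  have := ae_eq_of_expMul (s := (s : L2R)) (t := hat ħ hħ (ι (gv 1)) s) (l := 1) (β := 1 / d)
    fun w => by
      rw [inner_hat, h.star_gv, one_mul]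
      exact congrArg (fun u => inner ℂ (s : L2R) (toL2 u)) (h.v1 w)
  simpa using this

theorem intertwines_v0 (h : IsFactor ħ hħ c d ι) : Intertwines ħ hħ (ι (gv 0)) := by
  intro s w
  rw [h.star_gv, h.gamma_gv]
  have e : repL ħ hħ (ι (gv 0)) w = shiftLin ((-(2 * Real.pi * c) : ℝ) * I) w := h.v0 w
  rw [e, inner_K, inner_K]
  refine integral_congr_ae ?_
  filter_upwards [mulDilog_ae (ħ := ħ) (s : L2R),
    mulDilog_ae (ħ := ħ) (hat ħ hħ (ι (gv (0 + 1))) s), h.hat_v1_ae s] with x h1 h2 h3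
  have h3' : hat ħ hħ (ι (gv (0 + 1))) s x = (Real.exp (1 / d * x) : ℂ) * (s : L2R) x := h3
  rw [h1, h2, h3', W_fourier_shift, map_mul, map_mul, map_mul, conj_ofReal]
  have hd := h.per.d_pos.ne'
  have hc := h.per.c_pos.ne'
  have e2 : -(x / (2 * Real.pi * ħ)) * -(2 * Real.pi * c) = 1 / d * x := by
    rw [← h.mul]; field_simp
  rw [e2]; ring

/-- `s`, `v₂ s` and `v₀ v₂ s` form a triple to which the contour argument applies. -/
theorem dilogTriple (h : IsFactor ħ hħ c d ι) (s : schwartzL ħ hħ) :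
    DilogTriple c d (contourHeight ħ) s (hat ħ hħ (ι (gv 2)) s)
      (hat ħ hħ (ι (gv 0)) (hatS (ι (gv 2)) s)) (mulDilog ħ s)
      (mulDilog ħ (hat ħ hħ (ι (gv 2)) s)) where
  per := h.per
  shift := isShift_of_inner fun w => by
    rw [inner_hat, h.star_gv]
    exact congrArg (fun u => inner ℂ (hat ħ hħ (ι (gv 2)) s) (toL2 u)) (h.v0 w)
  ae_t := by
    set t := hat ħ hħ (ι (gv 0)) (hatS (ι (gv 2)) s)
    have ht' : t = hat ħ hħ (ι (gv 0) * ι (gv 2)) s := (hat_mul _ _ _).symm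
    have h1 := ae_eq_of_expMul (s := (s : L2R)) (t := t - s)
      (l := exp (Real.pi * I * c / d)) (β := 1 / d) fun w => by
        have e : repL ħ hħ (ι (gv 2) * ι (gv 0)) w =
            w + exp (Real.pi * I * c / d) • expMulLin (1 / d : ℝ) w := by
          rw [← map_mul ι, v2_mul_v0, map_add, map_one, map_mul, map_add, map_mul, map_one,
            LinearMap.add_apply, Module.End.mul_apply, Module.End.one_apply]
          congr 1
          refine (h.q 1 _).trans ?_
          rw [Int.cast_one, one_mul]
          exact congrArg _ (h.v1 w)
        rw [inner_sub_left, ht', inner_hat, starL_mul, h.star_gv, h.star_gv, e, map_add,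
          map_smul, inner_add_right, inner_smul_right]
        ring
    filter_upwards [h1, Lp.coeFn_sub t (s : L2R)] with x hx hx'
    rw [hx', Pi.sub_apply, sub_eq_iff_eq_add] at hx
    rw [hx, add_mul, one_mul, add_comm]
    congr 2
    rw [← exp_conj, ofReal_exp, ← exp_add]
    congr 1
    simp only [map_div₀, map_mul, conj_ofReal, conj_I]
    push_cast; ring
  ae_σ := by
    filter_upwards [mulDilog_ae (ħ := ħ) (s : L2R)] with x hx
    rw [hx, h.dilog]
  ae_ρ := by
    filter_upwards [mulDilog_ae (ħ := ħ) (hat ħ hħ (ι (gv 2)) s)] with x hx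
    rw [hx, h.dilog]

/-- `Φ v₂ s` is the imaginary translate of `Φ s`. In a factor with `c > d` the translate exists in
`L²(ℝ)` because it does, arbitrarily far, for the other factor `ι'`. -/
theorem isShift_v2 (h : IsFactor ħ hħ c d ι) {ι' : Lq →ₐ[ℤ] LAlg} (h' : IsFactor ħ hħ d c ι')
    (s : schwartzL ħ hħ) :
    IsShift (2 * Real.pi * c) (mulDilog ħ s) (mulDilog ħ (hat ħ hħ (ι (gv 2)) s)) := by
  rcases le_total c d with hcd | hdc
  · exact (h.dilogTriple s).isShift_of_le hcd
  · have hN : ∀ N : ℕ, ∃ u : schwartzL ħ hħ,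
        IsShift (N * (2 * Real.pi * d)) (mulDilog ħ s) (mulDilog ħ u) := by
      intro N
      induction N with
      | zero => exact ⟨s, by simp [IsShift]⟩
      | succ N ih =>
        obtain ⟨u, hu⟩ := ih
        have h2 : IsShift (2 * Real.pi * d) (mulDilog ħ u) (mulDilog ħ (hat ħ hħ (ι' (gv 2)) u)) :=
          (h'.dilogTriple u).isShift_of_le hdc
        refine ⟨hatS (ι' (gv 2)) u, ?_⟩
        have h3 := hu.trans h2
        have e : (N : ℝ) * (2 * Real.pi * d) + 2 * Real.pi * d =
            ((N + 1 : ℕ) : ℝ) * (2 * Real.pi * d) := by push_cast; ring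
        rwa [e] at h3
    have hd := h.per.d_pos
    have hc := h.per.c_pos
    obtain ⟨N, hNc⟩ := exists_nat_ge (c / d)
    obtain ⟨u, hu⟩ := hN N
    obtain ⟨τ, hτ⟩ := hu.interpolate (b' := 2 * Real.pi * c) (by positivity) (by
      rw [div_le_iff₀ hd] at hNc
      nlinarith [Real.pi_pos])
    exact (h.dilogTriple s).isShift_of_exists hτ

theorem intertwines_v1 (h : IsFactor ħ hħ c d ι) {ι' : Lq →ₐ[ℤ] LAlg} (h' : IsFactor ħ hħ d c ι') :
    Intertwines ħ hħ (ι (gv 1)) := by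
  intro s w
  rw [h.star_gv, h.gamma_gv]
  have e : repL ħ hħ (ι (gv 1)) w = expMulLin (1 / d : ℝ) w := h.v1 w
  rw [e]
  exact K_of_isShift h.mul (h.isShift_v2 h' s) w

theorem surjective_v0 (h : IsFactor ħ hħ c d ι) :
    Function.Surjective (repL ħ hħ (ι (gv 0))) := by
  intro w
  refine ⟨shiftLin (-((-(2 * Real.pi * c) : ℝ) * I)) w, ?_⟩
  refine (h.v0 _).trans (Subtype.ext (funext fun z => ?_))
  change w.1 (z + _ + -_) = _
  rw [add_neg_cancel_right]

theorem surjective_v1 (h : IsFactor ħ hħ c d ι) :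
    Function.Surjective (repL ħ hħ (ι (gv 1))) := by
  intro w
  refine ⟨expMulLin (-(1 / d : ℝ)) w, ?_⟩
  refine (h.v1 _).trans (Subtype.ext (funext fun z => ?_))
  change exp _ * (exp _ * w.1 z) = _
  rw [← mul_assoc, ← exp_add, neg_mul, add_neg_cancel, exp_zero, one_mul]

/-- The relation holds for all elements of a factor: by the exchange relations, it holds for `v₂`,
`v₃`, `v₄` because it holds for `v₀` and `v₁`, which are invertible on `W`. -/
theorem intertwines (h : IsFactor ħ hħ c d ι) {ι' : Lq →ₐ[ℤ] LAlg} (h' : IsFactor ħ hħ d c ι')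
    (x : Lq) : Intertwines ħ hħ (ι x) := by
  have h0 := h.intertwines_v0
  have h1 := h.intertwines_v1 h'
  have hone : Intertwines ħ hħ (1 : LAlg) := (intertwiners ħ hħ).one_mem
  have h2 : Intertwines ħ hħ (ι (gv 2)) := by
    refine Intertwines.of_mul ?_ h0 h.surjective_v0
    rw [← map_mul, v2_mul_v0, map_add, map_one, map_mul]
    exact hone.add ((h.intertwines_gq 1).mul h1)
  have h4 : Intertwines ħ hħ (ι (gv 4)) := by
    refine Intertwines.of_mul ?_ h1 h.surjective_v1
    rw [← map_mul, v4_mul_v1, map_add, map_one, map_mul]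
    exact hone.add ((h.intertwines_gq (-1)).mul h0)
  have h3 : Intertwines ħ hħ (ι (gv 3)) := by
    refine Intertwines.of_mul ?_ h0 h.surjective_v0
    rw [← map_mul, v3_mul_v0, map_add, map_one, map_mul]
    exact hone.add ((h.intertwines_gq (-1)).mul h4)
  refine Lq_subalgebra_eq_top ((intertwiners ħ hħ).comap ι) h.intertwines_gq (fun i => ?_) x
  fin_cases i
  exacts [h0, h1, h2, h3, h4]

end IsFactor

theorem intertwines_all {ħ : ℝ} (hħ : 0 < ħ) (B : LAlg) : Intertwines ħ hħ B := by
  induction B using TensorProduct.induction_on with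
  | zero => exact (intertwiners ħ hħ).zero_mem
  | add B C hB hC => exact hB.add hC
  | tmul x y =>
    have hx := isFactor_left.intertwines (hħ := hħ) isFactor_right x
    have hy := isFactor_right.intertwines (hħ := hħ) isFactor_left y
    have := hx.mul hy
    rwa [Algebra.TensorProduct.includeLeft_apply, Algebra.TensorProduct.includeRight_apply,
      Algebra.TensorProduct.tmul_mul_tmul, mul_one, one_mul] at this

theorem K_mem_schwartzL {ħ : ℝ} (hħ : 0 < ħ) (s : L2R) (hs : s ∈ schwartzL ħ hħ) :
    K ħ hħ s ∈ schwartzL ħ hħ :=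
  mem_schwartzL_of_exists fun B => ⟨K ħ hħ (hat ħ hħ (gamma (starL B)) ⟨s, hs⟩), fun w =>
    (intertwines_all hħ B ⟨s, hs⟩ w).symm⟩

end QuantumM05

end

theorem theorem2p4 (ħ : ℝ) (hħ : 0 < ħ) :
    ∃ hK : ∀ s ∈ QuantumM05.schwartzL ħ hħ, QuantumM05.K ħ hħ s ∈ QuantumM05.schwartzL ħ hħ,
      ∀ (A : QuantumM05.LAlg) (s : QuantumM05.schwartzL ħ hħ),
        (QuantumM05.K ħ hħ).symm
            (QuantumM05.hat ħ hħ A ⟨QuantumM05.K ħ hħ s, hK s s.2⟩) =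
          QuantumM05.hat ħ hħ (QuantumM05.gamma A) s := by
  refine ⟨QuantumM05.K_mem_schwartzL hħ, fun A s => ?_⟩
  rw [ContinuousLinearEquiv.symm_apply_eq]
  refine QuantumM05.eq_of_inner_W fun w => ?_
  rw [QuantumM05.inner_hat, QuantumM05.intertwines_all hħ (QuantumM05.starL A) s w,
    QuantumM05.starL_starL]
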